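/- Consider the Hamiltonian $H(x,y)=\frac12y^2-\frac12x^2+\frac14x^4$, which has centers at $C=(1,0)$ and $C^*=(-1,0)$, and its cubic perturbations $$\dot x=H_y+\varepsilon f(x,y),\qquad \dot y=-H_x+\varepsilon g(x,y),\qquad f=\sum_{0\le i+j\le 3}a_{ij}x^iy^j,\quad g=\sum_{0\le i+j\le3}b_{ij}x^iy^j, \qquad (1)$$ with real coefficients $a_{ij},b_{ij}$ that do not depend on $\varepsilon$. A limit cycle is an isolated periodic orbit. For a point $P$ and $r>0$ let $N_P(r)\in\{0,1,2,\dots,\infty\}$ be the number of limit cycles of (1) contained in the open $r$-neighbourhood of $P$ (a square, i.e. a ball of the maximum norm). Say that the distribution $m+n$ of small-amplitude limit cycles is possible if for every sufficiently small $r>0$ there are $f,g$ as above such that for all sufficiently small $\varepsilon\ne0$ system (1) satisfies $N_C(r)=m$ and $N_{C^*}(r)=n$. Theorem 4. The following are the maximal possible distributions of small-amplitude limit cycles of (1): $5+0$, $0+5$, $4+1$, $1+4$, $3+3$. That is: (i) each of these five distributions is possible; (ii) they are maximal: there is $r>0$ such that for all $f,g$ as above and all sufficiently small $\varepsilon\neq0$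 (how small may depend on $f,g$) there is a distribution $m+n$ in the list with $N_C(r)\le m$ and $N_{C^*}(r)\le n$. -/

import Mathlib

open Filter Topology

/-- The symmetric eight-loop Hamiltonian `H(x, y) = y² / 2 - x² / 2 + x⁴ / 4`. -/
noncomputable def eightLoop (x y : ℝ) : ℝ := y ^ 2 / 2 - x ^ 2 / 2 + x ^ 4 / 4

/-- `∂H/∂y = y`. -/
theorem eightLoop_hasDerivAt_snd (x y : ℝ) :
    HasDerivAt (fun v => eightLoop x v) y y := by
  have h := (((hasDerivAt_pow 2 y).div_const 2).sub_const (x ^ 2 / 2)).add_const (x ^ 4 / 4)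
  exact h.congr_deriv (by norm_num)

/-- `∂H/∂x = x³ - x`. -/
theorem eightLoop_hasDerivAt_fst (x y : ℝ) :
    HasDerivAt (fun u => eightLoop u y) (x ^ 3 - x) x := by
  have h := (((hasDerivAt_pow 2 x).div_const 2).const_sub (y ^ 2 / 2)).add
    ((hasDerivAt_pow 4 x).div_const 4)
  exact h.congr_deriv (by norm_num; ring)

/-- The polynomial `∑_{i + j ≤ 3} c i j * x ^ i * y ^ j`. -/
def cubicPoly (c : ℕ → ℕ → ℝ) (x y : ℝ) : ℝ :=
  ∑ i ∈ Finset.range 4, ∑ j ∈ Finset.range (4 - i), c i j * x ^ i * y ^ j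

/-- The vector field of `ẋ = H_y + ε f(x, y)`, `ẏ = -H_x + ε g(x, y)`, where `f` and `g` are the
cubic polynomials with coefficients `a` and `b`. -/
def perturbedField (a b : ℕ → ℕ → ℝ) (ε : ℝ) (p : ℝ × ℝ) : ℝ × ℝ :=
  (p.2 + ε * cubicPoly a p.1 p.2, -(p.1 ^ 3 - p.1) + ε * cubicPoly b p.1 p.2)

/-- `Γ` is a periodic orbit of `X`: the trace of a nonconstant periodic solution of `γ' = X(γ)`. -/
def IsPeriodicOrbit (X : ℝ × ℝ → ℝ × ℝ) (Γ : Set (ℝ × ℝ)) : Prop :=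
  ∃ (γ : ℝ → ℝ × ℝ) (T : ℝ), 0 < T ∧ (∀ t, HasDerivAt γ (X (γ t)) t) ∧
    Function.Periodic γ T ∧ (∃ t, γ t ≠ γ 0) ∧ Set.range γ = Γ

/-- A limit cycle: a periodic orbit that has a neighbourhood meeting no other periodic orbit. -/
def IsLimitCycle (X : ℝ × ℝ → ℝ × ℝ) (Γ : Set (ℝ × ℝ)) : Prop :=
  IsPeriodicOrbit X Γ ∧ ∃ U : Set (ℝ × ℝ), IsOpen U ∧ Γ ⊆ U ∧
    ∀ Γ' : Set (ℝ × ℝ), IsPeriodicOrbit X Γ' → (Γ' ∩ U).Nonempty → Γ' = Γ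

/-- The number (possibly infinite) of limit cycles of `X` lying in the neighbourhood of radius `r`
of the point `P`. -/
noncomputable def numLimitCycles (X : ℝ × ℝ → ℝ × ℝ) (P : ℝ × ℝ) (r : ℝ) : ℕ∞ :=
  {Γ : Set (ℝ × ℝ) | IsLimitCycle X Γ ∧ Γ ⊆ Metric.ball P r}.encard

/-- The distribution `m + n` of small-amplitude limit cycles is possible: for every sufficiently
small `r > 0` there are `f` and `g` such that for all sufficiently small `ε ≠ 0` the perturbed
system has exactly `m` limit cycles in the `r`-neighbourhood of the center `C = (1, 0)` and exactly
`n` limit cycles in the `r`-neighbourhood of the center `C* = (-1, 0)`. -/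
def SmallAmplitudeDistribution (m n : ℕ) : Prop :=
  ∀ᶠ r in 𝓝[>] (0 : ℝ), ∃ a b : ℕ → ℕ → ℝ, ∀ᶠ ε in 𝓝[≠] (0 : ℝ),
    numLimitCycles (perturbedField a b ε) (1, 0) r = m ∧
    numLimitCycles (perturbedField a b ε) (-1, 0) r = n

/-- The list `5 + 0`, `0 + 5`, `4 + 1`, `1 + 4`, `3 + 3`. -/
def maximalDistributions : Finset (ℕ × ℕ) := {(5, 0), (0, 5), (4, 1), (1, 4), (3, 3)}

/-! In the coordinates u = x² − 1, v = √2 y the Hamiltonian is (u² + v²)/4 − 1/4, so the unperturbed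
orbits around C are exact circles. In polar coordinates about the perturbed equilibrium the system
becomes dρ/dθ = S with S = 0 at ε = 0, and limit cycles correspond to isolated positive fixed points
of a monotone return map.

Let Ω be the one-form annihilating the field. An identity dW = μΩ + εᵏη (`Reduction`) turns the
increment of W over one turn into εᵏ times an integral of η that is smooth in (ρ, ε) and equals the
Melnikov integral M(ρ) at ε = 0. If the derivative of M of order 2j + 2 has no zero on [−R, R],
Rolle's theorem leaves at most 2j + 2 zeros for small ε. The origin is one of them and every cycle
accounts for two, so there are at most j cycles. Conversely, sign changes of M produce cycles.

Françoise's algorithm yields such identities for k = 1, 2, 3, 4. In each case M is `cycleIntegral v`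
for some v in ℝ⁶, a combination of the integrals of y, x²y, y³, x²y³, xy and xy³. The center C* sees
the same vector with the last two signs reversed (`flipOdd`). Either one of these vectors is
nonzero, or the system is Hamiltonian, reversible or pulled back by a fold, and then it has no limit
cycles near either center (`exists_melnikovVector_or_isCenterPerturbation`).

The upper bound is now linear algebra on the first six Taylor coefficients of M:
`exists_orderCoeff_ne_zero` puts the pair of orders at the two centers below a member of the list.
Compactness of the unit sphere of vectors v gives one radius valid for all perturbations
(`exists_uniform_radius`).

For existence, the second order vector takes every value in ℝ⁶ (`exists_secondVector_eq`). Five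
prescribed zeros are five linear conditions on v; for 3 + 3 one takes v with its last two entries
zero, so that three zeros serve both centers. The list is an antichain, so the orders must equal the
prescribed numbers of zeros. The zeros are then simple (`sign_change_of_zeros`), and the lower and
upper bounds meet. -/

open scoped ContDiff

/-! ### Superposition operators on spaces of continuous functions are smooth. -/

section Nemytskii

variable {K V W M : Type} [TopologicalSpace K] [CompactSpace K]
  [NormedAddCommGroup V] [NormedSpace ℝ V] [NormedAddCommGroup W] [NormedSpace ℝ W]
  [NormedAddCommGroup M] [NormedSpace ℝ M]

/-- Pointwise application of a continuous family of continuous linear maps. -/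
noncomputable def pointwiseApply : C(K, V →L[ℝ] W) →L[ℝ] C(K, V) →L[ℝ] C(K, W) :=
  LinearMap.mkContinuous₂
    (LinearMap.mk₂ ℝ (fun (A : C(K, V →L[ℝ] W)) (h : C(K, V)) =>
      (⟨fun k => A k (h k), by fun_prop⟩ : C(K, W)))
      (fun A₁ A₂ h => by ext k; simp) (fun c A h => by ext k; simp)
      (fun A h₁ h₂ => by ext k; simp) (fun c A h => by ext k; simp))
    1 (fun A h => by
      refine (ContinuousMap.norm_le _ (by positivity)).2 fun k => ?_
      calc ‖A k (h k)‖ ≤ ‖A k‖ * ‖h k‖ := (A k).le_opNorm _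
        _ ≤ 1 * ‖A‖ * ‖h‖ := by
          rw [one_mul]
          exact mul_le_mul (A.norm_coe_le_norm k) (h.norm_coe_le_norm k) (norm_nonneg _)
            (by positivity))

@[simp] theorem pointwiseApply_apply (A : C(K, V →L[ℝ] W)) (h : C(K, V)) (k : K) :
    pointwiseApply A h k = A k (h k) := rfl

/-- The mean value inequality is applied at every point of K with one and the same δ, which sup-norm
continuity of w ↦ F' ∘ w provides. -/
theorem hasFDerivAt_postcomp (F : C(V, W)) (F' : C(V, V →L[ℝ] W))
    (hF : ∀ x, HasFDerivAt F (F' x) x) (u : C(K, V)) :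
    HasFDerivAt (fun u : C(K, V) => F.comp u) (pointwiseApply (F'.comp u)) u := by
  rw [hasFDerivAt_iff_isLittleO_nhds_zero, Asymptotics.isLittleO_iff]
  intro ε hε
  have hc : ContinuousAt (fun w : C(K, V) => F'.comp w) u :=
    (ContinuousMap.continuous_postcomp F').continuousAt
  obtain ⟨δ, hδ, h⟩ := (Metric.continuousAt_iff (f := fun w : C(K, V) => F'.comp w)).1 hc ε hε
  filter_upwards [Metric.ball_mem_nhds (0 : C(K, V)) hδ] with v hv
  rw [ContinuousMap.norm_le _ (by positivity)]
  intro k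
  have hv' : ‖v‖ < δ := by simpa using hv
  have key := Convex.norm_image_sub_le_of_norm_hasFDerivWithin_le' (f := F) (f' := F')
    (φ := F' (u k)) (s := Metric.ball (u k) δ) (x := u k) (y := u k + v k) (C := ε)
    (fun x _ => (hF x).hasFDerivWithinAt) (fun x hx => by
      -- The translate of u by the constant x − u k is as close to u as x is to u k and takes the
      -- value x at k, so continuity in the sup norm controls F' at the single point x.
      have hw : dist (u + ContinuousMap.const K (x - u k)) u < δ := by
        rw [dist_eq_norm, add_sub_cancel_left]
        refine lt_of_le_of_lt ?_ (mem_ball_iff_norm.1 hx)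
        rw [ContinuousMap.norm_le _ (norm_nonneg _)]
        intro k; simp
      have h1 := h hw
      have h2 := (ContinuousMap.dist_apply_le_dist k).trans h1.le
      rw [dist_eq_norm] at h2
      simpa using h2) (convex_ball _ _) (Metric.mem_ball_self hδ)
    (by
      rw [mem_ball_iff_norm, add_sub_cancel_left]
      exact (v.norm_coe_le_norm k).trans_lt hv')
  rw [add_sub_cancel_left] at key
  calc _ ≤ ε * ‖v k‖ := by simpa using key
    _ ≤ ε * ‖v‖ := by gcongr; exact v.norm_coe_le_norm k

/-- The derivative is again a superposition operator, followed by the continuous linear map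
`pointwiseApply`. The target W varies in the induction because F' has values in V →L[ℝ] W. -/
theorem contDiff_postcomp_nat (n : ℕ) : ∀ {W : Type} [NormedAddCommGroup W] [NormedSpace ℝ W]
    (F : C(V, W)), ContDiff ℝ n F → ContDiff ℝ n (fun u : C(K, V) => F.comp u) := by
  induction n with
  | zero =>
    intro W _ _ F _
    rw [Nat.cast_zero, contDiff_zero]
    exact ContinuousMap.continuous_postcomp F
  | succ n ih =>
    intro W _ _ F hF
    push_cast at hF ⊢
    rw [contDiff_succ_iff_hasFDerivAt] at hF ⊢
    obtain ⟨F', hF', hd⟩ := hF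
    have := ih ⟨F', hF'.continuous⟩ hF'
    exact ⟨_, (pointwiseApply (K := K) (V := V) (W := W)).contDiff.comp this,
      hasFDerivAt_postcomp F ⟨F', hF'.continuous⟩ hd⟩

theorem contDiff_postcomp (F : C(V, W)) (hF : ContDiff ℝ ∞ F) :
    ContDiff ℝ ∞ (fun u : C(K, V) => F.comp u) :=
  contDiff_infty.2 fun n => contDiff_postcomp_nat n F (contDiff_infty.1 hF n)

/-- Constant functions, as a continuous linear map. -/
noncomputable def constL (K : Type) [TopologicalSpace K] [CompactSpace K] :
    M →L[ℝ] C(K, M) :=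
  LinearMap.mkContinuous
    { toFun := fun m => ContinuousMap.const K m
      map_add' := fun _ _ => rfl
      map_smul' := fun _ _ => rfl } 1 (fun m => by
      refine (ContinuousMap.norm_le _ (by positivity)).2 fun k => ?_
      rw [one_mul]
      exact le_rfl)

@[simp] theorem constL_apply (m : M) (k : K) : constL K m k = m := rfl

/-- Here (y, m) ↦ (κ, y, const m) is an affine continuous map into C(K, ℝ × V × M), so the result
follows by postcomposition with F. -/
theorem contDiff_nemytskii (κ : C(K, ℝ)) (F : ℝ × V × M → W) (hF : ContDiff ℝ ∞ F) :
    ContDiff ℝ ∞ (fun p : C(K, V) × M =>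
      (⟨fun k => F (κ k, p.1 k, p.2), by have := hF.continuous; fun_prop⟩ : C(K, W))) := by
  have h1 : ContDiff ℝ ∞ (fun p : C(K, V) × M =>
      ((ContinuousLinearMap.inl ℝ ℝ (V × M)).compLeftContinuous ℝ K κ +
        ((ContinuousLinearMap.inr ℝ ℝ (V × M)).compLeftContinuous ℝ K
          ((ContinuousLinearMap.inl ℝ V M).compLeftContinuous ℝ K p.1 +
           (ContinuousLinearMap.inr ℝ V M).compLeftContinuous ℝ K (constL K p.2))))) := by
    refine contDiff_const.add ((ContinuousLinearMap.contDiff _).comp ?_)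
    exact ((ContinuousLinearMap.contDiff _).comp contDiff_fst).add
      ((ContinuousLinearMap.contDiff _).comp ((ContinuousLinearMap.contDiff _).comp contDiff_snd))
  have h2 := (contDiff_postcomp (K := K) ⟨F, hF.continuous⟩ hF).comp h1
  convert h2 using 2 with p
  ext k
  simp

end Nemytskii

/-! ### Smooth dependence of integrals on parameters. -/

section Integrals

variable {W M : Type} [NormedAddCommGroup W] [NormedSpace ℝ W]
  [NormedAddCommGroup M] [NormedSpace ℝ M]

/-- The primitive, vanishing at `0`, of a continuous function on `[0, T]`. -/
noncomputable def primitiveL (T : ℝ) (hT : 0 ≤ T) :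
    C(Set.Icc (0 : ℝ) T, W) →L[ℝ] C(Set.Icc (0 : ℝ) T, W) :=
  have hi : ∀ (f : C(Set.Icc (0 : ℝ) T, W)) (a b : ℝ),
      IntervalIntegrable (Set.IccExtend hT f) MeasureTheory.volume a b := fun f a b =>
    (f.continuous.Icc_extend' (h := hT)).intervalIntegrable a b
  LinearMap.mkContinuous
    { toFun := fun f => ⟨fun t => ∫ s in (0 : ℝ)..t, Set.IccExtend hT f s,
        (intervalIntegral.continuous_primitive (hi f) 0).comp continuous_subtype_val⟩
      map_add' := fun f g => by
        ext t
        simp only [ContinuousMap.coe_mk, ContinuousMap.add_apply]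
        rw [← intervalIntegral.integral_add (hi f _ _) (hi g _ _)]
        rfl
      map_smul' := fun c f => by
        ext t
        simp only [ContinuousMap.coe_mk, ContinuousMap.smul_apply, RingHom.id_apply]
        rw [← intervalIntegral.integral_smul]
        rfl }
    T (fun f => by
      refine (ContinuousMap.norm_le _ (by positivity)).2 fun t => ?_
      have := intervalIntegral.norm_integral_le_of_norm_le_const (a := 0) (b := (t : ℝ))
        (C := ‖f‖) (f := Set.IccExtend hT f) (fun s _ => f.norm_coe_le_norm _)
      calc _ ≤ ‖f‖ * |(t : ℝ) - 0| := this
        _ ≤ ‖f‖ * T := by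
          gcongr
          rw [sub_zero, abs_of_nonneg t.2.1]
          exact t.2.2
        _ = T * ‖f‖ := mul_comm _ _)

theorem primitiveL_apply {T : ℝ} (hT : 0 ≤ T) (f : C(Set.Icc (0 : ℝ) T, W)) (t : Set.Icc 0 T) :
    primitiveL T hT f t = ∫ s in (0 : ℝ)..t, Set.IccExtend hT f s := rfl

/-- Evaluation at a point, as a continuous linear map. -/
noncomputable def evalL {K : Type} [TopologicalSpace K] [CompactSpace K] (k : K) :
    C(K, W) →L[ℝ] W :=
  LinearMap.mkContinuous
    { toFun := fun f => f k
      map_add' := fun _ _ => rfl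
      map_smul' := fun _ _ => rfl } 1 (fun f => by
      simpa using f.norm_coe_le_norm k)

@[simp] theorem evalL_apply {K : Type} [TopologicalSpace K] [CompactSpace K] (k : K)
    (f : C(K, W)) : evalL k f = f k := rfl

/-- The integral is a superposition operator followed by the linear maps "primitive" and "evaluation
at T"; the function argument of the superposition operator is a dummy, set to 0. -/
theorem contDiff_parametric_integral {T : ℝ} (hT : 0 ≤ T) (F : ℝ × M → W)
    (hF : ContDiff ℝ ∞ F) : ContDiff ℝ ∞ (fun m => ∫ t in (0 : ℝ)..T, F (t, m)) := by
  let κ : C(Set.Icc (0 : ℝ) T, ℝ) := ⟨Subtype.val, continuous_subtype_val⟩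
  have h := contDiff_nemytskii κ (fun p : ℝ × ℝ × M => F (p.1, p.2.2))
    (hF.comp (contDiff_fst.prodMk (contDiff_snd.snd)))
  have h2 := (((evalL (W := W) (⟨T, hT, le_rfl⟩ : Set.Icc 0 T)).comp
    (primitiveL T hT)).contDiff (n := ∞)).comp (h.comp
    ((contDiff_const (c := (0 : C(Set.Icc (0 : ℝ) T, ℝ)))).prodMk contDiff_id))
  convert h2 using 2 with m
  simp only [Function.comp, ContinuousLinearMap.comp_apply, evalL_apply, primitiveL_apply, id]
  refine intervalIntegral.integral_congr fun t ht => ?_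
  rw [Set.uIcc_of_le hT] at ht
  rw [Set.IccExtend_of_mem hT _ ht]
  rfl

end Integrals

/-! ### Hadamard quotients: smooth division by the radius. -/

/-- The Hadamard quotient `∫₀¹ DA(q + sρe) e ds`. -/
noncomputable def hadamardQuotient (A : ℝ × ℝ → ℝ) (q e : ℝ × ℝ) (ρ : ℝ) : ℝ :=
  ∫ s in (0 : ℝ)..1, fderiv ℝ A (q + (s * ρ) • e) e

theorem contDiff_hadamardQuotient {A : ℝ × ℝ → ℝ} (hA : ContDiff ℝ ∞ A) :
    ContDiff ℝ ∞ (fun m : (ℝ × ℝ) × (ℝ × ℝ) × ℝ => hadamardQuotient A m.1 m.2.1 m.2.2) := by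
  refine contDiff_parametric_integral zero_le_one
    (fun p : ℝ × (ℝ × ℝ) × (ℝ × ℝ) × ℝ =>
      fderiv ℝ A (p.2.1 + (p.1 * p.2.2.2) • p.2.2.1) p.2.2.1) ?_
  have : ContDiff ℝ ∞ (fderiv ℝ A) := hA.fderiv_right (m := ∞) (by simp)
  fun_prop

/-- The fundamental theorem of calculus along s ↦ q + sρe. This is what lets the polar field be
divided by ρ and remain smooth across ρ = 0. -/
theorem mul_hadamardQuotient {A : ℝ × ℝ → ℝ} (hA : ContDiff ℝ ∞ A) (q e : ℝ × ℝ) (ρ : ℝ) :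
    ρ * hadamardQuotient A q e ρ = A (q + ρ • e) - A q := by
  have hd : ∀ s : ℝ, HasDerivAt (fun s : ℝ => A (q + (s * ρ) • e))
      (fderiv ℝ A (q + (s * ρ) • e) (ρ • e)) s := fun s => by
    have h1 : HasFDerivAt A (fderiv ℝ A (q + (s * ρ) • e)) (q + (s * ρ) • e) :=
      (hA.differentiable (by simp) _).hasFDerivAt
    have h2 : HasDerivAt (fun s : ℝ => q + (s * ρ) • e) (ρ • e) s := by
      simpa using (((hasDerivAt_id s).mul_const ρ).smul_const e).const_add q
    exact h1.comp_hasDerivAt s h2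
  have hc : Continuous (fderiv ℝ A) := (hA.fderiv_right (m := ∞) (by simp)).continuous
  have := intervalIntegral.integral_eq_sub_of_hasDerivAt (a := 0) (b := 1)
    (fun s _ => hd s) (by apply Continuous.intervalIntegrable; fun_prop)
  simp only [one_mul, zero_mul, zero_smul, add_zero, map_smul, smul_eq_mul] at this
  rw [← this, hadamardQuotient, intervalIntegral.integral_const_mul]

/-! ### Iterated Rolle theorem. -/

section Rolle

/-- A function with at least `n + 1` zeros on an interval has an `n`-th derivative with a zero. -/
theorem exists_zero_of_card_zeros {a b : ℝ} (n : ℕ) : ∀ (F : ℕ → ℝ → ℝ),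
    (∀ i < n, ∀ x ∈ Set.Icc a b, HasDerivAt (F i) (F (i + 1) x) x) →
    ∀ s : Finset ℝ, (∀ x ∈ s, x ∈ Set.Icc a b ∧ F 0 x = 0) → n < s.card →
    ∃ x ∈ Set.Icc a b, F n x = 0 := by
  induction n with
  | zero =>
    intro F _ s hs hc
    obtain ⟨x, hx⟩ := Finset.card_pos.1 hc
    exact ⟨x, hs x hx⟩
  | succ n ih =>
    intro F hF s hs hc
    obtain ⟨m, hm⟩ : ∃ m, s.card = m + 1 := ⟨s.card - 1, by omega⟩
    let e : Fin (m + 1) ↪o ℝ := s.orderEmbOfFin hm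
    have he : ∀ i, e i ∈ s := fun i => s.orderEmbOfFin_mem hm i
    have hex : ∀ i : Fin m, ∃ c ∈ Set.Ioo (e i.castSucc) (e i.succ), F 1 c = 0 := by
      intro i
      have hlt : e i.castSucc < e i.succ := e.strictMono i.castSucc_lt_succ
      have hsub : Set.Icc (e i.castSucc) (e i.succ) ⊆ Set.Icc a b :=
        Set.Icc_subset_Icc (hs _ (he _)).1.1 (hs _ (he _)).1.2
      refine exists_hasDerivAt_eq_zero hlt
        (fun x hx => (hF 0 (by omega) x (hsub hx)).continuousAt.continuousWithinAt) ?_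
        (fun x hx => hF 0 (by omega) x (hsub (Set.Ioo_subset_Icc_self hx)))
      rw [(hs _ (he _)).2, (hs _ (he _)).2]
    choose c hc1 hc2 using hex
    have hmono : StrictMono c := by
      intro i j hij
      calc c i < e i.succ := (hc1 i).2
        _ ≤ e j.castSucc := e.monotone (by
          rw [Fin.le_def]; simpa using hij)
        _ < c j := (hc1 j).1
    obtain ⟨x, hx, hx0⟩ := ih (fun i => F (i + 1))
      (fun i hi x hx => hF (i + 1) (by omega) x hx)
      (Finset.univ.map ⟨c, hmono.injective⟩) (by
        intro x hx
        obtain ⟨i, -, rfl⟩ := Finset.mem_map.1 hx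
        refine ⟨⟨?_, ?_⟩, hc2 i⟩
        · exact (hs _ (he _)).1.1.trans (hc1 i).1.le
        · exact (hc1 i).2.le.trans (hs _ (he _)).1.2) (by simp; omega)
    exact ⟨x, hx, hx0⟩

end Rolle

/-! ### Counting zeros uniformly in a small parameter. -/

section PartialDerivatives

/-- The partial derivative with respect to the first variable. -/
noncomputable def partialFst (F : ℝ × ℝ → ℝ) (z : ℝ × ℝ) : ℝ := fderiv ℝ F z (1, 0)

theorem ContDiffAt.partialFst {F : ℝ × ℝ → ℝ} {z : ℝ × ℝ} (h : ContDiffAt ℝ ∞ F z) :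
    ContDiffAt ℝ ∞ (partialFst F) z :=
  (h.fderiv_right (m := ∞) (by simp)).clm_apply contDiffAt_const

theorem ContDiffAt.iterate_partialFst {F : ℝ × ℝ → ℝ} {z : ℝ × ℝ} (h : ContDiffAt ℝ ∞ F z)
    (i : ℕ) : ContDiffAt ℝ ∞ (_root_.partialFst^[i] F) z := by
  induction i with
  | zero => exact h
  | succ i ih => rw [Function.iterate_succ_apply']; exact ih.partialFst

theorem hasDerivAt_partialFst {F : ℝ × ℝ → ℝ} {ρ ε : ℝ} (h : DifferentiableAt ℝ F (ρ, ε)) :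
    HasDerivAt (fun r => F (r, ε)) (partialFst F (ρ, ε)) ρ :=
  h.hasFDerivAt.comp_hasDerivAt ρ ((hasDerivAt_id ρ).prodMk (hasDerivAt_const ρ ε))

theorem iterate_partialFst_eq_iteratedDeriv {F : ℝ × ℝ → ℝ} {ε : ℝ}
    (h : ∀ ρ, ContDiffAt ℝ ∞ F (ρ, ε)) (i : ℕ) (ρ : ℝ) :
    partialFst^[i] F (ρ, ε) = iteratedDeriv i (fun r => F (r, ε)) ρ := by
  induction i generalizing ρ with
  | zero => simp
  | succ i ih =>
    rw [Function.iterate_succ_apply', iteratedDeriv_succ, ← funext ih]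
    exact ((hasDerivAt_partialFst
      (((h ρ).iterate_partialFst i).differentiableAt (by simp))).deriv).symm

/-- If `F` is smooth at the points `(ρ, 0)`, `|ρ| ≤ R`, and `∂ⁿF/∂ρⁿ` has no zero there, then for
small `ε` the function `F(·, ε)` has at most `n` zeros in `[-R, R]`. -/
theorem eventually_card_zeros_le {F : ℝ × ℝ → ℝ} {R : ℝ} {n : ℕ}
    (hF : ∀ ρ ∈ Set.Icc (-R) R, ContDiffAt ℝ ∞ F (ρ, 0))
    (hn : ∀ ρ ∈ Set.Icc (-R) R, partialFst^[n] F (ρ, 0) ≠ 0) :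
    ∀ᶠ ε in 𝓝 (0 : ℝ), ∀ s : Finset ℝ, (∀ ρ ∈ s, ρ ∈ Set.Icc (-R) R ∧ F (ρ, ε) = 0) →
      s.card ≤ n := by
  -- Nonvanishing and differentiability are open conditions near each (ρ, 0); compactness of [−R, R]
  -- makes the range of ε uniform.
  have key : ∀ᶠ ε in 𝓝 (0 : ℝ), ∀ ρ ∈ Set.Icc (-R) R,
      (∀ i < n, DifferentiableAt ℝ (partialFst^[i] F) (ρ, ε)) ∧ partialFst^[n] F (ρ, ε) ≠ 0 := by
    refine isCompact_Icc.eventually_forall_of_forall_eventually fun ρ hρ => ?_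
    have h1 : ∀ᶠ z in 𝓝 (ρ, (0 : ℝ)), ∀ i < n, DifferentiableAt ℝ (partialFst^[i] F) z := by
      refine (Filter.eventually_all_finite (Set.finite_lt_nat n)).2 fun i _ => ?_
      have : ContDiffAt ℝ 1 (partialFst^[i] F) (ρ, 0) :=
        ((hF ρ hρ).iterate_partialFst i).of_le (by exact_mod_cast le_top)
      filter_upwards [this.eventually (by simp)] with z hz
      exact hz.differentiableAt (by simp)
    have h2 : ∀ᶠ z in 𝓝 (ρ, (0 : ℝ)), partialFst^[n] F z ≠ 0 :=
      ((hF ρ hρ).iterate_partialFst n).continuousAt.eventually_ne (hn ρ hρ)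
    have h3 := h1.and h2
    have : Filter.Tendsto (fun p : ℝ × ℝ => (p.2, p.1)) (𝓝 ((0 : ℝ), ρ)) (𝓝 (ρ, (0 : ℝ))) :=
      (continuous_snd.prodMk continuous_fst).tendsto (x := ((0 : ℝ), ρ))
    exact this.eventually h3
  filter_upwards [key] with ε hε s hs
  by_contra hlt
  obtain ⟨x, hx, hx0⟩ := exists_zero_of_card_zeros (a := -R) (b := R) n
    (fun i r => partialFst^[i] F (r, ε)) (fun i hi x hx => by
      have := hasDerivAt_partialFst ((hε x hx).1 i hi)
      rwa [← Function.iterate_succ_apply' partialFst] at this) s hs (not_le.1 hlt)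
  exact (hε x hx).2 hx0

end PartialDerivatives

/-! ### Global solutions of scalar differential equations. -/

section ScalarODE

variable {S : ℝ → ℝ → ℝ}

/-- `y` solves `y' = S(θ, y)` on the whole line. -/
def IsSolution (S : ℝ → ℝ → ℝ) (y : ℝ → ℝ) : Prop := ∀ θ, HasDerivAt y (S θ (y θ)) θ

theorem IsSolution.continuous {y : ℝ → ℝ} (h : IsSolution S y) : Continuous y :=
  continuous_iff_continuousAt.2 fun θ => (h θ).continuousAt

theorem IsSolution.eq_of_eq {K : NNReal} (hK : ∀ θ, LipschitzWith K (S θ)) {y z : ℝ → ℝ}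
    (hy : IsSolution S y) (hz : IsSolution S z) {θ : ℝ} (h : y θ = z θ) : y = z :=
  ODE_solution_unique_univ (v := S) (s := fun _ => Set.univ) (K := K) (t₀ := θ)
    (fun t => (hK t).lipschitzOnWith) (fun t => ⟨hy t, trivial⟩) (fun t => ⟨hz t, trivial⟩) h

/-- If the order were lost, the intermediate value theorem would give a common value, and uniqueness
would identify the solutions. This makes the return map strictly monotone. -/
theorem IsSolution.lt_of_lt {K : NNReal} (hK : ∀ θ, LipschitzWith K (S θ)) {y z : ℝ → ℝ}
    (hy : IsSolution S y) (hz : IsSolution S z) {θ : ℝ} (h : y θ < z θ) (θ' : ℝ) :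
    y θ' < z θ' := by
  by_contra hlt
  have hmem : (0 : ℝ) ∈ Set.uIcc (z θ' - y θ') (z θ - y θ) := by
    rw [Set.mem_uIcc]; left; constructor <;> linarith
  obtain ⟨c, -, hc⟩ := intermediate_value_uIcc (a := θ') (b := θ) (f := fun t => z t - y t)
    (hz.continuous.sub hy.continuous).continuousOn hmem
  have := hy.eq_of_eq hK hz (θ := c) (by linarith [sub_eq_zero.1 hc])
  rw [this] at h
  exact lt_irrefl _ h

theorem IsSolution.abs_sub_le {C : ℝ} (hC : ∀ θ ρ, |S θ ρ| ≤ C) {y : ℝ → ℝ}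
    (hy : IsSolution S y) (θ θ' : ℝ) : |y θ' - y θ| ≤ C * |θ' - θ| := by
  have := Convex.norm_image_sub_le_of_norm_hasDerivWithin_le (f := y)
    (f' := fun t => S t (y t)) (C := C) (s := Set.univ) (x := θ) (y := θ')
    (fun t _ => (hy t).hasDerivWithinAt) (fun t _ => hC _ _) convex_univ trivial trivial
  simpa using this

theorem IsSolution.shift {y : ℝ → ℝ} {c : ℝ} (hS : ∀ θ ρ, S (θ + c) ρ = S θ ρ)
    (hy : IsSolution S y) : IsSolution S (fun θ => y (θ + c)) := fun θ => by
  have := (hy (θ + c)).comp_add_const θ c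
  rwa [hS] at this

/-- Because |S| ≤ C everywhere, the Picard–Lindelöf theorem applies on an interval of any length,
with a ball of radius C times that length. The local solutions agree by uniqueness and glue to a
global one. -/
theorem exists_isSolution {K : NNReal} (hK : ∀ θ, LipschitzWith K (S θ))
    (hc : ∀ ρ, Continuous fun θ => S θ ρ) {C : ℝ} (hC : ∀ θ ρ, |S θ ρ| ≤ C) (θ₀ ρ₀ : ℝ) :
    ∃ y, y θ₀ = ρ₀ ∧ IsSolution S y := by
  have hC0 : 0 ≤ C := (abs_nonneg _).trans (hC 0 0)
  have hloc : ∀ n : ℕ, ∃ y : ℝ → ℝ, y θ₀ = ρ₀ ∧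
      ∀ t ∈ Set.Ioo (θ₀ - (n + 1)) (θ₀ + (n + 1)), HasDerivAt y (S t (y t)) t := by
    intro n
    have hn : (0 : ℝ) < n + 1 := by positivity
    let t₀ : Set.Icc (θ₀ - (n + 1)) (θ₀ + (n + 1)) := ⟨θ₀, by constructor <;> linarith⟩
    have hPL : IsPicardLindelof S t₀ ρ₀ (C.toNNReal * ((n : NNReal) + 1)) 0 C.toNNReal K :=
      { lipschitzOnWith := fun t _ => (hK t).lipschitzOnWith
        continuousOn := fun x _ => (hc x).continuousOn
        norm_le := fun t _ x _ => by
          rw [Real.coe_toNNReal _ hC0]; exact hC t x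
        mul_max_le := by
          simp only [NNReal.coe_mul, NNReal.coe_add, NNReal.coe_natCast, NNReal.coe_one,
            NNReal.coe_zero, sub_zero, t₀]
          rw [add_sub_cancel_left, sub_sub_cancel, max_self] }
    obtain ⟨y, hy0, hy⟩ := hPL.exists_eq_forall_mem_Icc_hasDerivWithinAt₀
    exact ⟨y, hy0, fun t ht => (hy t (Set.Ioo_subset_Icc_self ht)).hasDerivAt
      (Icc_mem_nhds ht.1 ht.2)⟩
  choose y hy0 hy using hloc
  have hagree : ∀ m n : ℕ, m ≤ n → Set.EqOn (y m) (y n)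
      (Set.Ioo (θ₀ - (m + 1)) (θ₀ + (m + 1))) := by
    intro m n hmn
    have hmn' : (m : ℝ) ≤ n := by exact_mod_cast hmn
    have hm : (0 : ℝ) < m + 1 := by positivity
    refine ODE_solution_unique_of_mem_Ioo (v := S) (s := fun _ => Set.univ) (K := K) (t₀ := θ₀)
      (fun t _ => (hK t).lipschitzOnWith) ⟨by linarith, by linarith⟩
      (fun t ht => ⟨hy m t ht, trivial⟩) (fun t ht => ⟨hy n t ⟨?_, ?_⟩, trivial⟩)
      ((hy0 m).trans (hy0 n).symm)
    · linarith [ht.1]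
    · linarith [ht.2]
  -- The index of an interval, centred at θ₀, that contains t in its interior.
  let N : ℝ → ℕ := fun t => ⌈|t - θ₀|⌉₊
  have hN : ∀ t, t ∈ Set.Ioo (θ₀ - ((N t : ℝ) + 1)) (θ₀ + ((N t : ℝ) + 1)) := fun t => by
    have h1 : |t - θ₀| ≤ N t := Nat.le_ceil _
    have h2 := abs_le.1 h1
    constructor <;> linarith [h2.1, h2.2]
  have heq : ∀ (n : ℕ) (t : ℝ), t ∈ Set.Ioo (θ₀ - ((n : ℝ) + 1)) (θ₀ + ((n : ℝ) + 1)) →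
      y (N t) t = y n t := fun n t ht => by
    rcases le_total (N t) n with h | h
    · exact hagree _ _ h (hN t)
    · exact (hagree _ _ h ht).symm
  refine ⟨fun t => y (N t) t, hy0 _, fun t => ?_⟩
  have hev : (fun s => y (N s) s) =ᶠ[𝓝 t] y (N t) := by
    filter_upwards [isOpen_Ioo.mem_nhds (hN t)] with s hs
    exact heq _ _ hs
  exact (hy (N t) t (hN t)).congr_of_eventuallyEq hev

end ScalarODE

/-! ### Uniqueness and time changes for planar fields. -/

section PlanarODE

variable {X : ℝ × ℝ → ℝ × ℝ}

theorem eventually_eq_of_hasDerivAt (hX : ContDiff ℝ 1 X) {γ δ : ℝ → ℝ × ℝ} {t : ℝ}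
    (hγ : ∀ᶠ s in 𝓝 t, HasDerivAt γ (X (γ s)) s) (hδ : ∀ᶠ s in 𝓝 t, HasDerivAt δ (X (δ s)) s)
    (h : γ t = δ t) : γ =ᶠ[𝓝 t] δ := by
  obtain ⟨K, s, hs, hK⟩ := hX.contDiffAt.exists_lipschitzOnWith (x := γ t)
  refine ODE_solution_unique_of_eventually (v := fun _ => X) (s := fun _ => s) (K := K)
    (Eventually.of_forall fun _ => hK) ?_ ?_ h
  · exact hγ.and (hγ.self_of_nhds.continuousAt.eventually hs)
  · rw [h] at hs
    exact hδ.and (hδ.self_of_nhds.continuousAt.eventually hs)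

/-- The times of local agreement and the times of disagreement are disjoint open sets covering I.
Only γ must solve the equation on the whole line: a polar orbit is a planar solution only while it
stays in the chart. -/
theorem eq_on_of_hasDerivAt (hX : ContDiff ℝ 1 X) {γ δ : ℝ → ℝ × ℝ} {I : Set ℝ}
    (hI : IsPreconnected I) (hγ : ∀ t, HasDerivAt γ (X (γ t)) t) (hδc : Continuous δ)
    (hδ : ∀ t ∈ I, ∀ᶠ s in 𝓝 t, HasDerivAt δ (X (δ s)) s) {t₀ : ℝ} (ht₀ : t₀ ∈ I)
    (h : γ t₀ = δ t₀) : ∀ t ∈ I, γ t = δ t := by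
  have hγc : Continuous γ := continuous_iff_continuousAt.2 fun t => (hγ t).continuousAt
  have key : ∀ t ∈ I, γ t = δ t → γ =ᶠ[𝓝 t] δ := fun t ht heq =>
    eventually_eq_of_hasDerivAt hX (Eventually.of_forall hγ) (hδ t ht) heq
  have hsub := hI.subset_left_of_subset_union (u := {t | ∀ᶠ s in 𝓝 t, γ s = δ s})
    (v := {t | γ t ≠ δ t}) isOpen_setOfPred_eventually_nhds (isOpen_ne_fun hγc hδc) (by
      rw [Set.disjoint_left]
      intro t ht ht'
      exact ht' (show ∀ᶠ s in 𝓝 t, γ s = δ s from ht).self_of_nhds) (fun t ht => by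
      by_cases heq : γ t = δ t
      · exact Or.inl (key t ht heq)
      · exact Or.inr heq) ⟨t₀, ht₀, key t₀ ht₀ h⟩
  exact fun t ht => (show ∀ᶠ s in 𝓝 t, γ s = δ s from hsub ht).self_of_nhds

theorem eq_of_hasDerivAt (hX : ContDiff ℝ 1 X) {γ δ : ℝ → ℝ × ℝ}
    (hγ : ∀ t, HasDerivAt γ (X (γ t)) t) (hδ : ∀ t, HasDerivAt δ (X (δ t)) t) {t₀ : ℝ}
    (h : γ t₀ = δ t₀) : γ = δ :=
  funext fun t => eq_on_of_hasDerivAt hX isPreconnected_univ hγ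
    (continuous_iff_continuousAt.2 fun t => (hδ t).continuousAt)
    (fun _ _ => Eventually.of_forall hδ) (Set.mem_univ t₀) h t trivial

/-- The field is autonomous, so time shifts of the two solutions through the common point coincide.
-/
theorem range_eq_of_hasDerivAt (hX : ContDiff ℝ 1 X) {γ δ : ℝ → ℝ × ℝ}
    (hγ : ∀ t, HasDerivAt γ (X (γ t)) t) (hδ : ∀ t, HasDerivAt δ (X (δ t)) t) {t s : ℝ}
    (h : γ t = δ s) : Set.range γ = Set.range δ := by
  have h1 : (fun r => γ (r + t)) = fun r => δ (r + s) :=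
    eq_of_hasDerivAt hX (fun r => (hγ (r + t)).comp_add_const r t)
      (fun r => (hδ (r + s)).comp_add_const r s) (t₀ := 0) (by simpa using h)
  ext p
  constructor
  · rintro ⟨r, rfl⟩
    exact ⟨r - t + s, by simpa using (congrFun h1 (r - t)).symm⟩
  · rintro ⟨r, rfl⟩
    exact ⟨r - s + t, by simpa using congrFun h1 (r - s)⟩

/-- A positive time change of the line. -/
theorem exists_time_change {h : ℝ → ℝ} (hc : Continuous h) {c C : ℝ} (hpos : 0 < c)
    (hl : ∀ θ, c ≤ h θ) (hu : ∀ θ, h θ ≤ C) (θ₀ : ℝ) :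
    ∃ ϑ : ℝ → ℝ, ϑ 0 = θ₀ ∧ StrictMono ϑ ∧ Function.Surjective ϑ ∧
      ∀ t, HasDerivAt ϑ (h (ϑ t)) t := by
  have hpos' : ∀ θ, 0 < h θ := fun θ => hpos.trans_le (hl θ)
  have hC : 0 < C := (hpos' 0).trans_le (hu 0)
  have hci : Continuous fun θ => (h θ)⁻¹ := hc.inv₀ fun θ => (hpos' θ).ne'
  -- The required angle function is the inverse of the time τ spent up to the angle θ.
  let τ : ℝ → ℝ := fun θ => ∫ s in θ₀..θ, (h s)⁻¹
  have hτ : ∀ θ, HasDerivAt τ ((h θ)⁻¹) θ := fun θ =>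
    intervalIntegral.integral_hasDerivAt_right (hci.intervalIntegrable _ _)
      (hci.stronglyMeasurableAtFilter _ _) hci.continuousAt
  have hτc : Continuous τ := continuous_iff_continuousAt.2 fun θ => (hτ θ).continuousAt
  have hmono : StrictMono τ := strictMono_of_deriv_pos fun θ => by
    rw [(hτ θ).deriv]; exact inv_pos.2 (hpos' θ)
  -- The bound h ≤ C makes τ grow at least linearly, which gives surjectivity.
  have hgrow : Monotone fun θ => τ θ - C⁻¹ * θ :=
    monotone_of_hasDerivAt_nonneg (f' := fun θ => (h θ)⁻¹ - C⁻¹ * 1)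
      (fun θ => (hτ θ).sub ((hasDerivAt_id θ).const_mul C⁻¹)) (fun θ => by
        have := inv_anti₀ (hpos' θ) (hu θ)
        show 0 ≤ (h θ)⁻¹ - C⁻¹ * 1
        linarith)
  have hsurj : Function.Surjective τ := by
    refine hτc.surjective ?_ ?_
    · refine tendsto_atTop_mono' _ (f₁ := fun θ => C⁻¹ * θ + (τ 0 - C⁻¹ * 0)) ?_
        (tendsto_atTop_add_const_right _ _ (tendsto_id.const_mul_atTop (inv_pos.2 hC)))
      filter_upwards [eventually_ge_atTop 0] with θ hθ
      have := hgrow hθ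
      simp only at this
      linarith
    · refine tendsto_atBot_mono' _ (f₁ := fun θ => C⁻¹ * θ + (τ 0 - C⁻¹ * 0)) ?_
        (tendsto_atBot_add_const_right _ _ (tendsto_id.const_mul_atBot (inv_pos.2 hC)))
      filter_upwards [eventually_le_atBot 0] with θ hθ
      have := hgrow hθ
      simp only at this
      linarith
  let e : ℝ ≃o ℝ := hmono.orderIsoOfSurjective τ hsurj
  have he : ∀ t, τ (e.symm t) = t := fun t => e.apply_symm_apply t
  refine ⟨e.symm, ?_, e.symm.strictMono, e.symm.surjective, fun t => ?_⟩
  · apply hmono.injective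
    rw [he]
    simp [τ]
  · have := HasDerivAt.of_local_left_inverse (f := τ) (g := e.symm) (a := t)
      e.symm.continuous.continuousAt (hτ _) (inv_ne_zero (hpos' _).ne')
      (Eventually.of_forall he)
    rwa [inv_inv] at this

end PlanarODE

/-! ### Polar charts and the count of limit cycles by fixed radii. -/

/-- A polar chart `φ(θ, ρ)`, `|ρ| < R`, about an equilibrium of the planar field `X`, in which the
orbits of `X` are the graphs of the solutions of `dρ/dθ = S(θ, ρ)`. -/
structure PolarChart (X : ℝ × ℝ → ℝ × ℝ) (R C : ℝ) where
  S : ℝ → ℝ → ℝ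
  speed : ℝ → ℝ → ℝ
  φ : ℝ → ℝ → ℝ × ℝ
  K : NNReal
  lo : ℝ
  hi : ℝ
  lo_pos : 0 < lo
  smooth : ContDiff ℝ 1 X
  lipschitz : ∀ θ, LipschitzWith K (S θ)
  continuous_S : ∀ ρ, Continuous fun θ => S θ ρ
  abs_S_le : ∀ θ ρ, |S θ ρ| ≤ C
  S_periodic : ∀ θ ρ, S (θ + 2 * Real.pi) ρ = S θ ρ
  S_zero : ∀ θ, S θ 0 = 0
  S_neg : ∀ θ ρ, S (θ + Real.pi) (-ρ) = -S θ ρ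
  continuous_speed : Continuous (Function.uncurry speed)
  lo_le_speed : ∀ θ ρ, lo ≤ speed θ ρ
  speed_le_hi : ∀ θ ρ, speed θ ρ ≤ hi
  continuous_φ : Continuous (Function.uncurry φ)
  φ_periodic : ∀ θ ρ, φ (θ + 2 * Real.pi) ρ = φ θ ρ
  φ_zero : ∀ θ, φ θ 0 = φ 0 0
  hasDerivAt_φ : ∀ y θ, HasDerivAt y (S θ (y θ)) θ → |y θ| < R →
    HasDerivAt (fun θ => φ θ (y θ)) ((speed θ (y θ))⁻¹ • X (φ θ (y θ))) θ
  injective : ∀ θ θ' ρ ρ', 0 < ρ → ρ < R → 0 < ρ' → ρ' < R → φ θ ρ = φ θ' ρ' →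
    ρ = ρ' ∧ ∃ k : ℤ, θ' = θ + k * (2 * Real.pi)
  nhds_le : ∀ θ ρ, 0 < ρ → ρ < R → 𝓝 (φ θ ρ) ≤ map (Function.uncurry φ) (𝓝 (θ, ρ))

namespace PolarChart

variable {X : ℝ × ℝ → ℝ × ℝ} {R C : ℝ} (c : PolarChart X R C)

/-- The polar orbits. -/
abbrev Sol (y : ℝ → ℝ) : Prop := IsSolution c.S y

theorem exists_sol (θ ρ : ℝ) : ∃ y, y θ = ρ ∧ c.Sol y :=
  exists_isSolution c.lipschitz c.continuous_S c.abs_S_le θ ρ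

theorem sol_zero : c.Sol fun _ => 0 := fun θ => by
  simpa [c.S_zero] using hasDerivAt_const θ (0 : ℝ)

theorem pos_of_pos {y : ℝ → ℝ} (hy : c.Sol y) {θ : ℝ} (h : 0 < y θ) (θ' : ℝ) : 0 < y θ' :=
  c.sol_zero.lt_of_lt c.lipschitz hy h θ'

theorem S_periodic_int (k : ℤ) (θ ρ : ℝ) : c.S (θ + k * (2 * Real.pi)) ρ = c.S θ ρ := by
  have h : Function.Periodic (fun θ => c.S θ ρ) (2 * Real.pi) := fun θ => c.S_periodic θ ρ
  exact h.int_mul k θ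

theorem φ_periodic_int (k : ℤ) (θ ρ : ℝ) : c.φ (θ + k * (2 * Real.pi)) ρ = c.φ θ ρ := by
  have h : Function.Periodic (fun θ => c.φ θ ρ) (2 * Real.pi) := fun θ => c.φ_periodic θ ρ
  exact h.int_mul k θ

theorem sol_shift {y : ℝ → ℝ} (hy : c.Sol y) (k : ℤ) :
    c.Sol fun θ => y (θ + k * (2 * Real.pi)) := hy.shift (c.S_periodic_int k)

theorem sol_shift_one {y : ℝ → ℝ} (hy : c.Sol y) : c.Sol fun θ => y (θ + 2 * Real.pi) :=
  hy.shift c.S_periodic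

/-- The solution ρ = 0 is carried to a constant curve, whose derivative is a nonzero multiple of the
field. -/
theorem X_zero (hR : 0 < R) : X (c.φ 0 0) = 0 := by
  have h := c.hasDerivAt_φ (fun _ => 0) 0 (c.sol_zero 0) (by simpa using hR)
  have h2 : HasDerivAt (fun θ => c.φ θ 0) (0 : ℝ × ℝ) 0 := by
    simpa only [c.φ_zero] using hasDerivAt_const (0 : ℝ) (c.φ 0 0)
  have := h.unique h2
  rcases smul_eq_zero.1 this with h0 | h0
  · exact absurd h0 (inv_ne_zero (c.lo_pos.trans_le (c.lo_le_speed _ _)).ne')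
  · exact h0

/-- The planar curve carried by a polar orbit, with the angle as a function of time. -/
theorem exists_curve {y : ℝ → ℝ} (hy : c.Sol y) (θ₀ : ℝ) :
    ∃ ϑ : ℝ → ℝ, ϑ 0 = θ₀ ∧ StrictMono ϑ ∧ Function.Surjective ϑ ∧ Continuous ϑ ∧
      ∀ t, |y (ϑ t)| < R → ∀ᶠ s in 𝓝 t, HasDerivAt (fun s => c.φ (ϑ s) (y (ϑ s)))
        (X (c.φ (ϑ s) (y (ϑ s)))) s := by
  obtain ⟨ϑ, h0, hm, hs, hd⟩ := exists_time_change (h := fun θ => c.speed θ (y θ))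
    (c.continuous_speed.comp (continuous_id.prodMk hy.continuous)) c.lo_pos
    (fun θ => c.lo_le_speed _ _) (fun θ => c.speed_le_hi _ _) θ₀
  have hc : Continuous ϑ := continuous_iff_continuousAt.2 fun t => (hd t).continuousAt
  refine ⟨ϑ, h0, hm, hs, hc, fun t ht => ?_⟩
  have hev : ∀ᶠ s in 𝓝 t, |y (ϑ s)| < R :=
    ((hy.continuous.comp hc).abs.continuousAt (x := t)).eventually_lt continuousAt_const ht
  filter_upwards [hev] with s hs
  have h1 := c.hasDerivAt_φ y (ϑ s) (hy _) hs
  have h2 := h1.scomp s (hd s)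
  rwa [smul_smul, mul_inv_cancel₀ (c.lo_pos.trans_le (c.lo_le_speed _ _)).ne', one_smul] at h2

/-- The closed curve carried by a polar orbit. -/
def orbit (y : ℝ → ℝ) : Set (ℝ × ℝ) := Set.range fun θ => c.φ θ (y θ)

/-- The shift by one turn preserves the order of solutions. A strict inequality after one turn
therefore persists after any number of turns: a monotone map of the line has no periodic points
besides its fixed points. -/
theorem periodic_of_return {y : ℝ → ℝ} (hy : c.Sol y) {θ : ℝ} {k : ℤ} (hk : k ≠ 0)
    (h : y (θ + k * (2 * Real.pi)) = y θ) : ∀ θ, y (θ + 2 * Real.pi) = y θ := by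
  have main : ∀ (n : ℕ), n ≠ 0 → ∀ θ, y (θ + n * (2 * Real.pi)) = y θ →
      ∀ θ, y (θ + 2 * Real.pi) = y θ := by
    intro n hn θ h
    have hs := c.sol_shift_one hy
    rcases lt_trichotomy (y (θ + 2 * Real.pi)) (y θ) with hlt | heq | hgt
    · exfalso
      have hall := hs.lt_of_lt c.lipschitz hy (θ := θ) hlt
      have : ∀ m : ℕ, m ≠ 0 → y (θ + m * (2 * Real.pi)) < y θ := by
        intro m hm
        induction m with
        | zero => exact absurd rfl hm
        | succ m ih =>
          have h1 := hall (θ + m * (2 * Real.pi))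
          have h2 : θ + m * (2 * Real.pi) + 2 * Real.pi = θ + (m + 1 : ℕ) * (2 * Real.pi) := by
            push_cast; ring
          simp only [h2] at h1
          rcases eq_or_ne m 0 with rfl | hm'
          · simpa using h1
          · exact h1.trans (ih hm')
      exact (this n hn).ne h
    · exact congrFun (hs.eq_of_eq c.lipschitz hy (θ := θ) heq)
    · exfalso
      have hall := hy.lt_of_lt c.lipschitz hs (θ := θ) hgt
      have : ∀ m : ℕ, m ≠ 0 → y θ < y (θ + m * (2 * Real.pi)) := by
        intro m hm
        induction m with
        | zero => exact absurd rfl hm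
        | succ m ih =>
          have h1 := hall (θ + m * (2 * Real.pi))
          have h2 : θ + m * (2 * Real.pi) + 2 * Real.pi = θ + (m + 1 : ℕ) * (2 * Real.pi) := by
            push_cast; ring
          simp only [h2] at h1
          rcases eq_or_ne m 0 with rfl | hm'
          · simpa using h1
          · exact (ih hm').trans h1
      exact (this n hn).ne' h
  obtain ⟨n, rfl | rfl⟩ := k.eq_nat_or_neg
  · exact main n (by simpa using hk) θ (by simpa using h)
  · refine main n (by simpa using hk) (θ + (-(n : ℤ) : ℤ) * (2 * Real.pi)) ?_
    rw [h]
    congr 1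
    push_cast; ring

theorem isPeriodicOrbit_orbit {y : ℝ → ℝ} (hy : c.Sol y) (hp : ∀ θ, y (θ + 2 * Real.pi) = y θ)
    (h0 : ∀ θ, 0 < y θ) (hR : ∀ θ, y θ < R) : IsPeriodicOrbit X (c.orbit y) := by
  obtain ⟨ϑ, hϑ0, hm, hs, hc, hd⟩ := c.exists_curve hy 0
  have hγ : ∀ t, HasDerivAt (fun s => c.φ (ϑ s) (y (ϑ s))) (X (c.φ (ϑ t) (y (ϑ t)))) t :=
    fun t => (hd t (by rw [abs_of_pos (h0 _)]; exact hR _)).self_of_nhds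
  obtain ⟨T, hT⟩ := hs (2 * Real.pi)
  obtain ⟨t, ht⟩ := hs Real.pi
  have hTpos : 0 < T := by
    rw [← hm.lt_iff_lt, hϑ0, hT]; positivity
  refine ⟨fun s => c.φ (ϑ s) (y (ϑ s)), T, hTpos, hγ, ?_, ⟨t, ?_⟩, ?_⟩
  · have := eq_of_hasDerivAt c.smooth (fun r => (hγ (r + T)).comp_add_const r T) hγ (t₀ := 0) (by
      simp only [zero_add, hϑ0, hT]
      have h1 := hp 0
      have h2 := c.φ_periodic 0 (y 0)
      rw [zero_add] at h1 h2
      rw [h1, h2])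
    exact fun s => congrFun this s
  -- The points at angles 0 and π differ: by injectivity of the chart their angles would otherwise
  -- agree modulo 2π, which gives 2k + 1 = 0.
  · intro heq
    simp only [hϑ0, ht] at heq
    obtain ⟨-, k, hk⟩ := c.injective _ _ _ _ (h0 _) (hR _) (h0 _) (hR _) heq
    have hπ := Real.pi_pos
    have h1 : Real.pi * (2 * k + 1) = 0 := by linear_combination -hk
    have h2 : ((2 * k + 1 : ℤ) : ℝ) = 0 := by
      push_cast
      exact (mul_eq_zero.1 h1).resolve_left hπ.ne'
    have h3 : 2 * k + 1 = 0 := by exact_mod_cast h2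
    omega
  · ext p
    constructor
    · rintro ⟨s, rfl⟩; exact ⟨ϑ s, rfl⟩
    · rintro ⟨θ, rfl⟩
      obtain ⟨s, rfl⟩ := hs θ
      exact ⟨s, rfl⟩

/-- A periodic orbit in the domain of the chart is carried by a periodic polar orbit. -/
theorem exists_sol_of_isPeriodicOrbit {R₁ : ℝ} (hR₁ : R₁ < R) {Γ : Set (ℝ × ℝ)}
    (hΓ : IsPeriodicOrbit X Γ)
    (hsub : ∀ p ∈ Γ, ∃ θ ρ, 0 ≤ ρ ∧ ρ ≤ R₁ ∧ c.φ θ ρ = p) :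
    ∃ y, c.Sol y ∧ (∀ θ, y (θ + 2 * Real.pi) = y θ) ∧ (∀ θ, 0 < y θ) ∧ (∀ θ, y θ ≤ R₁) ∧
      Γ = c.orbit y := by
  obtain ⟨γ, T, hT, hγ, hper, ⟨t₁, ht₁⟩, rfl⟩ := hΓ
  have hR : 0 < R := by
    obtain ⟨_, ρ, h0, h1, _⟩ := hsub (γ 0) ⟨0, rfl⟩
    linarith
  have hne : ∀ t, γ t ≠ c.φ 0 0 := by
    intro t ht
    have := eq_of_hasDerivAt c.smooth (γ := γ) (δ := fun _ => c.φ 0 0) hγ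
      (fun s => by simpa [c.X_zero hR] using hasDerivAt_const s (c.φ 0 0)) (t₀ := t) ht
    exact ht₁ (by rw [this])
  have hsub' : ∀ t, ∃ θ ρ, 0 < ρ ∧ ρ ≤ R₁ ∧ c.φ θ ρ = γ t := by
    intro t
    obtain ⟨θ, ρ, h0, h1, h2⟩ := hsub (γ t) ⟨t, rfl⟩
    refine ⟨θ, ρ, lt_of_le_of_ne h0 ?_, h1, h2⟩
    rintro rfl
    exact hne t (by rw [← h2, c.φ_zero])
  obtain ⟨θ₀, ρ₀, hρ0, hρ1, hφ0⟩ := hsub' 0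
  obtain ⟨y, hy0, hy⟩ := c.exists_sol θ₀ ρ₀
  have hpos : ∀ θ, 0 < y θ := c.pos_of_pos hy (θ := θ₀) (by rw [hy0]; exact hρ0)
  obtain ⟨ϑ, hϑ0, hm, hs, hc, hd⟩ := c.exists_curve hy θ₀
  have hγc : Continuous γ := continuous_iff_continuousAt.2 fun t => (hγ t).continuousAt
  have hδc : Continuous fun s => c.φ (ϑ s) (y (ϑ s)) :=
    c.continuous_φ.comp (hc.prodMk (hy.continuous.comp hc))
  have hV : ∀ t, γ t = c.φ (ϑ t) (y (ϑ t)) ∧ y (ϑ t) ≤ R₁ := by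
    -- Openness rests on planar uniqueness, which prolongs the identity, and on injectivity of the
    -- chart, which transfers the bound R₁ from the points of the orbit to the radius y; the gap R₁
    -- < R leaves room.
    have hclopen : IsClopen {t | γ t = c.φ (ϑ t) (y (ϑ t)) ∧ y (ϑ t) ≤ R₁} := by
      refine ⟨(isClosed_eq hγc hδc).inter (isClosed_le (hy.continuous.comp hc) continuous_const),
        isOpen_iff_mem_nhds.2 fun t ⟨h1, h2⟩ => ?_⟩
      have h3 : |y (ϑ t)| < R := by rw [abs_of_pos (hpos _)]; linarith
      have h4 := eventually_eq_of_hasDerivAt c.smooth (Eventually.of_forall hγ) (hd t h3) h1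
      have h5 : ∀ᶠ s in 𝓝 t, y (ϑ s) < R :=
        ((hy.continuous.comp hc).continuousAt (x := t)).eventually_lt continuousAt_const
          (by show y (ϑ t) < R; linarith)
      filter_upwards [h4, h5] with s hs1 hs2
      refine ⟨hs1, ?_⟩
      obtain ⟨θ, ρ, h6, h7, h8⟩ := hsub' s
      rw [hs1] at h8
      rw [← (c.injective _ _ _ _ h6 (h7.trans_lt hR₁) (hpos _) hs2 h8).1]
      exact h7
    have := hclopen.eq_univ ⟨0, by
      simp only [Set.mem_ofPred_eq, hϑ0, hy0]; exact ⟨hφ0.symm, hρ1⟩⟩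
    exact fun t => this.symm.subset trivial
  have hle : ∀ θ, y θ ≤ R₁ := fun θ => by
    obtain ⟨t, rfl⟩ := hs θ
    exact (hV t).2
  refine ⟨y, hy, ?_, hpos, hle, ?_⟩
  · have h1 : γ T = γ 0 := by simpa using hper 0
    rw [(hV T).1, (hV 0).1] at h1
    obtain ⟨h2, k, h3⟩ := c.injective _ _ _ _ (hpos _) ((hle _).trans_lt hR₁) (hpos _)
      ((hle _).trans_lt hR₁) h1
    -- The angle strictly increases in time, so it cannot return to the same value after the period
    -- T.
    have h4 : k ≠ 0 := by
      rintro rfl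
      have := hm hT
      simp at h3
      linarith
    refine c.periodic_of_return hy (θ := ϑ T) h4 ?_
    rw [← h3, h2]
  · ext p
    constructor
    · rintro ⟨s, rfl⟩; exact ⟨ϑ s, (hV s).1.symm⟩
    · rintro ⟨θ, rfl⟩
      obtain ⟨s, rfl⟩ := hs θ
      exact ⟨s, (hV s).1⟩

theorem periodic_of_eq {y : ℝ → ℝ} (hy : c.Sol y) (h : y (2 * Real.pi) = y 0) :
    ∀ θ, y (θ + 2 * Real.pi) = y θ :=
  c.periodic_of_return hy (θ := 0) (k := 1) one_ne_zero (by simpa using h)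

/-- The set of radii of the periodic polar orbits. -/
def fixedRadii : Set ℝ := {ρ | ∃ y, c.Sol y ∧ y 0 = ρ ∧ y (2 * Real.pi) = ρ}

theorem C_nonneg (c : PolarChart X R C) : 0 ≤ C := (abs_nonneg _).trans (c.abs_S_le 0 0)

theorem le_add_of_periodic {y : ℝ → ℝ} (hy : c.Sol y) (hp : ∀ θ, y (θ + 2 * Real.pi) = y θ)
    (θ : ℝ) : y θ ≤ y 0 + 2 * Real.pi * C := by
  have hper : Function.Periodic y (2 * Real.pi) := hp
  obtain ⟨θ', hθ', h⟩ := hper.exists_mem_Ico₀ Real.two_pi_pos θ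
  rw [h]
  have h1 := hy.abs_sub_le c.abs_S_le 0 θ'
  rw [sub_zero, abs_of_nonneg hθ'.1] at h1
  have h2 : C * θ' ≤ C * (2 * Real.pi) := mul_le_mul_of_nonneg_left hθ'.2.le c.C_nonneg
  linarith [le_abs_self (y θ' - y 0)]

theorem orbit_injective {y z : ℝ → ℝ} (hy : c.Sol y) (hz : c.Sol z) (h : y 0 = z 0) : y = z :=
  hy.eq_of_eq c.lipschitz hz h

/-- A limit cycle inside the ball is determined by the radius at which its polar orbit crosses the
ray θ = 0. -/
theorem encard_le {P : ℝ × ℝ} {r R₁ : ℝ} (hR₁ : R₁ < R) {j : ℕ}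
    (hball : ∀ p ∈ Metric.ball P r, ∃ θ ρ, 0 ≤ ρ ∧ ρ ≤ R₁ ∧ c.φ θ ρ = p)
    (hj : (c.fixedRadii ∩ Set.Ioc 0 R₁).encard ≤ j) : numLimitCycles X P r ≤ j := by
  have hex : ∀ Γ : Set (ℝ × ℝ), IsLimitCycle X Γ ∧ Γ ⊆ Metric.ball P r →
      ∃ y, c.Sol y ∧ (∀ θ, y (θ + 2 * Real.pi) = y θ) ∧ (∀ θ, 0 < y θ) ∧ (∀ θ, y θ ≤ R₁) ∧
      Γ = c.orbit y := fun Γ h =>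
    c.exists_sol_of_isPeriodicOrbit hR₁ h.1.1 fun p hp => hball p (h.2 hp)
  choose! f hf using hex
  refine le_trans ?_ hj
  refine Set.encard_le_encard_of_injOn (f := fun Γ => f Γ 0) ?_ ?_
  · intro Γ hΓ
    obtain ⟨h1, h2, h3, h4, -⟩ := hf Γ hΓ
    refine ⟨⟨f Γ, h1, rfl, ?_⟩, h3 0, h4 0⟩
    simpa using h2 0
  · intro Γ hΓ Γ' hΓ' heq
    obtain ⟨h1, -, -, -, h5⟩ := hf Γ hΓ
    obtain ⟨h1', -, -, -, h5'⟩ := hf Γ' hΓ'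
    rw [h5, h5', c.orbit_injective h1 h1' heq]

/-- When all small radii are fixed, closed orbits through slightly larger radii accumulate on any
given one and differ from it, so none is isolated. The margin 2πC keeps these neighbours inside the
chart. -/
theorem numLimitCycles_eq_zero {P : ℝ × ℝ} {r R₁ R₂ : ℝ} (h12 : R₁ < R₂)
    (h2 : R₂ + 2 * Real.pi * C < R)
    (hball : ∀ p ∈ Metric.ball P r, ∃ θ ρ, 0 ≤ ρ ∧ ρ ≤ R₁ ∧ c.φ θ ρ = p)
    (hfix : Set.Ioc 0 R₂ ⊆ c.fixedRadii) : numLimitCycles X P r = 0 := by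
  have hC := mul_nonneg Real.two_pi_pos.le c.C_nonneg
  rw [numLimitCycles, Set.encard_eq_zero, Set.eq_empty_iff_forall_notMem]
  rintro Γ ⟨⟨hΓ, U, hU, hΓU, hiso⟩, hΓb⟩
  obtain ⟨y, hy, hp, h0, hle, rfl⟩ := c.exists_sol_of_isPeriodicOrbit (by linarith) hΓ
    fun p hp => hball p (hΓb hp)
  have hmem : c.φ 0 (y 0) ∈ U := hΓU ⟨0, rfl⟩
  have hcont : ContinuousAt (fun ρ => c.φ 0 ρ) (y 0) :=
    (c.continuous_φ.comp (continuous_const.prodMk continuous_id)).continuousAt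
  have hev : ∀ᶠ ρ in 𝓝 (y 0), c.φ 0 ρ ∈ U := hcont (hU.mem_nhds hmem)
  have hev2 : ∀ᶠ ρ in 𝓝 (y 0), ρ < R₂ := gt_mem_nhds ((hle 0).trans_lt h12)
  obtain ⟨ρ, ⟨hρ1, hρ2⟩, hρ3⟩ :=
    (((hev.and hev2).filter_mono nhdsWithin_le_nhds).and
      (self_mem_nhdsWithin (s := Set.Ioi (y 0)))).exists
  obtain ⟨z, hz, hz0, hz1⟩ := hfix ⟨(h0 0).trans hρ3, hρ2.le⟩
  have hzp := c.periodic_of_eq hz (hz1.trans hz0.symm)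
  have hzpos := c.pos_of_pos hz (θ := 0) (by rw [hz0]; exact (h0 0).trans hρ3)
  have horb := c.isPeriodicOrbit_orbit hz hzp hzpos fun θ => by
    have := c.le_add_of_periodic hz hzp θ
    rw [hz0] at this
    linarith
  have heq := hiso _ horb ⟨c.φ 0 ρ, ⟨0, by simp [hz0]⟩, hρ1⟩
  have hin : c.φ 0 ρ ∈ c.orbit y := by rw [← heq]; exact ⟨0, by simp [hz0]⟩
  obtain ⟨θ, hθ⟩ := hin
  have := (c.injective _ _ _ _ (h0 θ) (by linarith [hle θ]) ((h0 0).trans hρ3) (by linarith) hθ)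
  obtain ⟨h5, k, hk⟩ := this
  have h6 : y θ = y 0 := by
    have hyper : Function.Periodic y (2 * Real.pi) := hp
    have := hyper.int_mul k θ
    rw [← hk] at this
    exact this.symm
  rw [h6] at h5
  exact absurd h5 (ne_of_lt hρ3)

/-- A polar orbit that is not periodic but starts between two levels enclosing a periodic one
cannot meet a periodic orbit of the field. -/
theorem not_isPeriodicOrbit_of_trapped {y : ℝ → ℝ} (hy : c.Sol y)
    (hne : y (2 * Real.pi) ≠ y 0) {θ₀ : ℝ} (h0 : ∀ θ, 0 < y θ)
    (htrap : (∀ θ, θ₀ ≤ θ → y θ < R) ∨ (∀ θ, θ ≤ θ₀ → y θ < R)) {Γ : Set (ℝ × ℝ)}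
    (hΓ : IsPeriodicOrbit X Γ) : c.φ θ₀ (y θ₀) ∉ Γ := by
  obtain ⟨γ₁, T, hT, hγ₁, hper₁, -, rfl⟩ := hΓ
  rintro ⟨t₁, ht₁⟩
  set γ : ℝ → ℝ × ℝ := fun s => γ₁ (s + t₁) with hγdef
  have hγ : ∀ t, HasDerivAt γ (X (γ t)) t := fun t => (hγ₁ (t + t₁)).comp_add_const t t₁
  have hper : ∀ t, γ (t + T) = γ t := fun t => by
    simp only [hγdef]
    rw [add_right_comm]; exact hper₁ _
  have hstart : γ 0 = c.φ θ₀ (y θ₀) := by simp only [hγdef, zero_add]; exact ht₁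
  obtain ⟨ϑ, hϑ0, hm, hs, hc, hd⟩ := c.exists_curve hy θ₀
  have hδc : Continuous fun s => c.φ (ϑ s) (y (ϑ s)) :=
    c.continuous_φ.comp (hc.prodMk (hy.continuous.comp hc))
  -- If the planar curve returns to its starting point while still following y, then y returns after
  -- a nonzero number of turns and is periodic.
  have hfin : ∀ t, t ≠ 0 → y (ϑ t) < R → y θ₀ < R → γ t = γ 0 →
      γ t = c.φ (ϑ t) (y (ϑ t)) → False := by
    intro t ht hlt hlt0 hg heq
    rw [heq, hstart] at hg
    obtain ⟨h1, k, hk⟩ := c.injective _ _ _ _ (h0 _) hlt (h0 _) hlt0 hg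
    have hk0 : k ≠ 0 := by
      rintro rfl
      simp only [Int.cast_zero, zero_mul, add_zero] at hk
      rw [← hϑ0] at hk
      exact ht (hm.injective hk).symm
    have := c.periodic_of_return hy (θ := ϑ t) hk0 (by rw [← hk, h1]) 0
    rw [zero_add] at this
    exact hne this
  -- The period is run forwards or backwards, according to the half-line on which y is known to stay
  -- in the chart.
  rcases htrap with htrap | htrap
  · have hlt : ∀ t ∈ Set.Ici (0 : ℝ), y (ϑ t) < R := fun t ht =>
      htrap _ (by rw [← hϑ0]; exact hm.monotone ht)
    have := eq_on_of_hasDerivAt c.smooth (I := Set.Ici 0) isPreconnected_Ici hγ hδc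
      (fun t ht => hd t (by rw [abs_of_pos (h0 _)]; exact hlt t ht)) (t₀ := 0)
      (Set.mem_Ici.2 le_rfl) (by rw [hϑ0]; exact hstart)
    exact hfin T hT.ne' (hlt T hT.le) (htrap _ le_rfl) (by simpa using hper 0) (this T hT.le)
  · have hlt : ∀ t ∈ Set.Iic (0 : ℝ), y (ϑ t) < R := fun t ht =>
      htrap _ (by rw [← hϑ0]; exact hm.monotone ht)
    have := eq_on_of_hasDerivAt c.smooth (I := Set.Iic 0) isPreconnected_Iic hγ hδc
      (fun t ht => hd t (by rw [abs_of_pos (h0 _)]; exact hlt t ht)) (t₀ := 0)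
      (Set.mem_Iic.2 le_rfl) (by rw [hϑ0]; exact hstart)
    have hT' : -T ∈ Set.Iic (0 : ℝ) := by simpa using hT.le
    exact hfin (-T) (neg_ne_zero.2 hT.ne') (hlt _ hT') (htrap _ le_rfl)
      (by simpa using (hper (-T)).symm) (this _ hT')

/-- If `y` starts on one side of the periodic orbit `z` and moves towards it, the later (earlier)
returns stay between the start and the periodic orbit. -/
theorem return_lt {y z : ℝ → ℝ} (hy : c.Sol y) (hz : c.Sol z)
    (hp : ∀ θ, z (θ + 2 * Real.pi) = z θ) {b : ℝ} (hyb : y 0 < b) (hzb : z 0 < b) :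
    (∀ n : ℕ, y (n * (2 * Real.pi)) < b) ∨ (∀ n : ℕ, y (-n * (2 * Real.pi)) < b) := by
  have hzp : Function.Periodic z (2 * Real.pi) := hp
  have hs := c.sol_shift_one hy
  rcases lt_trichotomy (y 0) (z 0) with hlt | heq | hgt
  · left
    intro n
    have h1 := hy.lt_of_lt c.lipschitz hz hlt (n * (2 * Real.pi))
    have h2 := hzp.nat_mul n 0
    rw [zero_add] at h2
    linarith
  · left
    intro n
    rw [hy.eq_of_eq c.lipschitz hz heq]
    have h2 := hzp.nat_mul n 0
    rw [zero_add] at h2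
    linarith
  · rcases le_total (y (2 * Real.pi)) (y 0) with hle | hle
    · left
      have hall : ∀ θ, y (θ + 2 * Real.pi) ≤ y θ := by
        intro θ
        rcases eq_or_lt_of_le hle with h | h
        · exact (congrFun (hs.eq_of_eq c.lipschitz hy (θ := 0) (by simpa using h)) θ).le
        · exact (hs.lt_of_lt c.lipschitz hy (θ := 0) (by simpa using h) θ).le
      intro n
      induction n with
      | zero => simpa using hyb
      | succ n ih =>
        have h1 := hall (n * (2 * Real.pi))
        have h2 : (n : ℝ) * (2 * Real.pi) + 2 * Real.pi = (n + 1 : ℕ) * (2 * Real.pi) := by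
          push_cast; ring
        rw [h2] at h1
        exact h1.trans_lt ih
    · right
      have hall : ∀ θ, y θ ≤ y (θ + 2 * Real.pi) := by
        intro θ
        rcases eq_or_lt_of_le hle with h | h
        · exact (congrFun (hy.eq_of_eq c.lipschitz hs (θ := 0) (by simpa using h)) θ).le
        · exact (hy.lt_of_lt c.lipschitz hs (θ := 0) (by simpa using h) θ).le
      intro n
      induction n with
      | zero => simpa using hyb
      | succ n ih =>
        have h1 := hall (-(n + 1 : ℕ) * (2 * Real.pi))
        have h2 : -((n + 1 : ℕ) : ℝ) * (2 * Real.pi) + 2 * Real.pi = -n * (2 * Real.pi) := by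
          push_cast; ring
        rw [h2] at h1
        exact h1.trans_lt ih

/-- The isolating neighbourhood is the image of the strip between the solutions starting at z 0 ± δ.
A polar orbit in the strip that closes after one turn is z by isolation of the radius. One that does
not close has monotone returns, hence stays in the chart in one time direction and cannot lie on a
periodic orbit. -/
theorem isLimitCycle_orbit {z : ℝ → ℝ} (hz : c.Sol z)
    (hp : ∀ θ, z (θ + 2 * Real.pi) = z θ) (h0 : ∀ θ, 0 < z θ) {δ : ℝ} (hδ : 0 < δ)
    (hδz : δ < z 0) (hR : z 0 + δ + 4 * Real.pi * C < R)
    (hiso : ∀ ρ ∈ c.fixedRadii, z 0 - δ < ρ → ρ < z 0 + δ → ρ = z 0) :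
    IsLimitCycle X (c.orbit z) := by
  have hπ := Real.pi_pos
  have hC := c.C_nonneg
  have hπC : 0 ≤ Real.pi * C := mul_nonneg hπ.le hC
  have hzR : ∀ θ, z θ < R := fun θ => by
    have := c.le_add_of_periodic hz hp θ
    linarith
  have hzp : Function.Periodic z (2 * Real.pi) := hp
  refine ⟨c.isPeriodicOrbit_orbit hz hp h0 hzR, ?_⟩
  obtain ⟨a, ha0, ha⟩ := c.exists_sol 0 (z 0 - δ)
  obtain ⟨b, hb0, hb⟩ := c.exists_sol 0 (z 0 + δ)
  have haz := ha.lt_of_lt c.lipschitz hz (θ := 0) (by rw [ha0]; linarith)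
  have hzb := hz.lt_of_lt c.lipschitz hb (θ := 0) (by rw [hb0]; linarith)
  have hapos := c.pos_of_pos ha (θ := 0) (by rw [ha0]; linarith)
  have hbR : ∀ θ, 0 ≤ θ → θ ≤ 4 * Real.pi → b θ < R := fun θ h1 h2 => by
    have h3 := hb.abs_sub_le c.abs_S_le 0 θ
    rw [sub_zero, abs_of_nonneg h1] at h3
    have h4 : C * θ ≤ C * (4 * Real.pi) := mul_le_mul_of_nonneg_left h2 hC
    linarith [le_abs_self (b θ - b 0)]
  -- Two turns are used so that every angle has a representative in (0, 2π], which is interior to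
  -- (0, 4π); this is why the margin in the radius is 4πC.
  let O : Set (ℝ × ℝ) := {q | 0 < q.1 ∧ q.1 < 4 * Real.pi ∧ a q.1 < q.2 ∧ q.2 < b q.1}
  have hO : IsOpen O :=
    (isOpen_lt continuous_const continuous_fst).inter
      ((isOpen_lt continuous_fst continuous_const).inter
        ((isOpen_lt (ha.continuous.comp continuous_fst) continuous_snd).inter
          (isOpen_lt continuous_snd (hb.continuous.comp continuous_fst))))
  refine ⟨interior (Function.uncurry c.φ '' O), isOpen_interior, ?_, ?_⟩
  · rintro _ ⟨θ, rfl⟩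
    obtain ⟨θ', hθ', -⟩ := existsUnique_add_zsmul_mem_Ioc Real.two_pi_pos θ 0
    simp only [zsmul_eq_mul, zero_add] at hθ'
    have h1 := c.φ_periodic_int θ' θ (z θ)
    have h2 := hzp.int_mul θ' θ
    show c.φ θ (z θ) ∈ interior (Function.uncurry c.φ '' O)
    rw [← h1, ← h2, mem_interior_iff_mem_nhds]
    set θ₁ := θ + θ' * (2 * Real.pi)
    have hmem : O ∈ 𝓝 (θ₁, z θ₁) :=
      hO.mem_nhds ⟨hθ'.1, by linarith [hθ'.2], haz _, hzb _⟩
    exact c.nhds_le θ₁ (z θ₁) (h0 _) (hzR _)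
      (Filter.image_mem_map hmem)
  · rintro Γ' hΓ' ⟨p, hpΓ, hpU⟩
    obtain ⟨⟨θ₀, ρ⟩, ⟨hθ0, hθ1, hρa, hρb⟩, rfl⟩ := interior_subset hpU
    simp only at hθ0 hθ1 hρa hρb
    obtain ⟨y, hyρ, hy⟩ := c.exists_sol θ₀ ρ
    have hay := ha.lt_of_lt c.lipschitz hy (θ := θ₀) (by rwa [hyρ])
    have hyb := hy.lt_of_lt c.lipschitz hb (θ := θ₀) (by rwa [hyρ])
    have hypos : ∀ θ, 0 < y θ := fun θ => (hapos θ).trans (hay θ)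
    have hpΓ' : c.φ θ₀ (y θ₀) ∈ Γ' := by rw [hyρ]; exact hpΓ
    by_cases hper : y (2 * Real.pi) = y 0
    · have h1 : y 0 = z 0 := hiso _ ⟨y, hy, rfl, hper⟩ (by rw [← ha0]; exact hay 0)
        (by rw [← hb0]; exact hyb 0)
      have h2 : y = z := hy.eq_of_eq c.lipschitz hz h1
      subst h2
      obtain ⟨γ, T, -, hγ, -, -, rfl⟩ := hΓ'
      obtain ⟨δ', T', -, hδ', -, -, hr⟩ := c.isPeriodicOrbit_orbit hz hp h0 hzR
      obtain ⟨t, ht⟩ := hpΓ'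
      have : c.φ θ₀ (y θ₀) ∈ Set.range δ' := by rw [hr]; exact ⟨θ₀, rfl⟩
      obtain ⟨s, hs⟩ := this
      rw [← hr]
      exact range_eq_of_hasDerivAt c.smooth hγ hδ' (ht.trans hs.symm)
    · exfalso
      refine c.not_isPeriodicOrbit_of_trapped hy hper hypos ?_ hΓ' hpΓ'
      -- A bound at the beginning of a turn extends to the whole turn by comparing the shifted orbit
      -- with b.
      have hbound : ∀ (k : ℤ) (θ : ℝ), y (k * (2 * Real.pi)) < b 0 → k * (2 * Real.pi) ≤ θ →
          θ ≤ k * (2 * Real.pi) + 2 * Real.pi → y θ < R := by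
        intro k θ h1 h2 h3
        have h4 := (c.sol_shift hy k).lt_of_lt c.lipschitz hb (θ := 0) (by simpa using h1)
          (θ - k * (2 * Real.pi))
        simp only [sub_add_cancel] at h4
        exact h4.trans (hbR _ (by linarith) (by linarith))
      have hfloor : ∀ θ : ℝ, ⌊θ / (2 * Real.pi)⌋ * (2 * Real.pi) ≤ θ ∧
          θ ≤ ⌊θ / (2 * Real.pi)⌋ * (2 * Real.pi) + 2 * Real.pi := fun θ => by
        have h1 := Int.floor_le (θ / (2 * Real.pi))
        have h2 := (Int.lt_floor_add_one (θ / (2 * Real.pi))).le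
        rw [le_div_iff₀ Real.two_pi_pos] at h1
        rw [div_le_iff₀ Real.two_pi_pos] at h2
        exact ⟨h1, by linarith⟩
      rcases c.return_lt hy hz hp (b := b 0) (hyb 0) (hzb 0) with h | h
      · left
        intro θ hθ
        have hk : 0 ≤ ⌊θ / (2 * Real.pi)⌋ :=
          Int.floor_nonneg.2 (div_nonneg (by linarith) Real.two_pi_pos.le)
        refine hbound _ θ ?_ (hfloor θ).1 (hfloor θ).2
        obtain ⟨n, hn⟩ := Int.eq_ofNat_of_zero_le hk
        rw [hn]
        simpa using h n
      · right
        intro θ hθ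
        rcases le_total 0 θ with hθ' | hθ'
        · exact (hyb θ).trans (hbR θ hθ' (hθ.trans hθ1.le))
        · have hk : ⌊θ / (2 * Real.pi)⌋ ≤ 0 := by
            have : θ / (2 * Real.pi) ≤ 0 := div_nonpos_of_nonpos_of_nonneg hθ' Real.two_pi_pos.le
            exact_mod_cast (Int.floor_le _).trans this
          refine hbound _ θ ?_ (hfloor θ).1 (hfloor θ).2
          obtain ⟨n, hn⟩ := Int.eq_ofNat_of_zero_le (neg_nonneg.2 hk)
          rw [neg_eq_iff_eq_neg.1 hn]
          simpa using h n

/-- Finiteness of the set of fixed radii isolates each of them, and distinct fixed radii give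
distinct orbits by injectivity of the chart. -/
theorem card_le_numLimitCycles {P : ℝ × ℝ} {r R₁ R₂ : ℝ} (s : Finset ℝ)
    (hs : ∀ ρ ∈ s, ρ ∈ c.fixedRadii ∧ 0 < ρ ∧ ρ ≤ R₂) (h2 : R₂ < R₁)
    (hR : R₁ + 4 * Real.pi * C < R) (hfin : (c.fixedRadii ∩ Set.Ioc 0 R₁).Finite)
    (hball : ∀ θ ρ, 0 < ρ → ρ ≤ R₂ + 2 * Real.pi * C → c.φ θ ρ ∈ Metric.ball P r) :
    (s.card : ℕ∞) ≤ numLimitCycles X P r := by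
  have hC := mul_nonneg Real.pi_pos.le c.C_nonneg
  choose! f hf using fun ρ (h : ρ ∈ s) => (hs ρ h).1
  have hper : ∀ ρ ∈ s, ∀ θ, f ρ (θ + 2 * Real.pi) = f ρ θ := fun ρ h =>
    c.periodic_of_eq (hf ρ h).1 ((hf ρ h).2.2.trans (hf ρ h).2.1.symm)
  have hpos : ∀ ρ ∈ s, ∀ θ, 0 < f ρ θ := fun ρ h =>
    c.pos_of_pos (hf ρ h).1 (θ := 0) (by rw [(hf ρ h).2.1]; exact (hs ρ h).2.1)
  have hle : ∀ ρ ∈ s, ∀ θ, f ρ θ ≤ R₂ + 2 * Real.pi * C := fun ρ h θ => by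
    have := c.le_add_of_periodic (hf ρ h).1 (hper ρ h) θ
    rw [(hf ρ h).2.1] at this
    linarith [(hs ρ h).2.2]
  rw [← Set.encard_coe_eq_coe_finsetCard, numLimitCycles]
  refine Set.encard_le_encard_of_injOn (f := fun ρ => c.orbit (f ρ)) ?_ ?_
  · intro ρ hρ
    have hρ' : ρ ∈ s := hρ
    constructor
    -- A δ smaller than ρ, than the distance to R₁, and than the distances to the finitely many
    -- other fixed radii.
    · have hev : ∀ᶠ δ in 𝓝[>] (0 : ℝ), δ < ρ ∧ ρ + δ < R₁ ∧
          ∀ ρ' ∈ (c.fixedRadii ∩ Set.Ioc 0 R₁) \ {ρ}, ¬ (ρ - δ < ρ' ∧ ρ' < ρ + δ) := by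
        have h1 : ∀ᶠ δ in 𝓝[>] (0 : ℝ), δ < ρ :=
          nhdsWithin_le_nhds (gt_mem_nhds (hs ρ hρ').2.1)
        have h2 : ∀ᶠ δ in 𝓝[>] (0 : ℝ), δ < R₁ - ρ :=
          nhdsWithin_le_nhds (gt_mem_nhds (by linarith [(hs ρ hρ').2.2]))
        have h3 : ∀ᶠ δ in 𝓝[>] (0 : ℝ), ∀ ρ' ∈ (c.fixedRadii ∩ Set.Ioc 0 R₁) \ {ρ},
            δ < |ρ' - ρ| := by
          refine (Filter.eventually_all_finite (hfin.sdiff)).2 fun ρ' hρ' => ?_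
          exact nhdsWithin_le_nhds (gt_mem_nhds (abs_pos.2 (sub_ne_zero.2 hρ'.2)))
        filter_upwards [h1, h2, h3] with δ h4 h5 h6
        refine ⟨h4, by linarith, fun ρ' hρ' h7 => ?_⟩
        have := h6 ρ' hρ'
        rw [lt_abs] at this
        rcases this with h | h <;> linarith [h7.1, h7.2]
      obtain ⟨δ, ⟨h3, h4, h5⟩, h6⟩ := (hev.and self_mem_nhdsWithin).exists
      have hδ : 0 < δ := h6
      have hf0 := (hf ρ hρ').2.1
      refine c.isLimitCycle_orbit (hf ρ hρ').1 (hper ρ hρ') (hpos ρ hρ') hδ (by rw [hf0]; exact h3)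
        (by rw [hf0]; linarith) fun ρ' hρ' h7 h8 => ?_
      rw [hf0] at h7 h8 ⊢
      by_contra hne
      exact h5 ρ' ⟨⟨hρ', by linarith, by linarith⟩, hne⟩ ⟨h7, h8⟩
    · rintro _ ⟨θ, rfl⟩
      exact hball _ _ (hpos ρ hρ' θ) (hle ρ hρ' θ)
  · intro ρ hρ ρ' hρ' heq
    have hmem : c.φ 0 (f ρ 0) ∈ c.orbit (f ρ') := by
      simp only at heq; rw [← heq]; exact ⟨0, rfl⟩
    obtain ⟨θ, hθ⟩ := hmem
    obtain ⟨h5, k, hk⟩ := c.injective _ _ _ _ (hpos ρ' hρ' θ)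
      (by linarith [hle ρ' hρ' θ]) (hpos ρ hρ 0) (by linarith [hle ρ hρ 0]) hθ
    have hyper : Function.Periodic (f ρ') (2 * Real.pi) := hper ρ' hρ'
    have h6 := hyper.int_mul k θ
    rw [← hk, (hf ρ' hρ').2.1] at h6
    rw [← h6, (hf ρ hρ).2.1] at h5
    exact h5.symm

end PolarChart

/-! ### Smooth cutoffs that make the polar field globally defined and bounded. -/

section Cutoffs

/-- A smooth bump equal to one on `[1/2, 3/2]` and vanishing outside `(1/4, 7/4)`. -/
noncomputable def unitBump : ContDiffBump (1 : ℝ) := ⟨1 / 2, 3 / 4, by norm_num, by norm_num⟩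

theorem contDiff_unitBump_mul {g : ℝ → ℝ} (hg : ∀ x, x ≠ 0 → ContDiffAt ℝ ∞ g x) :
    ContDiff ℝ ∞ fun x => unitBump x * g x := by
  rw [contDiff_iff_contDiffAt]
  intro x
  rcases eq_or_ne x 0 with rfl | hx
  · have : (fun x => unitBump x * g x) =ᶠ[𝓝 0] fun _ => 0 := by
      filter_upwards [Metric.ball_mem_nhds (0 : ℝ) (ε := 1 / 4) (by norm_num)] with x hx
      rw [unitBump.zero_of_le_dist, zero_mul]
      rw [Metric.mem_ball, Real.dist_eq, sub_zero] at hx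
      rw [Real.dist_eq]
      have := abs_lt.1 hx
      show (3 / 4 : ℝ) ≤ |x - 1|
      rw [abs_of_neg (by linarith)]
      linarith
    exact contDiffAt_const.congr_of_eventuallyEq this
  · exact unitBump.contDiff.contDiffAt.mul (hg x hx)

theorem unitBump_eq_one {x : ℝ} (h1 : 1 / 2 ≤ x) (h2 : x ≤ 3 / 2) : unitBump x = 1 := by
  apply unitBump.one_of_mem_closedBall
  rw [Metric.mem_closedBall, Real.dist_eq, abs_le]
  show -(1 / 2 : ℝ) ≤ _ ∧ _ ≤ (1 / 2 : ℝ)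
  constructor <;> linarith

/-- A smooth function equal to `x⁻¹` on `[1/2, 3/2]`. -/
noncomputable def smoothInv (x : ℝ) : ℝ := unitBump x * x⁻¹

/-- A smooth function equal to `√x` on `[1/2, 3/2]`. -/
noncomputable def smoothSqrt (x : ℝ) : ℝ := unitBump x * √x

theorem contDiff_smoothInv : ContDiff ℝ ∞ smoothInv :=
  contDiff_unitBump_mul fun _ hx => contDiffAt_inv ℝ hx

theorem contDiff_smoothSqrt : ContDiff ℝ ∞ smoothSqrt :=
  contDiff_unitBump_mul fun _ hx => Real.contDiffAt_sqrt hx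

theorem smoothInv_eq {x : ℝ} (h1 : 1 / 2 ≤ x) (h2 : x ≤ 3 / 2) : smoothInv x = x⁻¹ := by
  rw [smoothInv, unitBump_eq_one h1 h2, one_mul]

theorem smoothSqrt_eq {x : ℝ} (h1 : 1 / 2 ≤ x) (h2 : x ≤ 3 / 2) : smoothSqrt x = √x := by
  rw [smoothSqrt, unitBump_eq_one h1 h2, one_mul]

/-- A smooth bump equal to one on `[-1/4, 1/4]` and vanishing outside `(-3/8, 3/8)`. -/
noncomputable def originBump : ContDiffBump (0 : ℝ) := ⟨1 / 4, 3 / 8, by norm_num, by norm_num⟩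

/-- A smooth bounded odd function equal to the identity on `[-1/4, 1/4]`. -/
noncomputable def clamp (ρ : ℝ) : ℝ := ρ * originBump ρ

theorem contDiff_clamp : ContDiff ℝ ∞ clamp := contDiff_id.mul originBump.contDiff

theorem clamp_eq {ρ : ℝ} (h : |ρ| ≤ 1 / 4) : clamp ρ = ρ := by
  rw [clamp, originBump.one_of_mem_closedBall, mul_one]
  rw [Metric.mem_closedBall, Real.dist_eq, sub_zero]
  exact h

theorem clamp_eq_zero {ρ : ℝ} (h : 3 / 8 ≤ |ρ|) : clamp ρ = 0 := by
  rw [clamp, originBump.zero_of_le_dist, mul_zero]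
  rw [Real.dist_eq, sub_zero]
  exact h

theorem abs_clamp_le (ρ : ℝ) : |clamp ρ| ≤ 3 / 8 := by
  rcases le_total (3 / 8) |ρ| with h | h
  · rw [clamp_eq_zero h]; norm_num
  · rw [clamp, abs_mul]
    calc |ρ| * |originBump ρ| ≤ |ρ| * 1 := by
          gcongr
          rw [abs_of_nonneg originBump.nonneg]
          exact originBump.le_one
      _ ≤ 3 / 8 := by linarith

theorem clamp_neg (ρ : ℝ) : clamp (-ρ) = -clamp ρ := by
  rw [clamp, clamp, originBump.neg]; ring

theorem clamp_zero : clamp 0 = 0 := by simp [clamp]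

end Cutoffs

/-! ### The polar equation and its symmetries. -/

section PolarField

variable (A B : ℝ × ℝ → ℝ)

/-- The clockwise unit vector. -/
noncomputable def unitVec (θ : ℝ) : ℝ × ℝ := (Real.cos θ, -Real.sin θ)

theorem contDiff_unitVec : ContDiff ℝ ∞ unitVec :=
  Real.contDiff_cos.prodMk Real.contDiff_sin.neg

/-- The radial component of the perturbation, divided by the radius. -/
noncomputable def radialPart (θ κ : ℝ) (q : ℝ × ℝ) : ℝ :=
  Real.cos θ * hadamardQuotient A q (unitVec θ) κ -
    Real.sin θ * hadamardQuotient B q (unitVec θ) κ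

/-- The angular component of the perturbation, divided by the radius. -/
noncomputable def angularPart (θ κ : ℝ) (q : ℝ × ℝ) : ℝ :=
  Real.sin θ * hadamardQuotient A q (unitVec θ) κ +
    Real.cos θ * hadamardQuotient B q (unitVec θ) κ

/-- The right-hand side of the polar equation `dρ/dθ = S`. -/
noncomputable def polarS (p : ℝ × ℝ × (ℝ × ℝ) × ℝ) : ℝ :=
  p.2.2.2 * clamp p.2.1 * radialPart A B p.1 (clamp p.2.1) p.2.2.1 *
    smoothInv (1 - p.2.2.2 * angularPart A B p.1 (clamp p.2.1) p.2.2.1)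

variable {A B}

theorem contDiff_hadamard_polar (hA : ContDiff ℝ ∞ A) :
    ContDiff ℝ ∞ fun p : ℝ × ℝ × (ℝ × ℝ) × ℝ =>
      hadamardQuotient A p.2.2.1 (unitVec p.1) (clamp p.2.1) := by
  have h := contDiff_hadamardQuotient hA
  have h2 : ContDiff ℝ ∞ fun p : ℝ × ℝ × (ℝ × ℝ) × ℝ =>
      (p.2.2.1, unitVec p.1, clamp p.2.1) := by
    have := contDiff_unitVec
    have := contDiff_clamp
    fun_prop
  exact h.comp h2

theorem contDiff_radialPart (hA : ContDiff ℝ ∞ A) (hB : ContDiff ℝ ∞ B) :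
    ContDiff ℝ ∞ fun p : ℝ × ℝ × (ℝ × ℝ) × ℝ =>
      radialPart A B p.1 (clamp p.2.1) p.2.2.1 :=
  ((Real.contDiff_cos.comp contDiff_fst).mul (contDiff_hadamard_polar hA)).sub
    ((Real.contDiff_sin.comp contDiff_fst).mul (contDiff_hadamard_polar hB))

theorem contDiff_angularPart (hA : ContDiff ℝ ∞ A) (hB : ContDiff ℝ ∞ B) :
    ContDiff ℝ ∞ fun p : ℝ × ℝ × (ℝ × ℝ) × ℝ =>
      angularPart A B p.1 (clamp p.2.1) p.2.2.1 :=
  ((Real.contDiff_sin.comp contDiff_fst).mul (contDiff_hadamard_polar hA)).add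
    ((Real.contDiff_cos.comp contDiff_fst).mul (contDiff_hadamard_polar hB))

theorem contDiff_polarS (hA : ContDiff ℝ ∞ A) (hB : ContDiff ℝ ∞ B) :
    ContDiff ℝ ∞ (polarS A B) := by
  have h1 := contDiff_radialPart hA hB
  have h2 := contDiff_angularPart hA hB
  have h3 := contDiff_clamp
  have h4 := contDiff_smoothInv
  unfold polarS
  fun_prop

theorem polarS_zero_right (θ ρ : ℝ) (q : ℝ × ℝ) : polarS A B (θ, ρ, q, 0) = 0 := by
  simp [polarS]

theorem polarS_zero_radius (θ : ℝ) (q : ℝ × ℝ) (ε : ℝ) : polarS A B (θ, 0, q, ε) = 0 := by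
  simp [polarS, clamp_zero]

theorem unitVec_add_two_pi (θ : ℝ) : unitVec (θ + 2 * Real.pi) = unitVec θ := by
  simp [unitVec]

theorem radialPart_add_two_pi (θ κ : ℝ) (q : ℝ × ℝ) :
    radialPart A B (θ + 2 * Real.pi) κ q = radialPart A B θ κ q := by
  simp [radialPart, unitVec_add_two_pi]

theorem angularPart_add_two_pi (θ κ : ℝ) (q : ℝ × ℝ) :
    angularPart A B (θ + 2 * Real.pi) κ q = angularPart A B θ κ q := by
  simp [angularPart, unitVec_add_two_pi]

theorem polarS_add_two_pi (θ ρ : ℝ) (q : ℝ × ℝ) (ε : ℝ) :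
    polarS A B (θ + 2 * Real.pi, ρ, q, ε) = polarS A B (θ, ρ, q, ε) := by
  simp only [polarS, radialPart_add_two_pi, angularPart_add_two_pi]

theorem hadamardQuotient_neg_neg (A : ℝ × ℝ → ℝ) (q e : ℝ × ℝ) (κ : ℝ) :
    hadamardQuotient A q (-e) (-κ) = -hadamardQuotient A q e κ := by
  simp only [hadamardQuotient, mul_neg, smul_neg, neg_smul, neg_neg, map_neg,
    intervalIntegral.integral_neg]

theorem unitVec_add_pi (θ : ℝ) : unitVec (θ + Real.pi) = -unitVec θ := by
  simp [unitVec]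

/-- The polar coordinates (θ + π, −ρ) and (θ, ρ) describe the same point. This symmetry is why each
closed orbit is also seen at a negative radius. -/
theorem polarS_add_pi_neg (θ ρ : ℝ) (q : ℝ × ℝ) (ε : ℝ) :
    polarS A B (θ + Real.pi, -ρ, q, ε) = -polarS A B (θ, ρ, q, ε) := by
  simp only [polarS, radialPart, angularPart, clamp_neg, unitVec_add_pi,
    hadamardQuotient_neg_neg, Real.cos_add_pi, Real.sin_add_pi]
  ring_nf

theorem polarS_eq_zero {θ ρ : ℝ} (q : ℝ × ℝ) (ε : ℝ) (h : 3 / 8 ≤ |ρ|) :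
    polarS A B (θ, ρ, q, ε) = 0 := by
  simp [polarS, clamp_eq_zero h]

/-- A uniform bound of the perturbation near the origin. -/
theorem exists_bound_parts (hA : ContDiff ℝ ∞ A) (hB : ContDiff ℝ ∞ B) :
    ∃ M, 0 < M ∧ ∀ θ ρ : ℝ, ∀ q : ℝ × ℝ, ‖q‖ ≤ 1 →
      |radialPart A B θ (clamp ρ) q| ≤ M ∧ |angularPart A B θ (clamp ρ) q| ≤ M := by
  have hc : IsCompact (Set.Icc 0 (2 * Real.pi) ×ˢ Set.Icc (-1 : ℝ) 1 ×ˢ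
      Metric.closedBall (0 : ℝ × ℝ) 1 ×ˢ ({0} : Set ℝ)) :=
    isCompact_Icc.prod (isCompact_Icc.prod ((isCompact_closedBall _ _).prod isCompact_singleton))
  obtain ⟨M₁, hM₁⟩ := hc.exists_bound_of_continuousOn
    (contDiff_radialPart hA hB).continuous.continuousOn
  obtain ⟨M₂, hM₂⟩ := hc.exists_bound_of_continuousOn
    (contDiff_angularPart hA hB).continuous.continuousOn
  have key : ∀ θ ∈ Set.Ico 0 (2 * Real.pi), ∀ ρ : ℝ, ∀ q : ℝ × ℝ, ‖q‖ ≤ 1 →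
      |radialPart A B θ (clamp ρ) q| ≤ M₁ ∧ |angularPart A B θ (clamp ρ) q| ≤ M₂ := by
    intro θ hθ ρ q hq
    -- All values of the cutoff are attained on [−1, 1], so compactness in ρ is available.
    have h : ∃ ρ', ρ' ∈ Set.Icc (-1 : ℝ) 1 ∧ clamp ρ' = clamp ρ := by
      rcases le_total |ρ| 1 with h | h
      · exact ⟨ρ, abs_le.1 h, rfl⟩
      · exact ⟨0, by norm_num, by rw [clamp_zero, clamp_eq_zero (by linarith)]⟩
    obtain ⟨ρ', hρ', heq⟩ := h
    have hmem : (θ, ρ', q, (0 : ℝ)) ∈ (Set.Icc 0 (2 * Real.pi) ×ˢ Set.Icc (-1 : ℝ) 1 ×ˢ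
      Metric.closedBall (0 : ℝ × ℝ) 1 ×ˢ ({0} : Set ℝ)) :=
      ⟨Set.Ico_subset_Icc_self hθ, hρ', by simpa using hq, rfl⟩
    have h1 := hM₁ _ hmem
    have h2 := hM₂ _ hmem
    simp only [heq] at h1 h2
    exact ⟨h1, h2⟩
  refine ⟨max (max M₁ M₂) 1, lt_max_of_lt_right one_pos, fun θ ρ q hq => ?_⟩
  have hper : Function.Periodic (fun θ => (radialPart A B θ (clamp ρ) q,
      angularPart A B θ (clamp ρ) q)) (2 * Real.pi) := fun θ => by
    simp only [radialPart_add_two_pi, angularPart_add_two_pi]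
  obtain ⟨θ', hθ', h⟩ := hper.exists_mem_Ico₀ Real.two_pi_pos θ
  obtain ⟨h1, h2⟩ := key θ' hθ' ρ q hq
  rw [Prod.mk.injEq] at h
  rw [h.1, h.2]
  exact ⟨h1.trans ((le_max_left _ _).trans (le_max_left _ _)),
    h2.trans ((le_max_right _ _).trans (le_max_left _ _))⟩

/-- The ρ-derivative is bounded on the compact set |ρ| ≤ 1, 0 ≤ θ ≤ 2π, it is periodic in θ, and it
vanishes for |ρ| > 1 because the field does. -/
theorem exists_lipschitz_polarS (hA : ContDiff ℝ ∞ A) (hB : ContDiff ℝ ∞ B) (q : ℝ × ℝ) (ε : ℝ) :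
    ∃ K : NNReal, ∀ θ, LipschitzWith K fun ρ => polarS A B (θ, ρ, q, ε) := by
  let F : ℝ × ℝ → ℝ := fun z => polarS A B (z.2, z.1, q, ε)
  have hF : ContDiff ℝ ∞ F := (contDiff_polarS hA hB).comp (by fun_prop)
  have hd : ∀ θ ρ, HasDerivAt (fun r => F (r, θ)) (partialFst F (ρ, θ)) ρ := fun θ ρ =>
    hasDerivAt_partialFst (hF.differentiable (by simp) _)
  have hpc : Continuous (partialFst F) :=
    continuous_iff_continuousAt.2 fun z => hF.contDiffAt.partialFst.continuousAt
  obtain ⟨K, hK⟩ := (isCompact_Icc (a := (-1 : ℝ)) (b := 1)).prod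
    (isCompact_Icc (a := (0 : ℝ)) (b := 2 * Real.pi)) |>.exists_bound_of_continuousOn
    hpc.continuousOn
  refine ⟨(max K 0).toNNReal, fun θ => ?_⟩
  have hfun : Function.Periodic (fun θ => fun ρ => polarS A B (θ, ρ, q, ε)) (2 * Real.pi) :=
    fun θ => funext fun ρ => polarS_add_two_pi θ ρ q ε
  obtain ⟨θ', hθ', h⟩ := hfun.exists_mem_Ico₀ Real.two_pi_pos θ
  replace h : (fun ρ => polarS A B (θ, ρ, q, ε)) = fun ρ => polarS A B (θ', ρ, q, ε) := h
  rw [h]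
  refine lipschitzWith_of_nnnorm_deriv_le (fun ρ => (hd θ' ρ).differentiableAt) fun ρ => ?_
  have h1 : deriv (fun ρ => polarS A B (θ', ρ, q, ε)) ρ = partialFst F (ρ, θ') := (hd θ' ρ).deriv
  rw [← NNReal.coe_le_coe, coe_nnnorm, Real.coe_toNNReal _ (le_max_right _ _), h1]
  rcases le_or_gt |ρ| 1 with hρ | hρ
  · exact (hK (ρ, θ') ⟨abs_le.1 hρ, Set.Ico_subset_Icc_self hθ'⟩).trans (le_max_left _ _)
  · have h0 : (fun r => F (r, θ')) =ᶠ[𝓝 ρ] fun _ => 0 := by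
      filter_upwards [continuous_abs.continuousAt.eventually (lt_mem_nhds hρ)] with r hr
      exact polarS_eq_zero _ _ (by linarith)
    rw [← h1]
    have h3 : deriv (fun ρ => polarS A B (θ', ρ, q, ε)) ρ = 0 := by
      have := h0.deriv_eq
      simpa using this
    rw [h3]
    simp

theorem abs_polarS_le {M : ℝ} (hM : ∀ θ ρ : ℝ, ∀ q : ℝ × ℝ, ‖q‖ ≤ 1 →
      |radialPart A B θ (clamp ρ) q| ≤ M ∧ |angularPart A B θ (clamp ρ) q| ≤ M)
    {q : ℝ × ℝ} (hq : ‖q‖ ≤ 1) {ε : ℝ} (hε : |ε| * M ≤ 1 / 2) (θ ρ : ℝ) :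
    |polarS A B (θ, ρ, q, ε)| ≤ |ε| * M := by
  obtain ⟨h1, h2⟩ := hM θ ρ q hq
  have h3 : |ε * angularPart A B θ (clamp ρ) q| ≤ 1 / 2 := by
    rw [abs_mul]
    exact (mul_le_mul_of_nonneg_left h2 (abs_nonneg _)).trans hε
  have h4 := abs_le.1 h3
  simp only [polarS]
  rw [smoothInv_eq (by linarith) (by linarith), abs_mul, abs_mul, abs_mul, abs_inv]
  have h5 : |1 - ε * angularPart A B θ (clamp ρ) q|⁻¹ ≤ 2 := by
    rw [abs_of_pos (by linarith)]
    rw [inv_le_comm₀ (by linarith) (by norm_num)]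
    linarith
  have hM0 : 0 ≤ M := (abs_nonneg _).trans h1
  calc |ε| * |clamp ρ| * |radialPart A B θ (clamp ρ) q| *
        |1 - ε * angularPart A B θ (clamp ρ) q|⁻¹ ≤ |ε| * (3 / 8) * M * 2 := by
        gcongr
        exact abs_clamp_le ρ
    _ ≤ |ε| * M := by nlinarith [mul_nonneg (abs_nonneg ε) ((abs_nonneg _).trans h1)]

end PolarField

/-! ### Smooth dependence on initial radius and parameter by the implicit function theorem. -/

section SmoothDependence

theorem const_of_field_eq_zero {V : Type} {G : ℝ × ℝ × V × ℝ → ℝ}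
    (hG0 : ∀ θ ρ q, G (θ, ρ, q, 0) = 0) {v : V} {y : ℝ → ℝ}
    (hy : ∀ θ, HasDerivAt y (G (θ, y θ, v, 0)) θ) (θ : ℝ) : y θ = y 0 :=
  is_const_of_deriv_eq_zero (fun θ => (hy θ).differentiableAt)
    (fun θ => by rw [(hy θ).deriv, hG0]) θ 0

/-- Smooth dependence, at a parameter where the field vanishes, of an integral along solutions. -/
theorem contDiffAt_integral_along_solutions {V : Type} [NormedAddCommGroup V] [NormedSpace ℝ V]
    [CompleteSpace V] {G E : ℝ × ℝ × V × ℝ → ℝ} (hG : ContDiff ℝ ∞ G)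
    (hE : ContDiff ℝ ∞ E) (hG0 : ∀ θ ρ q, G (θ, ρ, q, 0) = 0) {q : ℝ → V}
    (hq : ContDiffAt ℝ ∞ q 0) {T : ℝ} (hT : 0 ≤ T) {Y : ℝ → ℝ → ℝ → ℝ}
    (hY : ∀ᶠ ε in 𝓝 0, (∃ K : NNReal, ∀ θ, LipschitzWith K fun ρ => G (θ, ρ, q ε, ε)) ∧
      ∀ ρ, Y ε ρ 0 = ρ ∧ ∀ θ, HasDerivAt (Y ε ρ) (G (θ, Y ε ρ θ, q ε, ε)) θ) (ρ₀ : ℝ) :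
    ContDiffAt ℝ ∞ (fun z : ℝ × ℝ => ∫ θ in (0 : ℝ)..T, E (θ, Y z.2 z.1 θ, q z.2, z.2))
      (ρ₀, 0) := by
  let κ : C(Set.Icc (0 : ℝ) T, ℝ) := ⟨Subtype.val, continuous_subtype_val⟩
  let NG : C(Set.Icc (0 : ℝ) T, ℝ) × (V × ℝ) → C(Set.Icc (0 : ℝ) T, ℝ) := fun p =>
    ⟨fun k => G (κ k, p.1 k, p.2), by have := hG.continuous; fun_prop⟩
  let NE : C(Set.Icc (0 : ℝ) T, ℝ) × (V × ℝ) → C(Set.Icc (0 : ℝ) T, ℝ) := fun p =>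
    ⟨fun k => E (κ k, p.1 k, p.2), by have := hE.continuous; fun_prop⟩
  have hNG : ContDiff ℝ ∞ NG := contDiff_nemytskii κ G hG
  have hNE : ContDiff ℝ ∞ NE := contDiff_nemytskii κ E hE
  -- The zeros of Φ are the solutions of the integral equation y = ρ + ∫ G on [0, T].
  let Φ : (ℝ × ℝ) × C(Set.Icc (0 : ℝ) T, ℝ) → C(Set.Icc (0 : ℝ) T, ℝ) := fun w =>
    w.2 - constL _ w.1.1 - primitiveL T hT (NG (w.2, (q w.1.2, w.1.2)))
  let u : (ℝ × ℝ) × C(Set.Icc (0 : ℝ) T, ℝ) := ((ρ₀, 0), constL _ ρ₀)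
  have hq1 : ContDiffAt ℝ ∞ (fun w : (ℝ × ℝ) × C(Set.Icc (0 : ℝ) T, ℝ) => q w.1.2) u :=
    ContDiffAt.comp u (g := q) (by exact hq) contDiffAt_fst.snd
  have hprim : ContDiff ℝ ∞ fun f : C(Set.Icc (0 : ℝ) T, ℝ) => primitiveL T hT f :=
    ContinuousLinearMap.contDiff (primitiveL (W := ℝ) T hT)
  have hconst : ContDiff ℝ ∞ fun r : ℝ => constL (Set.Icc (0 : ℝ) T) r :=
    ContinuousLinearMap.contDiff (constL (M := ℝ) (Set.Icc (0 : ℝ) T))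
  have hΦ : ContDiffAt ℝ ∞ Φ u := by
    have h1 : ContDiffAt ℝ ∞ (fun w : (ℝ × ℝ) × C(Set.Icc (0 : ℝ) T, ℝ) =>
        NG (w.2, (q w.1.2, w.1.2))) u :=
      hNG.contDiffAt.comp u (contDiffAt_snd.prodMk (hq1.prodMk contDiffAt_fst.snd))
    refine (contDiffAt_snd.sub ?_).sub (hprim.contDiffAt.comp u h1)
    exact hconst.contDiffAt.comp u contDiffAt_fst.fst
  have hNG0 : ∀ y, NG (y, (q 0, 0)) = 0 := fun y => ContinuousMap.ext fun k => hG0 _ _ _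
  -- At ε = 0 the integral term vanishes identically in y, so the partial derivative is the
  -- identity.
  have hinv : (fderiv ℝ Φ u ∘L .inr ℝ (ℝ × ℝ) C(Set.Icc (0 : ℝ) T, ℝ)) =
      ContinuousLinearMap.id ℝ _ := by
    have h1 : HasFDerivAt (fun y => Φ ((ρ₀, 0), y))
        (fderiv ℝ Φ u ∘L .inr ℝ (ℝ × ℝ) C(Set.Icc (0 : ℝ) T, ℝ)) (constL _ ρ₀) :=
      (hΦ.differentiableAt (by simp)).hasFDerivAt.comp (constL _ ρ₀)
        (hasFDerivAt_prodMk_right (ρ₀, (0 : ℝ)) (constL _ ρ₀))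
    have h2 : HasFDerivAt (fun y => Φ ((ρ₀, 0), y)) (ContinuousLinearMap.id ℝ _)
        (constL _ ρ₀) := by
      simp only [Φ, hNG0, map_zero, sub_zero]
      exact (hasFDerivAt_id _).sub_const _
    exact h1.unique h2
  have hinv' : (fderiv ℝ Φ u ∘L .inr ℝ (ℝ × ℝ) C(Set.Icc (0 : ℝ) T, ℝ)).IsInvertible := by
    rw [hinv]; exact ⟨ContinuousLinearEquiv.refl ℝ _, rfl⟩
  let ψ := hΦ.implicitFunction (by simp) hinv'
  have hψ : ContDiffAt ℝ ∞ ψ (ρ₀, 0) := hΦ.contDiffAt_implicitFunction (by simp) hinv'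
  have hψu : ψ (ρ₀, 0) = constL _ ρ₀ := hΦ.implicitFunction_apply_self (by simp) hinv'
  have hΦu : Φ u = 0 := by
    simp only [Φ, u, hNG0, map_zero, sub_self]
  have hev : ∀ᶠ z in 𝓝 (ρ₀, (0 : ℝ)), Φ (z, ψ z) = 0 := by
    have := hΦ.eventually_apply_implicitFunction (by simp) hinv'
    rwa [hΦu] at this
  have hq2 : ContDiffAt ℝ ∞ (fun z : ℝ × ℝ => q z.2) (ρ₀, 0) :=
    ContDiffAt.comp (ρ₀, (0 : ℝ)) (g := q) (by exact hq) contDiffAt_snd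
  let T' : Set.Icc (0 : ℝ) T := ⟨T, hT, le_rfl⟩
  have hD : ContDiffAt ℝ ∞ (fun z : ℝ × ℝ =>
      evalL T' (primitiveL T hT (NE (ψ z, (q z.2, z.2))))) (ρ₀, 0) := by
    have h1 : ContDiffAt ℝ ∞ (fun z : ℝ × ℝ => NE (ψ z, (q z.2, z.2))) (ρ₀, 0) :=
      hNE.contDiffAt.comp _ (hψ.prodMk (hq2.prodMk contDiffAt_snd))
    exact (evalL (W := ℝ) T').contDiff.contDiffAt.comp _
      (hprim.contDiffAt.comp _ h1)
  refine hD.congr_of_eventuallyEq ?_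
  have hY2 : ∀ᶠ z in 𝓝 (ρ₀, (0 : ℝ)), _ := continuous_snd.continuousAt.eventually hY
  filter_upwards [hev, hY2] with z hz ⟨⟨K, hK⟩, hYz⟩
  obtain ⟨hY0, hYd⟩ := hYz z.1
  have hpt : ∀ t : Set.Icc (0 : ℝ) T, ψ z t = z.1 + ∫ s in (0 : ℝ)..t,
      Set.IccExtend hT (NG (ψ z, (q z.2, z.2))) s := fun t => by
    have := congrArg (fun f : C(Set.Icc (0 : ℝ) T, ℝ) => f t) hz
    have h2 : ψ z t - z.1 - ∫ s in (0 : ℝ)..t,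
      Set.IccExtend hT (NG (ψ z, (q z.2, z.2))) s = 0 := this
    linarith
  let yh : ℝ → ℝ := fun t => z.1 + ∫ s in (0 : ℝ)..t,
      Set.IccExtend hT (NG (ψ z, (q z.2, z.2))) s
  have hyh : ∀ t, HasDerivAt yh (Set.IccExtend hT (NG (ψ z, (q z.2, z.2))) t) t := fun t =>
    (((NG (ψ z, (q z.2, z.2))).continuous.Icc_extend' (h := hT)).integral_hasStrictDerivAt
      0 t).hasDerivAt.const_add z.1
  have hyh2 : ∀ t ∈ Set.Icc 0 T, HasDerivAt yh (G (t, yh t, q z.2, z.2)) t := fun t ht => by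
    have h := hyh t
    rw [Set.IccExtend_of_mem hT _ ht] at h
    have h2 : yh t = ψ z ⟨t, ht⟩ := (hpt ⟨t, ht⟩).symm
    rw [h2]
    exact h
  -- The implicit function provides some solution of the integral equation; uniqueness identifies it
  -- with the given family Y.
  have heq : Set.EqOn (Y z.2 z.1) yh (Set.Icc 0 T) :=
    ODE_solution_unique (v := fun θ ρ => G (θ, ρ, q z.2, z.2)) (K := K)
      (fun t => hK t)
      (fun t _ => (hYd t).continuousAt.continuousWithinAt)
      (fun t _ => (hYd t).hasDerivWithinAt)
      (fun t _ => (hyh t).continuousAt.continuousWithinAt)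
      (fun t ht => (hyh2 t ⟨ht.1, ht.2.le⟩).hasDerivWithinAt)
      (by rw [hY0]; simp [yh])
  show _ = ∫ s in (0 : ℝ)..T, Set.IccExtend hT (NE (ψ z, (q z.2, z.2))) s
  refine intervalIntegral.integral_congr fun t ht => ?_
  rw [Set.uIcc_of_le hT] at ht
  show E _ = Set.IccExtend hT (NE (ψ z, (q z.2, z.2))) t
  rw [Set.IccExtend_of_mem hT _ ht, heq ht]
  have h2 : yh t = ψ z ⟨t, ht⟩ := (hpt ⟨t, ht⟩).symm
  rw [h2]
  rfl

end SmoothDependence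

/-! ### The polar chart about the perturbed equilibrium near (1, 0). -/

section Chart

theorem contDiff_cubicPoly (c : ℕ → ℕ → ℝ) {n : WithTop ℕ∞} :
    ContDiff ℝ n fun p : ℝ × ℝ => cubicPoly c p.1 p.2 := by
  unfold cubicPoly
  fun_prop

theorem contDiff_perturbedField (a b : ℕ → ℕ → ℝ) (ε : ℝ) :
    ContDiff ℝ 1 (perturbedField a b ε) := by
  have h1 := contDiff_cubicPoly a (n := 1)
  have h2 := contDiff_cubicPoly b (n := 1)
  unfold perturbedField
  fun_prop

/-- The abscissa as a function of `u = x² - 1`. -/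
noncomputable def abscissa (u : ℝ) : ℝ := smoothSqrt (1 + u)

theorem contDiff_abscissa : ContDiff ℝ ∞ abscissa :=
  contDiff_smoothSqrt.comp (contDiff_const.add contDiff_id)

theorem abscissa_eq {u : ℝ} (h : |u| ≤ 1 / 2) : abscissa u = √(1 + u) := by
  have := abs_le.1 h
  exact smoothSqrt_eq (by linarith) (by linarith)

theorem abscissa_sq {u : ℝ} (h : |u| ≤ 1 / 2) : abscissa u ^ 2 = 1 + u := by
  rw [abscissa_eq h, Real.sq_sqrt (by linarith [(abs_le.1 h).1])]

theorem half_le_abscissa {u : ℝ} (h : |u| ≤ 1 / 2) : 1 / 2 ≤ abscissa u := by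
  rw [abscissa_eq h]
  exact Real.le_sqrt_of_sq_le (by linarith [(abs_le.1 h).1])

theorem abscissa_le {u : ℝ} (h : |u| ≤ 1 / 2) : abscissa u ≤ 3 / 2 := by
  rw [abscissa_eq h, Real.sqrt_le_left (by norm_num)]
  linarith [(abs_le.1 h).2]

theorem abscissa_eq_of_sq {u x : ℝ} (h : |u| ≤ 1 / 2) (hx : 0 ≤ x) (hxu : x ^ 2 = 1 + u) :
    abscissa u = x := by
  rw [abscissa_eq h, ← hxu, Real.sqrt_sq hx]

theorem abs_abscissa_sub_one_le {u : ℝ} (h : |u| ≤ 1 / 2) : |abscissa u - 1| ≤ |u| := by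
  have h1 := abscissa_sq h
  have h2 := half_le_abscissa h
  have h3 : |abscissa u - 1| * (abscissa u + 1) = |u| := by
    have h4 := abs_mul (abscissa u - 1) (abscissa u + 1)
    rw [abs_of_pos (show 0 < abscissa u + 1 by linarith)] at h4
    rw [← h4]
    congr 1
    linarith
  nlinarith [abs_nonneg (abscissa u - 1)]

theorem hasDerivAt_abscissa {u : ℝ} (h : |u| < 1 / 2) :
    HasDerivAt abscissa (1 / (2 * abscissa u)) u := by
  have h1 : abscissa =ᶠ[𝓝 u] fun u => √(1 + u) := by
    filter_upwards [continuous_abs.continuousAt.eventually (gt_mem_nhds h)] with w hw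
    exact abscissa_eq hw.le
  rw [abscissa_eq h.le]
  exact (((hasDerivAt_id u).const_add 1).sqrt
    (by have := (abs_lt.1 h).1; simp only [id]; linarith)).congr_of_eventuallyEq h1

/-- The horizontal component of the perturbation in the coordinates `u = x² - 1`, `v = √2 y`. -/
noncomputable def fieldA (a : ℕ → ℕ → ℝ) (p : ℝ × ℝ) : ℝ :=
  √2 * cubicPoly a (abscissa p.1) (p.2 / √2)

/-- The vertical component of the perturbation in the coordinates `u = x² - 1`, `v = √2 y`. -/
noncomputable def fieldB (b : ℕ → ℕ → ℝ) (p : ℝ × ℝ) : ℝ :=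
  cubicPoly b (abscissa p.1) (p.2 / √2) * smoothInv (abscissa p.1)

theorem contDiff_abscissa_prod :
    ContDiff ℝ ∞ fun p : ℝ × ℝ => (abscissa p.1, p.2 / √2) :=
  (contDiff_abscissa.comp contDiff_fst).prodMk (contDiff_snd.div_const _)

theorem contDiff_fieldA (a : ℕ → ℕ → ℝ) : ContDiff ℝ ∞ (fieldA a) :=
  contDiff_const.mul ((contDiff_cubicPoly a).comp contDiff_abscissa_prod)

theorem contDiff_fieldB (b : ℕ → ℕ → ℝ) : ContDiff ℝ ∞ (fieldB b) :=
  ((contDiff_cubicPoly b).comp contDiff_abscissa_prod).mul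
    (contDiff_smoothInv.comp (contDiff_abscissa.comp contDiff_fst))

/-- The polar coordinates around the point `q` of the plane of `(x² - 1, √2 y)`. -/
noncomputable def polarMap (q : ℝ × ℝ) (θ ρ : ℝ) : ℝ × ℝ :=
  (abscissa (q.1 + ρ * Real.cos θ), (q.2 - ρ * Real.sin θ) / √2)

/-- The angular speed. -/
noncomputable def polarSpeed (a b : ℕ → ℕ → ℝ) (q : ℝ × ℝ) (ε θ ρ : ℝ) : ℝ :=
  √2 * abscissa (q.1 + clamp ρ * Real.cos θ) *
    (1 - ε * angularPart (fieldA a) (fieldB b) θ (clamp ρ) q)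

theorem contDiff_polarMap :
    ContDiff ℝ ∞ fun p : (ℝ × ℝ) × ℝ × ℝ => polarMap p.1 p.2.1 p.2.2 := by
  have h := contDiff_abscissa
  have hc := Real.contDiff_cos (n := ∞)
  have hs := Real.contDiff_sin (n := ∞)
  unfold polarMap
  fun_prop

theorem abs_add_mul_le {q : ℝ × ℝ} {ρ t r : ℝ} (hq : ‖q‖ ≤ 1 / 8) (ht : |t| ≤ 1) (hρ : |ρ| ≤ r) :
    |q.1 + ρ * t| ≤ 1 / 8 + r := by
  have h1 : |q.1| ≤ 1 / 8 := (norm_fst_le q).trans hq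
  have h2 : |ρ * t| ≤ r := by
    rw [abs_mul]
    nlinarith [abs_nonneg ρ, abs_nonneg t]
  exact (abs_add_le _ _).trans (add_le_add h1 h2)

theorem hasDerivAt_polarMap_curve {q : ℝ × ℝ} (hq : ‖q‖ ≤ 1 / 8) {y : ℝ → ℝ} {y' θ : ℝ}
    (hy : HasDerivAt y y' θ) (hR : |y θ| < 1 / 4) :
    HasDerivAt (fun θ => polarMap q θ (y θ))
      ((y' * Real.cos θ - y θ * Real.sin θ) / (2 * (polarMap q θ (y θ)).1),
        -(y' * Real.sin θ + y θ * Real.cos θ) / √2) θ := by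
  have hu : |q.1 + y θ * Real.cos θ| < 1 / 2 :=
    (abs_add_mul_le hq (Real.abs_cos_le_one θ) hR.le).trans_lt (by norm_num)
  have h1 := (hasDerivAt_abscissa hu).comp θ
    ((hy.mul (Real.hasDerivAt_cos θ)).const_add q.1)
  have h2 := ((hy.mul (Real.hasDerivAt_sin θ)).const_sub q.2).div_const √2
  refine (h1.prodMk h2).congr_deriv ?_
  rw [polarMap, Prod.mk.injEq]
  constructor
  · simp only
    ring
  · ring

/-- After division by √2 x the field reads (v + εA, −u + εB) in the coordinates u, v. Subtracting
the two equilibrium equations makes both components multiples of ρ through Hadamard quotients, and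
their radial and angular parts give S and the speed. -/
theorem hasDerivAt_polarMap_field {a b : ℕ → ℕ → ℝ} {q : ℝ × ℝ} {ε : ℝ} (hq : ‖q‖ ≤ 1 / 8)
    (hA : q.2 = -ε * fieldA a q) (hB : q.1 = ε * fieldB b q) {y : ℝ → ℝ} {θ : ℝ}
    (hang : |ε * angularPart (fieldA a) (fieldB b) θ (clamp (y θ)) q| ≤ 1 / 2)
    (hy : HasDerivAt y (polarS (fieldA a) (fieldB b) (θ, y θ, q, ε)) θ) (hR : |y θ| < 1 / 4) :
    HasDerivAt (fun θ => polarMap q θ (y θ))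
      ((polarSpeed a b q ε θ (y θ))⁻¹ • perturbedField a b ε (polarMap q θ (y θ))) θ := by
  refine (hasDerivAt_polarMap_curve hq hy hR).congr_deriv ?_
  have hu : |q.1 + y θ * Real.cos θ| < 1 / 2 :=
    (abs_add_mul_le hq (Real.abs_cos_le_one θ) hR.le).trans_lt (by norm_num)
  have hx0 := half_le_abscissa hu.le
  have hx3 := abscissa_le hu.le
  have hxsq := abscissa_sq hu.le
  have hang' := abs_le.1 hang
  have hmA := mul_hadamardQuotient (contDiff_fieldA a) q (unitVec θ) (y θ)
  have hmB := mul_hadamardQuotient (contDiff_fieldB b) q (unitVec θ) (y θ)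
  have hsc := Real.sin_sq_add_cos_sq θ
  have hpt : q + y θ • unitVec θ = (q.1 + y θ * Real.cos θ, q.2 - y θ * Real.sin θ) := by
    ext <;> simp [unitVec]
    ring
  rw [hpt] at hmA hmB
  have hfA : fieldA a (q.1 + y θ * Real.cos θ, q.2 - y θ * Real.sin θ) =
    √2 * cubicPoly a (polarMap q θ (y θ)).1 (polarMap q θ (y θ)).2 := rfl
  have hfB : fieldB b (q.1 + y θ * Real.cos θ, q.2 - y θ * Real.sin θ) =
    cubicPoly b (polarMap q θ (y θ)).1 (polarMap q θ (y θ)).2 * (polarMap q θ (y θ)).1⁻¹ := by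
    rw [← smoothInv_eq (x := (polarMap q θ (y θ)).1) hx0 hx3]; rfl
  rw [hfA] at hmA
  rw [hfB] at hmB
  simp only [polarSpeed, polarS, perturbedField, clamp_eq hR.le] at hang' ⊢
  rw [smoothInv_eq (by linarith) (by linarith)]
  have hX : abscissa (q.1 + y θ * Real.cos θ) = (polarMap q θ (y θ)).1 := rfl
  have hY : q.2 - y θ * Real.sin θ = √2 * (polarMap q θ (y θ)).2 := by
    rw [polarMap]; field_simp
  rw [hX] at hx0 hxsq ⊢
  set x := (polarMap q θ (y θ)).1
  set Y := (polarMap q θ (y θ)).2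
  set f := cubicPoly a x Y
  set g := cubicPoly b x Y
  have hD : 1 - ε * angularPart (fieldA a) (fieldB b) θ (y θ) q ≠ 0 := by
    intro h; linarith [hang'.2]
  have hxne : x ≠ 0 := by intro h; linarith
  have h2 : √2 ≠ 0 := by positivity
  have h22 : √2 * √2 = 2 := Real.mul_self_sqrt (by norm_num)
  set D := 1 - ε * angularPart (fieldA a) (fieldB b) θ (y θ) q with hDdef
  -- The radial and angular parts are rotated back to the u and v components.
  have e1 : y θ * (Real.cos θ * radialPart (fieldA a) (fieldB b) θ (y θ) q +
      Real.sin θ * angularPart (fieldA a) (fieldB b) θ (y θ) q) = √2 * f - fieldA a q := by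
    rw [← hmA]
    simp only [radialPart, angularPart]
    linear_combination (y θ * hadamardQuotient (fieldA a) q (unitVec θ) (y θ)) * hsc
  have e2 : y θ * (-Real.sin θ * radialPart (fieldA a) (fieldB b) θ (y θ) q +
      Real.cos θ * angularPart (fieldA a) (fieldB b) θ (y θ) q) = g * x⁻¹ - fieldB b q := by
    rw [← hmB]
    simp only [radialPart, angularPart]
    linear_combination (y θ * hadamardQuotient (fieldB b) q (unitVec θ) (y θ)) * hsc
  rw [Prod.smul_mk, Prod.mk.injEq, smul_eq_mul, smul_eq_mul]
  set rad := radialPart (fieldA a) (fieldB b) θ (y θ) q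
  set ang := angularPart (fieldA a) (fieldB b) θ (y θ) q
  constructor
  · have key : (ε * y θ * rad * D⁻¹ * Real.cos θ - y θ * Real.sin θ) * D =
        √2 * (Y + ε * f) := by
      have : (ε * y θ * rad * D⁻¹ * Real.cos θ - y θ * Real.sin θ) * D =
        ε * y θ * rad * Real.cos θ - y θ * Real.sin θ * D := by field_simp
      rw [this, hDdef]
      linear_combination ε * e1 + hY - hA
    have e4 : Y + ε * f = (ε * y θ * rad * D⁻¹ * Real.cos θ - y θ * Real.sin θ) * D / √2 := by
      rw [key]; field_simp
    have e5 : (√2 * x * D)⁻¹ * (Y + ε * f) =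
        (ε * y θ * rad * D⁻¹ * Real.cos θ - y θ * Real.sin θ) / ((√2 * √2) * x) := by
      rw [e4]; field_simp
    rw [e5, h22]
  · have key : (ε * y θ * rad * D⁻¹ * Real.sin θ + y θ * Real.cos θ) * D * x =
        (x ^ 3 - x) - ε * g := by
      have : (ε * y θ * rad * D⁻¹ * Real.sin θ + y θ * Real.cos θ) * D * x =
        (ε * y θ * rad * Real.sin θ + y θ * Real.cos θ * D) * x := by field_simp
      rw [this, hDdef]
      have e3 : g * x⁻¹ * x = g := by field_simp
      linear_combination (-ε * x) * e2 - x * hB - x * hxsq - ε * e3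
    have : -(ε * y θ * rad * D⁻¹ * Real.sin θ + y θ * Real.cos θ) / √2 =
        (√2 * x * D)⁻¹ * (-((ε * y θ * rad * D⁻¹ * Real.sin θ + y θ * Real.cos θ) * D * x)) := by
      field_simp
    rw [this, key]
    ring

theorem polarMap_injective {q : ℝ × ℝ} (hq : ‖q‖ ≤ 1 / 8) {θ θ' ρ ρ' : ℝ} (h1 : 0 < ρ)
    (h2 : ρ < 1 / 4) (h3 : 0 < ρ') (h4 : ρ' < 1 / 4) (h : polarMap q θ ρ = polarMap q θ' ρ') :
    ρ = ρ' ∧ ∃ k : ℤ, θ' = θ + k * (2 * Real.pi) := by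
  have hu : |q.1 + ρ * Real.cos θ| < 1 / 2 :=
    (abs_add_mul_le hq (Real.abs_cos_le_one θ) (abs_of_pos h1 ▸ h2.le)).trans_lt (by norm_num)
  have hu' : |q.1 + ρ' * Real.cos θ'| < 1 / 2 :=
    (abs_add_mul_le hq (Real.abs_cos_le_one θ') (abs_of_pos h3 ▸ h4.le)).trans_lt (by norm_num)
  rw [polarMap, polarMap, Prod.mk.injEq] at h
  have hc : ρ * Real.cos θ = ρ' * Real.cos θ' := by
    have e1 := abscissa_sq hu.le
    have e2 := abscissa_sq hu'.le
    rw [h.1] at e1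
    linarith
  have hs : ρ * Real.sin θ = ρ' * Real.sin θ' := by
    have := h.2
    rw [div_left_inj' (by positivity)] at this
    linarith
  have hρ : ρ = ρ' := by
    have e1 : ρ ^ 2 = (ρ * Real.cos θ) ^ 2 + (ρ * Real.sin θ) ^ 2 := by
      linear_combination (-ρ ^ 2) * Real.sin_sq_add_cos_sq θ
    have e2 : ρ' ^ 2 = (ρ' * Real.cos θ') ^ 2 + (ρ' * Real.sin θ') ^ 2 := by
      linear_combination (-ρ' ^ 2) * Real.sin_sq_add_cos_sq θ'
    rw [hc, hs, ← e2] at e1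
    exact (sq_eq_sq₀ h1.le h3.le).1 e1
  subst hρ
  have hc' := mul_left_cancel₀ h1.ne' hc
  have hs' := mul_left_cancel₀ h1.ne' hs
  have := Real.Angle.cos_sin_inj hc'.symm hs'.symm
  rw [Real.Angle.angle_eq_iff_two_pi_dvd_sub] at this
  obtain ⟨k, hk⟩ := this
  exact ⟨rfl, k, by linarith⟩

/-- For ρ > 0 the Jacobian of polar coordinates is invertible, so the chart is open there. -/
theorem nhds_polarMap_le {q : ℝ × ℝ} (hq : ‖q‖ ≤ 1 / 8) {θ ρ : ℝ} (h1 : 0 < ρ) (h2 : ρ < 1 / 4) :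
    𝓝 (polarMap q θ ρ) ≤ map (Function.uncurry (polarMap q)) (𝓝 (θ, ρ)) := by
  have hu : |q.1 + ρ * Real.cos θ| < 1 / 2 :=
    (abs_add_mul_le hq (Real.abs_cos_le_one θ) (abs_of_pos h1 ▸ h2.le)).trans_lt (by norm_num)
  have hsm : ContDiff ℝ ∞ (Function.uncurry (polarMap q)) :=
    contDiff_polarMap.comp (contDiff_const.prodMk contDiff_id)
  have hst := hsm.contDiffAt (x := (θ, ρ)) |>.hasStrictFDerivAt (by simp)
  set L := fderiv ℝ (Function.uncurry (polarMap q)) (θ, ρ)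
  have hθ : L (1, 0) = (-(ρ * Real.sin θ) / (2 * abscissa (q.1 + ρ * Real.cos θ)),
      -(ρ * Real.cos θ) / √2) := by
    have e1 : HasDerivAt (fun t => polarMap q t ρ) (L (1, 0)) θ :=
      HasFDerivAt.comp_hasDerivAt (f := fun t => (t, ρ)) θ hst.hasFDerivAt
        ((hasDerivAt_id θ).prodMk (hasDerivAt_const θ ρ))
    have e2 := hasDerivAt_polarMap_curve hq (y := fun _ => ρ) (hasDerivAt_const θ ρ)
      (by rwa [abs_of_pos h1])
    rw [e1.unique e2]
    simp [polarMap]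
  have hρ : L (0, 1) = (Real.cos θ / (2 * abscissa (q.1 + ρ * Real.cos θ)),
      -Real.sin θ / √2) := by
    have e1 : HasDerivAt (fun t => polarMap q θ t) (L (0, 1)) ρ :=
      HasFDerivAt.comp_hasDerivAt (f := fun t => (θ, t)) ρ hst.hasFDerivAt
        ((hasDerivAt_const ρ θ).prodMk (hasDerivAt_id ρ))
    have e2 : HasDerivAt (fun t => polarMap q θ t) (1 / (2 * abscissa (q.1 + ρ * Real.cos θ)) *
        (1 * Real.cos θ), -(1 * Real.sin θ) / √2) ρ :=
      (HasDerivAt.comp (h := fun t => q.1 + t * Real.cos θ) ρ (hasDerivAt_abscissa hu)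
        (((hasDerivAt_id ρ).mul_const (Real.cos θ)).const_add q.1)).prodMk
        ((((hasDerivAt_id ρ).mul_const (Real.sin θ)).const_sub q.2).div_const √2)
    rw [e1.unique e2, Prod.mk.injEq]
    constructor <;> ring
  have hsurj : L.range = ⊤ := by
    rw [LinearMap.range_eq_top]
    rintro ⟨α, β⟩
    have hx := half_le_abscissa hu.le
    set x := abscissa (q.1 + ρ * Real.cos θ)
    have hxne : x ≠ 0 := by intro h; linarith
    have h2ne : √2 ≠ 0 := by positivity
    have hsc := Real.sin_sq_add_cos_sq θ
    refine ⟨((-Real.sin θ * (2 * x * α) + Real.cos θ * (-√2 * β)) / ρ,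
      Real.cos θ * (2 * x * α) + Real.sin θ * (-√2 * β)), ?_⟩
    have hlin : ∀ h k : ℝ, L (h, k) = h • L (1, 0) + k • L (0, 1) := fun h k => by
      rw [← map_smul, ← map_smul, ← map_add]
      simp
    show L _ = _
    rw [hlin, hθ, hρ, Prod.smul_mk, Prod.smul_mk, Prod.mk_add_mk, Prod.mk.injEq]
    simp only [smul_eq_mul]
    constructor
    · field_simp
      linear_combination (2 * x * α) * hsc
    · field_simp
      linear_combination β * √2 * hsc
  exact (hst.map_nhds_eq_of_surj hsurj).ge

theorem exists_polarMap_eq {q p : ℝ × ℝ} {r : ℝ} (hr : r ≤ 1 / 32) (hq : ‖q‖ ≤ r / 8)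
    (hp : p ∈ Metric.ball ((1 : ℝ), (0 : ℝ)) r) :
    ∃ θ ρ, 0 ≤ ρ ∧ ρ ≤ 4 * r ∧ polarMap q θ ρ = p := by
  rw [Metric.mem_ball, Prod.dist_eq, max_lt_iff, Real.dist_eq, Real.dist_eq, sub_zero] at hp
  obtain ⟨hp1, hp2⟩ := hp
  have hr0 : 0 < r := (abs_nonneg _).trans_lt hp2
  have hq1 : |q.1| ≤ r / 8 := (norm_fst_le q).trans hq
  have hq2 : |q.2| ≤ r / 8 := (norm_snd_le q).trans hq
  have hs2 : √2 < 1.5 := by rw [Real.sqrt_lt' (by norm_num)]; norm_num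
  have hs0 : 0 < √2 := by positivity
  have hp1' := abs_lt.1 hp1
  have hu : |p.1 ^ 2 - 1| ≤ (2 + r) * r := by
    rw [show p.1 ^ 2 - 1 = (p.1 + 1) * (p.1 - 1) by ring, abs_mul]
    have : |p.1 + 1| ≤ 2 + r := by rw [abs_le]; constructor <;> linarith
    gcongr
  -- The angle runs clockwise, hence the sign of the imaginary part.
  let z : ℂ := ⟨p.1 ^ 2 - 1 - q.1, q.2 - √2 * p.2⟩
  -- The contributions are (2 + r)r from x² − 1, at most 3r/2 from √2 y, and r/8 from each
  -- coordinate of q; with r ≤ 1/32 they stay below 4r.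
  have hz : ‖z‖ ≤ 4 * r := by
    have h1 : |z.re| ≤ (2 + r) * r + r / 8 := (abs_sub _ _).trans (add_le_add hu hq1)
    have h2 : |z.im| ≤ r / 8 + 1.5 * r := by
      refine (abs_sub _ _).trans (add_le_add hq2 ?_)
      rw [abs_mul, abs_of_pos hs0]
      gcongr
    have := Complex.norm_le_abs_re_add_abs_im z
    nlinarith
  have hre : ‖z‖ * Real.cos z.arg = z.re := Complex.norm_mul_cos_arg z
  have him : ‖z‖ * Real.sin z.arg = z.im := Complex.norm_mul_sin_arg z
  refine ⟨z.arg, ‖z‖, norm_nonneg _, hz, ?_⟩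
  rw [polarMap, hre, him]
  ext
  · apply abscissa_eq_of_sq
    · show |q.1 + (p.1 ^ 2 - 1 - q.1)| ≤ _
      rw [add_sub_cancel]
      nlinarith
    · linarith
    · show _ = 1 + (q.1 + (p.1 ^ 2 - 1 - q.1))
      ring
  · show (q.2 - (q.2 - √2 * p.2)) / √2 = p.2
    field_simp
    ring

theorem polarMap_mem_ball {q : ℝ × ℝ} {θ ρ r : ℝ} (hρ : 0 ≤ ρ) (hr : r ≤ 1 / 2)
    (h : ‖q‖ + ρ < r) : polarMap q θ ρ ∈ Metric.ball ((1 : ℝ), (0 : ℝ)) r := by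
  have hq1 : |q.1| ≤ ‖q‖ := norm_fst_le q
  have hq2 : |q.2| ≤ ‖q‖ := norm_snd_le q
  have h1 : |q.1 + ρ * Real.cos θ| < r := by
    refine (abs_add_le _ _).trans_lt ?_
    rw [abs_mul, abs_of_nonneg hρ]
    have := mul_le_mul_of_nonneg_left (Real.abs_cos_le_one θ) hρ
    linarith
  have h2 : |q.2 - ρ * Real.sin θ| < r := by
    refine (abs_sub _ _).trans_lt ?_
    rw [abs_mul, abs_of_nonneg hρ]
    have := mul_le_mul_of_nonneg_left (Real.abs_sin_le_one θ) hρ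
    linarith
  rw [Metric.mem_ball, Prod.dist_eq, max_lt_iff, Real.dist_eq, Real.dist_eq, sub_zero]
  refine ⟨(abs_abscissa_sub_one_le (h1.le.trans hr)).trans_lt h1, ?_⟩
  show |_ / √2| < r
  rw [abs_div, abs_of_pos (show 0 < √2 by positivity)]
  refine (div_le_self (abs_nonneg _) ?_).trans_lt h2
  rw [Real.one_le_sqrt]; norm_num

/-- The polar chart around an equilibrium near `(1, 0)`. -/
noncomputable def centerChart {a b : ℕ → ℕ → ℝ} {q : ℝ × ℝ} {ε M : ℝ} (hq : ‖q‖ ≤ 1 / 8)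
    (hA : q.2 = -ε * fieldA a q) (hB : q.1 = ε * fieldB b q)
    (hM : ∀ θ ρ : ℝ, ∀ q : ℝ × ℝ, ‖q‖ ≤ 1 →
      |radialPart (fieldA a) (fieldB b) θ (clamp ρ) q| ≤ M ∧
      |angularPart (fieldA a) (fieldB b) θ (clamp ρ) q| ≤ M) (hε : |ε| * M ≤ 1 / 2) :
    PolarChart (perturbedField a b ε) (1 / 4) (|ε| * M) :=
  have hq1 : ‖q‖ ≤ 1 := hq.trans (by norm_num)
  have hang : ∀ θ ρ, |ε * angularPart (fieldA a) (fieldB b) θ (clamp ρ) q| ≤ 1 / 2 :=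
    fun θ ρ => by
      rw [abs_mul]
      exact (mul_le_mul_of_nonneg_left (hM θ ρ q hq1).2 (abs_nonneg _)).trans hε
  have hu : ∀ θ ρ, |q.1 + clamp ρ * Real.cos θ| ≤ 1 / 2 := fun θ ρ =>
    (abs_add_mul_le hq (Real.abs_cos_le_one θ) (abs_clamp_le ρ)).trans (by norm_num)
  have h1 : 1 ≤ √2 := by rw [Real.one_le_sqrt]; norm_num
  have h2 : √2 ≤ 2 := by rw [Real.sqrt_le_left] <;> norm_num
  have hLip := exists_lipschitz_polarS (contDiff_fieldA a) (contDiff_fieldB b) q ε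
  { S := fun θ ρ => polarS (fieldA a) (fieldB b) (θ, ρ, q, ε)
    speed := polarSpeed a b q ε
    φ := polarMap q
    K := hLip.choose
    lo := 1 / 4
    hi := 5
    lo_pos := by norm_num
    smooth := contDiff_perturbedField a b ε
    lipschitz := hLip.choose_spec
    continuous_S := fun ρ => (contDiff_polarS (contDiff_fieldA a) (contDiff_fieldB b)).continuous.comp
      (by fun_prop)
    abs_S_le := abs_polarS_le hM hq1 hε
    S_periodic := fun θ ρ => polarS_add_two_pi θ ρ q ε
    S_zero := fun θ => polarS_zero_radius θ q ε
    S_neg := fun θ ρ => polarS_add_pi_neg θ ρ q ε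
    continuous_speed := by
      have e1 := (contDiff_angularPart (contDiff_fieldA a) (contDiff_fieldB b)).continuous.comp
        (show Continuous fun p : ℝ × ℝ => (p.1, p.2, q, ε) by fun_prop)
      have e2 := contDiff_abscissa.continuous
      have e3 := contDiff_clamp.continuous
      have e4 : Continuous fun p : ℝ × ℝ => abscissa (q.1 + clamp p.2 * Real.cos p.1) :=
        e2.comp (continuous_const.add ((e3.comp continuous_snd).mul
          (Real.continuous_cos.comp continuous_fst)))
      exact (continuous_const.mul e4).mul (continuous_const.sub (continuous_const.mul e1))
    lo_le_speed := fun θ ρ => by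
      have e1 := abs_le.1 (hang θ ρ)
      have e2 := half_le_abscissa (hu θ ρ)
      calc (1 / 4 : ℝ) = 1 * (1 / 2) * (1 / 2) := by norm_num
        _ ≤ _ := by
          unfold polarSpeed
          gcongr
          linarith
    speed_le_hi := fun θ ρ => by
      have e1 := abs_le.1 (hang θ ρ)
      have e2 := half_le_abscissa (hu θ ρ)
      have e3 := abscissa_le (hu θ ρ)
      calc _ ≤ (2 * (3 / 2) * (3 / 2) : ℝ) := by
            unfold polarSpeed
            gcongr
            · linarith
            · linarith
        _ ≤ 5 := by norm_num
    continuous_φ := contDiff_polarMap.continuous.comp (continuous_const.prodMk continuous_id)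
    φ_periodic := fun θ ρ => by simp [polarMap]
    φ_zero := fun θ => by simp [polarMap]
    hasDerivAt_φ := fun y θ hy hR => hasDerivAt_polarMap_field hq hA hB (hang θ _) hy hR
    injective := fun θ θ' ρ ρ' e1 e2 e3 e4 h => polarMap_injective hq e1 e2 e3 e4 h
    nhds_le := fun θ ρ e1 e2 => nhds_polarMap_le hq e1 e2 }

/-- The equilibrium near `(1, 0)`, as a smooth function of the parameter. -/
theorem exists_equilibrium (a b : ℕ → ℕ → ℝ) :
    ∃ q : ℝ → ℝ × ℝ, ContDiffAt ℝ ∞ q 0 ∧ q 0 = 0 ∧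
      (∀ᶠ ε in 𝓝 (0 : ℝ), (q ε).2 = -ε * fieldA a (q ε) ∧ (q ε).1 = ε * fieldB b (q ε)) ∧
      ∀ᶠ z in 𝓝 ((0 : ℝ), (0 : ℝ × ℝ)), z.2.2 = -z.1 * fieldA a z.2 → z.2.1 = z.1 * fieldB b z.2 →
        q z.1 = z.2 := by
  let F : ℝ × (ℝ × ℝ) → ℝ × ℝ := fun z =>
    (z.2.1 - z.1 * fieldB b z.2, z.2.2 + z.1 * fieldA a z.2)
  have hF : ContDiff ℝ ∞ F := by
    have h1 := contDiff_fieldA a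
    have h2 := contDiff_fieldB b
    fun_prop
  -- At ε = 0 the equilibrium map is the identity in the plane variable.
  have hinv : (fderiv ℝ F (0, 0) ∘L .inr ℝ ℝ (ℝ × ℝ)) = ContinuousLinearMap.id ℝ _ := by
    have h1 : HasFDerivAt (fun y => F (0, y)) (fderiv ℝ F (0, 0) ∘L .inr ℝ ℝ (ℝ × ℝ)) 0 :=
      (hF.differentiable (by simp) _).hasFDerivAt.comp (0 : ℝ × ℝ)
        (hasFDerivAt_prodMk_right (0 : ℝ) (0 : ℝ × ℝ))
    have h2 : HasFDerivAt (fun y => F (0, y)) (ContinuousLinearMap.id ℝ _) 0 := by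
      simp only [F, zero_mul, sub_zero, add_zero, Prod.mk.eta]
      exact hasFDerivAt_id _
    exact h1.unique h2
  have hinv' : (fderiv ℝ F (0, 0) ∘L .inr ℝ ℝ (ℝ × ℝ)).IsInvertible := by
    rw [hinv]; exact ⟨ContinuousLinearEquiv.refl ℝ _, rfl⟩
  have hF0 : F (0, 0) = 0 := by simp [F]
  have hFc := hF.contDiffAt (x := (0, 0))
  refine ⟨hFc.implicitFunction (by simp) hinv', hFc.contDiffAt_implicitFunction (by simp) hinv',
    hFc.implicitFunction_apply_self (by simp) hinv', ?_, ?_⟩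
  · filter_upwards [hFc.eventually_apply_implicitFunction (by simp) hinv'] with ε hε
    rw [hF0, Prod.mk_eq_zero] at hε
    exact ⟨by linarith [hε.2], by linarith [hε.1]⟩
  · filter_upwards [hFc.eventually_apply_eq_iff_implicitFunction (by simp) hinv'] with z hz h1 h2
    refine hz.1 ?_
    rw [hF0, Prod.mk_eq_zero]
    exact ⟨by linarith, by linarith⟩

end Chart

/-! ### The family of charts for small parameters. -/

section Family

/-- The equilibria near `(1, 0)` together with a bound of the perturbation. -/
structure CenterFamily (a b : ℕ → ℕ → ℝ) where
  q : ℝ → ℝ × ℝ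
  M : ℝ
  smooth_q : ContDiffAt ℝ ∞ q 0
  q_zero : q 0 = 0
  unique : ∀ᶠ z in 𝓝 ((0 : ℝ), (0 : ℝ × ℝ)), z.2.2 = -z.1 * fieldA a z.2 →
    z.2.1 = z.1 * fieldB b z.2 → q z.1 = z.2
  bound : ∀ θ ρ : ℝ, ∀ q : ℝ × ℝ, ‖q‖ ≤ 1 →
      |radialPart (fieldA a) (fieldB b) θ (clamp ρ) q| ≤ M ∧
      |angularPart (fieldA a) (fieldB b) θ (clamp ρ) q| ≤ M
  eventually_equilibrium : ∀ᶠ ε in 𝓝 (0 : ℝ), (q ε).2 = -ε * fieldA a (q ε) ∧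
    (q ε).1 = ε * fieldB b (q ε)

theorem nonempty_centerFamily (a b : ℕ → ℕ → ℝ) : Nonempty (CenterFamily a b) := by
  obtain ⟨q, h1, h2, h3, h4⟩ := exists_equilibrium a b
  obtain ⟨M, -, h5⟩ := exists_bound_parts (contDiff_fieldA a) (contDiff_fieldB b)
  exact ⟨⟨q, M, h1, h2, h4, h5, h3⟩⟩

namespace CenterFamily

variable {a b : ℕ → ℕ → ℝ} (F : CenterFamily a b)

/-- The parameters for which the polar chart exists. -/
structure Good (ε : ℝ) : Prop where
  norm_le : ‖F.q ε‖ ≤ 1 / 8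
  eqA : (F.q ε).2 = -ε * fieldA a (F.q ε)
  eqB : (F.q ε).1 = ε * fieldB b (F.q ε)
  mul_le : |ε| * F.M ≤ 1 / 2

theorem eventually_norm_q_lt {δ : ℝ} (hδ : 0 < δ) : ∀ᶠ ε in 𝓝 (0 : ℝ), ‖F.q ε‖ < δ := by
  have h := F.smooth_q.continuousAt.norm
  exact h.eventually (gt_mem_nhds (by simpa [F.q_zero] using hδ))

theorem eventually_mul_lt {δ : ℝ} (hδ : 0 < δ) : ∀ᶠ ε in 𝓝 (0 : ℝ), |ε| * F.M < δ := by
  have h : ContinuousAt (fun ε : ℝ => |ε| * F.M) 0 := by fun_prop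
  exact h.eventually (gt_mem_nhds (by simpa using hδ))

theorem eventually_good : ∀ᶠ ε in 𝓝 (0 : ℝ), F.Good ε := by
  filter_upwards [F.eventually_norm_q_lt (δ := 1 / 8) (by norm_num), F.eventually_equilibrium,
    F.eventually_mul_lt (δ := 1 / 2) (by norm_num)] with ε h1 h2 h3
  exact ⟨h1.le, h2.1, h2.2, h3.le⟩

/-- The polar field of the family. -/
noncomputable def field (ε θ ρ : ℝ) : ℝ := polarS (fieldA a) (fieldB b) (θ, ρ, F.q ε, ε)

variable {F}

/-- The polar chart of the family. -/
noncomputable def Good.chart {ε : ℝ} (h : F.Good ε) :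
    PolarChart (perturbedField a b ε) (1 / 4) (|ε| * F.M) :=
  centerChart h.norm_le h.eqA h.eqB F.bound h.mul_le

theorem Good.chart_S {ε : ℝ} (h : F.Good ε) : h.chart.S = F.field ε := rfl

variable (F)

/-- The solution of the polar equation with a given initial radius. -/
noncomputable def sol (ε ρ : ℝ) : ℝ → ℝ :=
  Classical.epsilon fun y => y 0 = ρ ∧ IsSolution (F.field ε) y

variable {F}

theorem Good.sol_spec {ε : ℝ} (h : F.Good ε) (ρ : ℝ) :
    F.sol ε ρ 0 = ρ ∧ IsSolution (F.field ε) (F.sol ε ρ) :=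
  Classical.epsilon_spec (p := fun y => y 0 = ρ ∧ IsSolution (F.field ε) y) (h.chart.exists_sol 0 ρ)

theorem Good.sol_eq {ε : ℝ} (h : F.Good ε) {y : ℝ → ℝ} (hy : IsSolution (F.field ε) y) :
    F.sol ε (y 0) = y :=
  (h.sol_spec (y 0)).2.eq_of_eq h.chart.lipschitz hy (h.sol_spec (y 0)).1

theorem Good.abs_sol_le {ε : ℝ} (h : F.Good ε) {y : ℝ → ℝ} (hy : IsSolution (F.field ε) y)
    {θ : ℝ} (h1 : 0 ≤ θ) (h2 : θ ≤ 2 * Real.pi) : |y θ| ≤ |y 0| + 2 * Real.pi * (|ε| * F.M) := by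
  have h3 := hy.abs_sub_le h.chart.abs_S_le 0 θ
  rw [sub_zero, abs_of_nonneg h1] at h3
  have h4 : |ε| * F.M * θ ≤ |ε| * F.M * (2 * Real.pi) :=
    mul_le_mul_of_nonneg_left h2 h.chart.C_nonneg
  have h5 : |y θ| ≤ |y 0| + |y θ - y 0| := by
    have := abs_add_le (y 0) (y θ - y 0)
    rwa [add_sub_cancel] at this
  linarith

variable (F)

/-- The radii of the closed polar orbits. -/
def closedRadii (ε : ℝ) : Set ℝ :=
  {ρ | ∃ y, IsSolution (F.field ε) y ∧ y 0 = ρ ∧ y (2 * Real.pi) = ρ}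

end CenterFamily

end Family

/-! ### Turn integrals and reductions modulo the annihilating form. -/

section Reduction

/-- The values of the one-form `η₁ dx + η₂ dy` on the polar orbits. -/
noncomputable def formAlong (a b : ℕ → ℕ → ℝ) (η₁ η₂ : ℝ → ℝ → ℝ → ℝ)
    (p : ℝ × ℝ × (ℝ × ℝ) × ℝ) : ℝ :=
  η₁ p.2.2.2 (polarMap p.2.2.1 p.1 p.2.1).1 (polarMap p.2.2.1 p.1 p.2.1).2 *
    ((polarS (fieldA a) (fieldB b) p * Real.cos p.1 - p.2.1 * Real.sin p.1) *
      (smoothInv (polarMap p.2.2.1 p.1 p.2.1).1 / 2)) +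
  η₂ p.2.2.2 (polarMap p.2.2.1 p.1 p.2.1).1 (polarMap p.2.2.1 p.1 p.2.1).2 *
    (-(polarS (fieldA a) (fieldB b) p * Real.sin p.1 + p.2.1 * Real.cos p.1) / √2)

/-- The integral of `η₁ dx + η₂ dy` along the closed orbit `ρ` of the unperturbed system. -/
noncomputable def orbitIntegral (η₁ η₂ : ℝ → ℝ → ℝ) (ρ : ℝ) : ℝ :=
  ∫ θ in (0 : ℝ)..2 * Real.pi,
    η₁ (abscissa (ρ * Real.cos θ)) (-(ρ * Real.sin θ) / √2) *
      (-(ρ * Real.sin θ) * (smoothInv (abscissa (ρ * Real.cos θ)) / 2)) +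
    η₂ (abscissa (ρ * Real.cos θ)) (-(ρ * Real.sin θ) / √2) * (-(ρ * Real.cos θ) / √2)

/-- `dW = μ Ω + εᵏ (η₁ dx + η₂ dy)`, where `Ω` is the one-form annihilating the perturbed field. -/
structure Reduction (a b : ℕ → ℕ → ℝ) (k : ℕ) (W μ η₁ η₂ : ℝ → ℝ → ℝ → ℝ) : Prop where
  continuous_μ : Continuous fun z : ℝ × ℝ × ℝ => μ z.1 z.2.1 z.2.2
  μ_zero : ∀ x y, μ 0 x y = 1
  smooth₁ : ContDiff ℝ ∞ fun z : ℝ × ℝ × ℝ => η₁ z.1 z.2.1 z.2.2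
  smooth₂ : ContDiff ℝ ∞ fun z : ℝ × ℝ × ℝ => η₂ z.1 z.2.1 z.2.2
  hasDerivAt : ∀ (ε : ℝ) (x y : ℝ → ℝ) (x' y' t : ℝ), HasDerivAt x x' t → HasDerivAt y y' t →
    HasDerivAt (fun s => W ε (x s) (y s))
      (μ ε (x t) (y t) * (-(perturbedField a b ε (x t, y t)).2 * x' +
        (perturbedField a b ε (x t, y t)).1 * y') +
        ε ^ k * (η₁ ε (x t) (y t) * x' + η₂ ε (x t) (y t) * y')) t

theorem contDiff_formAlong {a b : ℕ → ℕ → ℝ} {η₁ η₂ : ℝ → ℝ → ℝ → ℝ}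
    (h₁ : ContDiff ℝ ∞ fun z : ℝ × ℝ × ℝ => η₁ z.1 z.2.1 z.2.2)
    (h₂ : ContDiff ℝ ∞ fun z : ℝ × ℝ × ℝ => η₂ z.1 z.2.1 z.2.2) :
    ContDiff ℝ ∞ (formAlong a b η₁ η₂) := by
  have hS := contDiff_polarS (contDiff_fieldA a) (contDiff_fieldB b)
  have hm : ContDiff ℝ ∞ fun p : ℝ × ℝ × (ℝ × ℝ) × ℝ => polarMap p.2.2.1 p.1 p.2.1 :=
    contDiff_polarMap.comp (contDiff_snd.snd.fst.prodMk (contDiff_fst.prodMk contDiff_snd.fst))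
  have h3 : ContDiff ℝ ∞ fun p : ℝ × ℝ × (ℝ × ℝ) × ℝ =>
      (p.2.2.2, (polarMap p.2.2.1 p.1 p.2.1).1, (polarMap p.2.2.1 p.1 p.2.1).2) :=
    contDiff_snd.snd.snd.prodMk (hm.fst.prodMk hm.snd)
  have hη₁ := h₁.comp h3
  have hη₂ := h₂.comp h3
  have hi : ContDiff ℝ ∞ fun p : ℝ × ℝ × (ℝ × ℝ) × ℝ =>
    smoothInv (polarMap p.2.2.1 p.1 p.2.1).1 := contDiff_smoothInv.comp hm.fst
  have hc : ContDiff ℝ ∞ fun p : ℝ × ℝ × (ℝ × ℝ) × ℝ => Real.cos p.1 :=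
    Real.contDiff_cos.comp contDiff_fst
  have hs : ContDiff ℝ ∞ fun p : ℝ × ℝ × (ℝ × ℝ) × ℝ => Real.sin p.1 :=
    Real.contDiff_sin.comp contDiff_fst
  have hρ : ContDiff ℝ ∞ fun p : ℝ × ℝ × (ℝ × ℝ) × ℝ => p.2.1 := contDiff_snd.fst
  exact (hη₁.mul (((hS.mul hc).sub (hρ.mul hs)).mul (hi.div_const 2))).add
    (hη₂.mul (((hS.mul hs).add (hρ.mul hc)).neg.div_const _))

theorem formAlong_zero (a b : ℕ → ℕ → ℝ) (η₁ η₂ : ℝ → ℝ → ℝ → ℝ) (θ ρ : ℝ) :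
    formAlong a b η₁ η₂ (θ, ρ, 0, 0) =
    η₁ 0 (abscissa (ρ * Real.cos θ)) (-(ρ * Real.sin θ) / √2) *
      (-(ρ * Real.sin θ) * (smoothInv (abscissa (ρ * Real.cos θ)) / 2)) +
    η₂ 0 (abscissa (ρ * Real.cos θ)) (-(ρ * Real.sin θ) / √2) * (-(ρ * Real.cos θ) / √2) := by
  simp [formAlong, polarS_zero_right, polarMap]

variable {a b : ℕ → ℕ → ℝ} {k : ℕ} {W μ η₁ η₂ : ℝ → ℝ → ℝ → ℝ} (F : CenterFamily a b)

/-- The integral of `η₁ dx + η₂ dy` along one turn of a polar orbit. -/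
noncomputable def CenterFamily.turnIntegral (η₁ η₂ : ℝ → ℝ → ℝ → ℝ) (z : ℝ × ℝ) : ℝ :=
  ∫ θ in (0 : ℝ)..2 * Real.pi, formAlong a b η₁ η₂ (θ, F.sol z.2 z.1 θ, F.q z.2, z.2)

theorem CenterFamily.contDiffAt_turnIntegral
    (h₁ : ContDiff ℝ ∞ fun z : ℝ × ℝ × ℝ => η₁ z.1 z.2.1 z.2.2)
    (h₂ : ContDiff ℝ ∞ fun z : ℝ × ℝ × ℝ => η₂ z.1 z.2.1 z.2.2) (ρ : ℝ) :
    ContDiffAt ℝ ∞ (F.turnIntegral η₁ η₂) (ρ, 0) := by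
  refine contDiffAt_integral_along_solutions
    (contDiff_polarS (contDiff_fieldA a) (contDiff_fieldB b)) (contDiff_formAlong h₁ h₂)
    polarS_zero_right F.smooth_q Real.two_pi_pos.le ?_ ρ
  filter_upwards [F.eventually_good] with ε hε
  exact ⟨⟨_, hε.chart.lipschitz⟩, fun ρ => hε.sol_spec ρ⟩

theorem CenterFamily.turnIntegral_zero (ρ : ℝ) :
    F.turnIntegral η₁ η₂ (ρ, 0) = orbitIntegral (η₁ 0) (η₂ 0) ρ := by
  have hs := F.eventually_good.self_of_nhds.sol_spec ρ
  have hc : ∀ θ, F.sol 0 ρ θ = ρ := fun θ => by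
    rw [const_of_field_eq_zero (V := ℝ × ℝ) polarS_zero_right (fun θ => hs.2 θ) θ, hs.1]
  simp only [turnIntegral, hc, F.q_zero, formAlong_zero]
  rfl

variable {F}

/-- The tangent of a polar orbit is parallel to the field, so the μ-term disappears. The identity
for W is only required on a box around (1, 0), since an integrating factor may exist only locally.
-/
theorem CenterFamily.Good.hasDerivAt_along {ε : ℝ} (hε : F.Good ε) {y : ℝ → ℝ} {θ : ℝ}
    (hy : IsSolution (F.field ε) y) (hb : |y θ| < 1 / 4) {W μ η₁ η₂ : ℝ → ℝ → ℝ} {κ : ℝ}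
    (hW : ∀ (x y : ℝ → ℝ) (x' y' t : ℝ), HasDerivAt x x' t → HasDerivAt y y' t →
      1 / 2 ≤ x t → x t ≤ 3 / 2 → |y t| ≤ 1 →
      HasDerivAt (fun s => W (x s) (y s))
      (μ (x t) (y t) * (-(perturbedField a b ε (x t, y t)).2 * x' +
        (perturbedField a b ε (x t, y t)).1 * y') +
        κ * (η₁ (x t) (y t) * x' + η₂ (x t) (y t) * y')) t) :
    HasDerivAt (fun s => W (polarMap (F.q ε) s (y s)).1 (polarMap (F.q ε) s (y s)).2)
      (κ * formAlong a b (fun _ => η₁) (fun _ => η₂) (θ, y θ, F.q ε, ε)) θ := by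
  have h1 := hε.chart.hasDerivAt_φ y θ (hy θ) hb
  have h2 := hasDerivAt_polarMap_curve hε.norm_le (hy θ) hb
  have h3 := h1.unique h2
  have hu : |(F.q ε).1 + y θ * Real.cos θ| ≤ 1 / 2 :=
    (abs_add_mul_le hε.norm_le (Real.abs_cos_le_one θ) hb.le).trans (by norm_num)
  have hv : |(polarMap (F.q ε) θ (y θ)).2| ≤ 1 := by
    have e1 : |(F.q ε).2 - y θ * Real.sin θ| ≤ 1 := by
      refine (abs_sub _ _).trans ?_
      have e2 : |(F.q ε).2| ≤ 1 / 8 := (norm_snd_le _).trans hε.norm_le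
      have e3 : |y θ * Real.sin θ| ≤ 1 / 4 := by
        rw [abs_mul]
        nlinarith [abs_nonneg (y θ), abs_nonneg (Real.sin θ), Real.abs_sin_le_one θ]
      linarith
    show |_ / √2| ≤ 1
    rw [abs_div, abs_of_pos (show 0 < √2 by positivity)]
    refine (div_le_self (abs_nonneg _) ?_).trans e1
    rw [Real.one_le_sqrt]; norm_num
  refine (hW (fun s => (polarMap (F.q ε) s (y s)).1) (fun s => (polarMap (F.q ε) s (y s)).2) _ _ θ
    (hasFDerivAt_fst.comp_hasDerivAt θ h2) (hasFDerivAt_snd.comp_hasDerivAt θ h2)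
    (half_le_abscissa hu) (abscissa_le hu) hv).congr_deriv ?_
  have hz : -(perturbedField a b ε (polarMap (F.q ε) θ (y θ))).2 *
      ((F.field ε θ (y θ) * Real.cos θ - y θ * Real.sin θ) / (2 * (polarMap (F.q ε) θ (y θ)).1)) +
      (perturbedField a b ε (polarMap (F.q ε) θ (y θ))).1 *
      (-(F.field ε θ (y θ) * Real.sin θ + y θ * Real.cos θ) / √2) = 0 := by
    have e1 := congrArg Prod.fst h3
    have e2 := congrArg Prod.snd h3
    simp only [Prod.smul_fst, Prod.smul_snd, smul_eq_mul] at e1 e2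
    rw [← e1, ← e2]
    show -(perturbedField a b ε (polarMap (F.q ε) θ (y θ))).2 *
      (_ * (perturbedField a b ε (polarMap (F.q ε) θ (y θ))).1) +
      (perturbedField a b ε (polarMap (F.q ε) θ (y θ))).1 *
      (_ * (perturbedField a b ε (polarMap (F.q ε) θ (y θ))).2) = 0
    ring
  simp only [ContinuousLinearMap.coe_fst', ContinuousLinearMap.coe_snd', Prod.mk.eta]
  rw [hz, formAlong]
  have hx : smoothInv (polarMap (F.q ε) θ (y θ)).1 = (polarMap (F.q ε) θ (y θ)).1⁻¹ :=
    smoothInv_eq (half_le_abscissa hu) (abscissa_le hu)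
  simp only [hx, CenterFamily.field]
  ring

theorem CenterFamily.Good.continuous_formAlong {ε : ℝ} {y : ℝ → ℝ} (hy : Continuous y)
    (h₁ : ContDiff ℝ ∞ fun z : ℝ × ℝ × ℝ => η₁ z.1 z.2.1 z.2.2)
    (h₂ : ContDiff ℝ ∞ fun z : ℝ × ℝ × ℝ => η₂ z.1 z.2.1 z.2.2) (q : ℝ × ℝ) :
    Continuous fun θ => formAlong a b η₁ η₂ (θ, y θ, q, ε) :=
  (contDiff_formAlong h₁ h₂).continuous.comp (by fun_prop)

/-- The increment of `W` along one turn. -/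
theorem CenterFamily.Good.pow_mul_turnIntegral {ε : ℝ} (hε : F.Good ε)
    (hW : Reduction a b k W μ η₁ η₂) {ρ : ℝ}
    (hb : |ρ| + 2 * Real.pi * (|ε| * F.M) < 1 / 4) :
    ε ^ k * F.turnIntegral η₁ η₂ (ρ, ε) =
      W ε (polarMap (F.q ε) 0 (F.sol ε ρ (2 * Real.pi))).1
        (polarMap (F.q ε) 0 (F.sol ε ρ (2 * Real.pi))).2 -
      W ε (polarMap (F.q ε) 0 ρ).1 (polarMap (F.q ε) 0 ρ).2 := by
  obtain ⟨h0, hs⟩ := hε.sol_spec ρ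
  have hd : ∀ θ ∈ Set.uIcc 0 (2 * Real.pi), HasDerivAt
      (fun s => W ε (polarMap (F.q ε) s (F.sol ε ρ s)).1 (polarMap (F.q ε) s (F.sol ε ρ s)).2)
      (ε ^ k * formAlong a b η₁ η₂ (θ, F.sol ε ρ θ, F.q ε, ε)) θ := fun θ hθ => by
    rw [Set.uIcc_of_le Real.two_pi_pos.le] at hθ
    refine hε.hasDerivAt_along hs (((hε.abs_sol_le hs hθ.1 hθ.2)).trans_lt (by rwa [h0]))
      (W := W ε) (μ := μ ε) (η₁ := η₁ ε) (η₂ := η₂ ε) (κ := ε ^ k) ?_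
    intro x y x' y' t hx hy _ _ _
    exact hW.hasDerivAt ε x y x' y' t hx hy
  have hint := intervalIntegral.integral_eq_sub_of_hasDerivAt hd
    ((continuous_const.mul (CenterFamily.Good.continuous_formAlong hs.continuous hW.smooth₁
      hW.smooth₂ (F.q ε))).intervalIntegrable _ _)
  rw [intervalIntegral.integral_const_mul] at hint
  rw [CenterFamily.turnIntegral, hint, h0]
  have hp : ∀ r, polarMap (F.q ε) (2 * Real.pi) r = polarMap (F.q ε) 0 r := fun r => by
    simp [polarMap]
  rw [hp]

end Reduction

/-! ### Upper bounds for limit cycles, and criteria for a center. -/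

section Criteria

variable {a b : ℕ → ℕ → ℝ} {k : ℕ} {W μ η₁ η₂ : ℝ → ℝ → ℝ → ℝ} (F : CenterFamily a b)

theorem encard_le_of_forall_finset {α : Type} {s : Set α} {n : ℕ}
    (h : ∀ t : Finset α, (t : Set α) ⊆ s → t.card ≤ n) : s.encard ≤ n := by
  by_contra hlt
  rw [not_le] at hlt
  obtain ⟨t, hts, ht⟩ := Set.exists_subset_encard_eq (k := ((n + 1 : ℕ) : ℕ∞))
    (s := s) (by push_cast; exact Order.add_one_le_of_lt hlt)
  have hfin : t.Finite := Set.finite_of_encard_eq_coe ht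
  have := h hfin.toFinset (by simpa using hts)
  rw [hfin.encard_eq_coe_toFinset_card, Nat.cast_inj] at ht
  omega

/-- Zeros of the turn integral include 0, every closed radius, and the negative of the radius half a
turn later. Hence n closed radii give 2n + 1 zeros, while Rolle's theorem allows 2j + 2, so n ≤ j.
-/
theorem CenterFamily.eventually_encard_closedRadii_le (hW : Reduction a b k W μ η₁ η₂) {R : ℝ}
    (hR0 : 0 < R) (hR : R ≤ 1 / 8) {j : ℕ} (hj : ∀ ρ ∈ Set.Icc (-R) R,
      iteratedDeriv (2 * j + 2) (orbitIntegral (η₁ 0) (η₂ 0)) ρ ≠ 0) {R₁ : ℝ} (hR₁ : R₁ < R) :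
    ∀ᶠ ε in 𝓝[≠] (0 : ℝ), (F.closedRadii ε ∩ Set.Ioc 0 R₁).encard ≤ j := by
  have hsm := fun ρ => F.contDiffAt_turnIntegral hW.smooth₁ hW.smooth₂ ρ
  have hM : (fun r => F.turnIntegral η₁ η₂ (r, 0)) = orbitIntegral (η₁ 0) (η₂ 0) :=
    funext F.turnIntegral_zero
  have hcard := eventually_card_zeros_le (F := F.turnIntegral η₁ η₂) (R := R) (n := 2 * j + 2)
    (fun ρ _ => hsm ρ) (fun ρ hρ => by
      rw [iterate_partialFst_eq_iteratedDeriv hsm, hM]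
      exact hj ρ hρ)
  have hlt : 0 < R - R₁ := by linarith
  filter_upwards [hcard.filter_mono nhdsWithin_le_nhds,
    F.eventually_good.filter_mono nhdsWithin_le_nhds,
    (F.eventually_mul_lt (δ := min (R - R₁) (1 / 8) / (2 * Real.pi))
      (by positivity)).filter_mono nhdsWithin_le_nhds, self_mem_nhdsWithin] with ε h1 hε h3 hne
  rw [lt_div_iff₀ Real.two_pi_pos, lt_min_iff] at h3
  have hC := hε.chart.C_nonneg
  have hpos : ∀ ρ, 0 < ρ → ∀ θ, 0 < F.sol ε ρ θ := fun ρ hρ θ =>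
    hε.chart.pos_of_pos (hε.sol_spec ρ).2 (θ := 0) (by rwa [(hε.sol_spec ρ).1]) θ
  have hzero : ∀ y, IsSolution (F.field ε) y → y (2 * Real.pi) = y 0 → |y 0| ≤ R →
      F.turnIntegral η₁ η₂ (y 0, ε) = 0 := fun y hy hp hb => by
    have h := hε.pow_mul_turnIntegral hW (ρ := y 0) (by linarith [h3.2])
    rw [hε.sol_eq hy, hp, sub_self] at h
    exact (mul_eq_zero.1 h).resolve_left (pow_ne_zero k hne)
  refine encard_le_of_forall_finset fun t ht => ?_
  have hsol : ∀ ρ ∈ t, 0 < ρ ∧ ρ ≤ R₁ ∧ F.sol ε ρ (2 * Real.pi) = ρ := fun ρ hρ => by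
    obtain ⟨⟨y, hy, hy0, hyp⟩, h0, hle⟩ := ht hρ
    refine ⟨h0, hle, ?_⟩
    rw [← hy0, hε.sol_eq hy, hyp, hy0]
  -- The negative radius at which the same closed orbit crosses the line of the initial ray.
  let g : ℝ → ℝ := fun ρ => -F.sol ε ρ Real.pi
  have hginj : Set.InjOn g t := fun ρ _ ρ' _ heq => by
    have h5 : F.sol ε ρ Real.pi = F.sol ε ρ' Real.pi := neg_injective heq
    have h4 := (hε.sol_spec ρ).2.eq_of_eq hε.chart.lipschitz (hε.sol_spec ρ').2 h5
    rw [← (hε.sol_spec ρ).1, h4, (hε.sol_spec ρ').1]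
  have hgneg : ∀ ρ ∈ t, g ρ < 0 := fun ρ hρ => neg_lt_zero.2 (hpos ρ (hsol ρ hρ).1 _)
  have hd1 : Disjoint t (t.image g) := by
    rw [Finset.disjoint_left]
    intro ρ hρ hρ'
    obtain ⟨ρ', hρ₂, rfl⟩ := Finset.mem_image.1 hρ'
    exact lt_asymm (hgneg ρ' hρ₂) (hsol _ hρ).1
  have h0 : (0 : ℝ) ∉ t ∪ t.image g := by
    rw [Finset.mem_union, Finset.mem_image]
    rintro (h | ⟨ρ, hρ, h⟩)
    · exact lt_irrefl _ (hsol _ h).1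
    · exact (hgneg ρ hρ).ne h
  have hc := h1 (insert 0 (t ∪ t.image g)) (fun ρ hρ => ?_)
  · rw [Finset.card_insert_of_notMem h0, Finset.card_union_of_disjoint hd1,
      Finset.card_image_of_injOn hginj] at hc
    omega
  · rw [Finset.mem_insert, Finset.mem_union, Finset.mem_image] at hρ
    have habs : |ρ| ≤ R ∧ ∃ y, IsSolution (F.field ε) y ∧ y 0 = ρ ∧ y (2 * Real.pi) = y 0 := by
      rcases hρ with rfl | h | ⟨ρ', h, rfl⟩
      · exact ⟨by simpa using hR0.le, _, hε.chart.sol_zero, rfl, rfl⟩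
      · obtain ⟨e1, e2, e3⟩ := hsol ρ h
        exact ⟨by rw [abs_of_pos e1]; linarith, _, (hε.sol_spec ρ).2, (hε.sol_spec ρ).1,
          by rw [e3, (hε.sol_spec ρ).1]⟩
      · obtain ⟨e1, e2, e3⟩ := hsol ρ' h
        obtain ⟨s1, s2⟩ := hε.sol_spec ρ'
        refine ⟨?_, fun θ => -F.sol ε ρ' (θ + Real.pi), fun θ => ?_, by simp [g], ?_⟩
        · have := hε.abs_sol_le s2 Real.pi_pos.le (by linarith [Real.pi_pos])
          rw [s1, abs_of_pos e1] at this
          simp only [g, abs_neg]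
          linarith [h3.1]
        · have e4 := ((s2 (θ + Real.pi)).comp_add_const θ Real.pi).neg
          have e5 := hε.chart.S_neg θ (-F.sol ε ρ' (θ + Real.pi))
          rw [neg_neg, hε.chart_S] at e5
          rwa [e5, neg_neg] at e4
        · have e4 := hε.chart.periodic_of_eq s2 (by rw [e3, s1]) Real.pi
          simp only [zero_add]
          rw [add_comm, e4]
    obtain ⟨hle, y, hy, rfl, hp⟩ := habs
    exact ⟨abs_le.1 hle, hzero y hy hp hle⟩


/-- Upper bound for the number of limit cycles near `(1, 0)`. -/
theorem eventually_numLimitCycles_le (hW : Reduction a b k W μ η₁ η₂) {R : ℝ}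
    (hR : R ≤ 1 / 8) {j : ℕ} (hj : ∀ ρ ∈ Set.Icc (-R) R,
      iteratedDeriv (2 * j + 2) (orbitIntegral (η₁ 0) (η₂ 0)) ρ ≠ 0) {r : ℝ} (hr0 : 0 < r)
    (hr : 8 * r ≤ R) :
    ∀ᶠ ε in 𝓝[≠] (0 : ℝ), numLimitCycles (perturbedField a b ε) (1, 0) r ≤ j := by
  obtain ⟨F⟩ := nonempty_centerFamily a b
  filter_upwards [F.eventually_encard_closedRadii_le hW (by linarith) hR hj
    (show 4 * r < R by linarith), F.eventually_good.filter_mono nhdsWithin_le_nhds,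
    (F.eventually_norm_q_lt (δ := r / 8) (by linarith)).filter_mono nhdsWithin_le_nhds]
    with ε h1 hε h3
  exact hε.chart.encard_le (R₁ := 4 * r) (by linarith)
    (fun p hp => exists_polarMap_eq (by linarith) h3.le hp) h1

theorem CenterFamily.Good.numLimitCycles_eq_zero {F : CenterFamily a b} {ε r : ℝ} (hε : F.Good ε)
    (hC : |ε| * F.M < 1 / 64) (hr : r ≤ 1 / 64) (hq : ‖F.q ε‖ ≤ r / 8)
    (h : ∀ y, IsSolution (F.field ε) y → 0 < y 0 → y 0 ≤ 1 / 8 → y (2 * Real.pi) = y 0) :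
    numLimitCycles (perturbedField a b ε) (1, 0) r = 0 := by
  refine hε.chart.numLimitCycles_eq_zero (R₁ := 4 * r) (R₂ := 1 / 8) (by linarith) ?_
    (fun p hp => exists_polarMap_eq (by linarith) hq hp) fun ρ hρ => ?_
  -- With π < 4 and |ε| M < 1/64 the drift over one turn is below 1/8, and 1/8 + 1/8 is the chart
  -- radius.
  · have := Real.pi_lt_four
    have := mul_lt_mul_of_pos_left hC Real.two_pi_pos
    linarith
  · obtain ⟨s1, s2⟩ := hε.sol_spec ρ
    exact ⟨_, s2, s1, by rw [h _ s2 (by rw [s1]; exact hρ.1) (by rw [s1]; exact hρ.2), s1]⟩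

theorem hasDerivAt_polarMap_ray {q : ℝ × ℝ} (hq : ‖q‖ ≤ 1 / 8) {ρ : ℝ} (hρ : |ρ| < 1 / 4) :
    HasDerivAt (fun ρ => (polarMap q 0 ρ).1) (1 / (2 * (polarMap q 0 ρ).1)) ρ ∧
    HasDerivAt (fun ρ => (polarMap q 0 ρ).2) 0 ρ := by
  have hu : |q.1 + ρ * Real.cos 0| < 1 / 2 :=
    (abs_add_mul_le hq (Real.abs_cos_le_one 0) hρ.le).trans_lt (by norm_num)
  constructor
  · have h := HasDerivAt.comp (h := fun t => q.1 + t * Real.cos 0) ρ (hasDerivAt_abscissa hu)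
      (((hasDerivAt_id ρ).mul_const (Real.cos 0)).const_add q.1)
    refine h.congr_deriv ?_
    simp [polarMap]
  · simpa [polarMap] using hasDerivAt_const ρ (q.2 / √2)

/-- On the initial ray the second component of the field is negative. -/
theorem CenterFamily.Good.snd_field_ray {F : CenterFamily a b} {ε : ℝ} (hε : F.Good ε) {ρ : ℝ}
    (hρ0 : 0 < ρ) (hρ : ρ < 1 / 4) :
    0 < -(perturbedField a b ε (polarMap (F.q ε) 0 ρ)).2 := by
  have hu : |(F.q ε).1 + ρ * Real.cos 0| < 1 / 2 :=
    (abs_add_mul_le hε.norm_le (Real.abs_cos_le_one 0) (abs_of_pos hρ0 ▸ hρ.le)).trans_lt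
      (by norm_num)
  have hmB := mul_hadamardQuotient (contDiff_fieldB b) (F.q ε) (unitVec 0) ρ
  have hang : |ε * hadamardQuotient (fieldB b) (F.q ε) (unitVec 0) ρ| ≤ 1 / 2 := by
    have h := (F.bound 0 ρ (F.q ε) (hε.norm_le.trans (by norm_num))).2
    rw [clamp_eq (by rw [abs_of_pos hρ0]; exact hρ.le), angularPart, Real.sin_zero, Real.cos_zero,
      zero_mul, zero_add, one_mul] at h
    rw [abs_mul]
    exact (mul_le_mul_of_nonneg_left h (abs_nonneg _)).trans hε.mul_le
  have hpt : F.q ε + ρ • unitVec 0 = ((F.q ε).1 + ρ * Real.cos 0, (F.q ε).2 - ρ * Real.sin 0) := by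
    ext <;> simp [unitVec]
  have hx0 := half_le_abscissa hu.le
  have hx3 := abscissa_le hu.le
  have hxsq := abscissa_sq hu.le
  have hfB : fieldB b ((F.q ε).1 + ρ * Real.cos 0, (F.q ε).2 - ρ * Real.sin 0) =
    cubicPoly b (polarMap (F.q ε) 0 ρ).1 (polarMap (F.q ε) 0 ρ).2 *
      (polarMap (F.q ε) 0 ρ).1⁻¹ := by
    rw [← smoothInv_eq (x := (polarMap (F.q ε) 0 ρ).1) hx0 hx3]; rfl
  rw [hpt, hfB] at hmB
  have hX : abscissa ((F.q ε).1 + ρ * Real.cos 0) = (polarMap (F.q ε) 0 ρ).1 := rfl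
  rw [hX] at hx0 hxsq
  have hB := hε.eqB
  rw [Real.cos_zero, mul_one] at hxsq
  show 0 < -(-((polarMap (F.q ε) 0 ρ).1 ^ 3 - (polarMap (F.q ε) 0 ρ).1) +
    ε * cubicPoly b (polarMap (F.q ε) 0 ρ).1 (polarMap (F.q ε) 0 ρ).2)
  set x := (polarMap (F.q ε) 0 ρ).1
  set g := cubicPoly b x (polarMap (F.q ε) 0 ρ).2
  set B1 := hadamardQuotient (fieldB b) (F.q ε) (unitVec 0) ρ
  have hgx : g * x⁻¹ * x = g := by
    have : x ≠ 0 := by intro h; linarith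
    field_simp
  have e : -(-(x ^ 3 - x) + ε * g) = x * (ρ * (1 - ε * B1)) := by
    linear_combination x * hxsq + x * hB + ε * x * hmB + ε * hgx
  rw [e]
  have := (abs_le.1 hang).2
  have h1 : 0 < 1 - ε * B1 := by linarith
  have h2 : 0 < x := by linarith
  positivity

/-- An integrating factor yields a center. -/
theorem eventually_numLimitCycles_eq_zero_of_integral
    (hW : ∀ᶠ ε in 𝓝 (0 : ℝ), ∃ W μ : ℝ → ℝ → ℝ,
      (∀ x y, 1 / 2 ≤ x → x ≤ 3 / 2 → |y| ≤ 1 → 0 < μ x y) ∧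
      ∀ (x y : ℝ → ℝ) (x' y' t : ℝ), HasDerivAt x x' t → HasDerivAt y y' t →
        1 / 2 ≤ x t → x t ≤ 3 / 2 → |y t| ≤ 1 →
        HasDerivAt (fun s => W (x s) (y s))
          (μ (x t) (y t) * (-(perturbedField a b ε (x t, y t)).2 * x' +
            (perturbedField a b ε (x t, y t)).1 * y')) t) {r : ℝ} (hr0 : 0 < r)
    (hr : r ≤ 1 / 64) :
    ∀ᶠ ε in 𝓝 (0 : ℝ), numLimitCycles (perturbedField a b ε) (1, 0) r = 0 := by
  obtain ⟨F⟩ := nonempty_centerFamily a b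
  filter_upwards [hW, F.eventually_good, F.eventually_mul_lt (δ := 1 / 64) (by norm_num),
    F.eventually_norm_q_lt (δ := r / 8) (by linarith)] with ε ⟨W, μ, hμ, hd⟩ hε hC hq
  refine hε.numLimitCycles_eq_zero hC hr hq.le fun y hy h0 hle => ?_
  have hπ : 2 * Real.pi * (|ε| * F.M) < 1 / 8 := by
    have := Real.pi_lt_four
    have := mul_lt_mul_of_pos_left hC Real.two_pi_pos
    linarith
  have hbd : ∀ θ ∈ Set.Icc 0 (2 * Real.pi), |y θ| < 1 / 4 := fun θ hθ => by
    have := hε.abs_sol_le hy hθ.1 hθ.2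
    rw [abs_of_pos h0] at this
    linarith
  have hpos : 0 < y (2 * Real.pi) := hε.chart.pos_of_pos hy h0 _
  have hder : ∀ θ ∈ Set.Icc 0 (2 * Real.pi), HasDerivAt
      (fun s => W (polarMap (F.q ε) s (y s)).1 (polarMap (F.q ε) s (y s)).2) 0 θ := fun θ hθ => by
    have := hε.hasDerivAt_along hy (hbd θ hθ) (W := W) (μ := μ) (η₁ := 0) (η₂ := 0) (κ := 0)
      (fun x y x' y' t hx hy h1 h2 h3 => by simpa using hd x y x' y' t hx hy h1 h2 h3)
    simpa using this
  -- W is a first integral: it takes the same value at both ends of the turn.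
  have hconst := (convex_Icc 0 (2 * Real.pi)).is_const_of_fderivWithin_eq_zero (𝕜 := ℝ)
    (f := fun s => W (polarMap (F.q ε) s (y s)).1 (polarMap (F.q ε) s (y s)).2)
    (fun θ hθ => (hder θ hθ).differentiableAt.differentiableWithinAt)
    (fun θ hθ => by
      have huniq : UniqueDiffWithinAt ℝ (Set.Icc 0 (2 * Real.pi)) θ :=
        uniqueDiffOn_Icc Real.two_pi_pos θ hθ
      have := (hder θ hθ).hasFDerivAt.hasFDerivWithinAt (s := Set.Icc 0 (2 * Real.pi))
      rw [this.fderivWithin huniq]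
      ext; simp)
    (Set.left_mem_Icc.2 Real.two_pi_pos.le) (Set.right_mem_Icc.2 Real.two_pi_pos.le)
  have hp : polarMap (F.q ε) (2 * Real.pi) (y (2 * Real.pi)) =
      polarMap (F.q ε) 0 (y (2 * Real.pi)) := by simp [polarMap]
  simp only [hp] at hconst
  -- W is strictly increasing along the initial ray, where its derivative is μ times the positive
  -- quantity of `snd_field_ray`, up to a positive factor; equal values of W therefore mean equal
  -- radii.
  have hmono : StrictMonoOn
      (fun ρ => W (polarMap (F.q ε) 0 ρ).1 (polarMap (F.q ε) 0 ρ).2) (Set.Ioo 0 (1 / 4)) := by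
    have hray : ∀ ρ ∈ Set.Ioo (0 : ℝ) (1 / 4), ∃ d, 0 < d ∧ HasDerivAt
        (fun ρ => W (polarMap (F.q ε) 0 ρ).1 (polarMap (F.q ε) 0 ρ).2) d ρ := fun ρ hρ => by
      have habs : |ρ| < 1 / 4 := by rw [abs_of_pos hρ.1]; exact hρ.2
      obtain ⟨d1, d2⟩ := hasDerivAt_polarMap_ray hε.norm_le habs
      have hu : |(F.q ε).1 + ρ * Real.cos 0| ≤ 1 / 2 :=
        (abs_add_mul_le hε.norm_le (Real.abs_cos_le_one 0) habs.le).trans (by norm_num)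
      have hx0 := half_le_abscissa hu
      have hx3 := abscissa_le hu
      have hv : |(polarMap (F.q ε) 0 ρ).2| ≤ 1 := by
        have e2 : |(F.q ε).2| ≤ 1 / 8 := (norm_snd_le _).trans hε.norm_le
        simp only [polarMap, Real.sin_zero, mul_zero, sub_zero]
        rw [abs_div, abs_of_pos (show 0 < √2 by positivity)]
        refine (div_le_self (abs_nonneg _) ?_).trans (by linarith)
        rw [Real.one_le_sqrt]; norm_num
      refine ⟨_, ?_, hd _ _ _ _ ρ d1 d2 hx0 hx3 hv⟩
      have := hε.snd_field_ray hρ.1 hρ.2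
      rw [Prod.mk.eta, mul_zero, add_zero]
      have hxp : 0 < (polarMap (F.q ε) 0 ρ).1 := lt_of_lt_of_le (by norm_num) hx0
      exact mul_pos (hμ _ _ hx0 hx3 hv) (mul_pos this (by positivity))
    refine strictMonoOn_of_deriv_pos (convex_Ioo _ _)
      (fun ρ hρ => ?_) fun ρ hρ => ?_
    · obtain ⟨d, -, h⟩ := hray ρ hρ
      exact h.continuousAt.continuousWithinAt
    · rw [interior_Ioo] at hρ
      obtain ⟨d, h0, h⟩ := hray ρ hρ
      rwa [h.deriv]
  have h2 := hbd (2 * Real.pi) (Set.right_mem_Icc.2 Real.two_pi_pos.le)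
  rw [abs_of_pos hpos] at h2
  exact (hmono.injOn ⟨h0, by linarith⟩ ⟨hpos, h2⟩ hconst).symm

end Criteria

/-! ### Limit cycles from sign changes of the Melnikov integral. -/

section LowerBound

variable {a b : ℕ → ℕ → ℝ} {k : ℕ} {W μ η₁ η₂ : ℝ → ℝ → ℝ → ℝ}

/-- Over one turn W changes by εᵏ times a number close to the Melnikov integral at s, and W
increases along the ray near s. The return map therefore moves s in the direction of the sign of εᵏ
times that integral. -/
theorem CenterFamily.eventually_sign_return (F : CenterFamily a b) (hk : k ≠ 0)
    (hW : Reduction a b k W μ η₁ η₂)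
    {s : ℝ} (hs0 : 0 < s) (hs : s < 1 / 4) (hM : orbitIntegral (η₁ 0) (η₂ 0) s ≠ 0) :
    ∀ᶠ ε in 𝓝[≠] (0 : ℝ), 0 < (F.sol ε s (2 * Real.pi) - s) * ε ^ k *
      orbitIntegral (η₁ 0) (η₂ 0) s := by
  have hΔ : ∀ᶠ ε in 𝓝 (0 : ℝ), 0 < F.turnIntegral η₁ η₂ (s, ε) *
      orbitIntegral (η₁ 0) (η₂ 0) s := by
    have h1 : ContinuousAt (fun ε : ℝ => F.turnIntegral η₁ η₂ (s, ε)) 0 :=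
      ContinuousAt.comp (f := fun ε : ℝ => (s, ε))
        (F.contDiffAt_turnIntegral hW.smooth₁ hW.smooth₂ s).continuousAt (by fun_prop)
    refine (h1.mul_const _).eventually (lt_mem_nhds ?_)
    show 0 < F.turnIntegral η₁ η₂ (s, 0) * orbitIntegral (η₁ 0) (η₂ 0) s
    rw [F.turnIntegral_zero]
    exact mul_self_pos.2 hM
  -- Up to the positive factor 1/(2x), the derivative of W along the ray. At ε = 0 it equals x³ − x
  -- = xs > 0; the η₁ term drops out there because k ≠ 0.
  let N : ℝ × ℝ → ℝ := fun z =>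
    μ z.2 (polarMap (F.q z.2) 0 z.1).1 (polarMap (F.q z.2) 0 z.1).2 *
      -(perturbedField a b z.2 (polarMap (F.q z.2) 0 z.1)).2 +
    z.2 ^ k * η₁ z.2 (polarMap (F.q z.2) 0 z.1).1 (polarMap (F.q z.2) 0 z.1).2
  have hN : ∀ᶠ z in 𝓝 (s, (0 : ℝ)), 0 < N z := by
    have hq : ContinuousAt (fun z : ℝ × ℝ => F.q z.2) (s, 0) :=
      ContinuousAt.comp (f := fun z : ℝ × ℝ => z.2) (g := F.q) (by exact F.smooth_q.continuousAt)
        (by fun_prop)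
    have hm : ContinuousAt (fun z : ℝ × ℝ => polarMap (F.q z.2) 0 z.1) (s, 0) :=
      ContinuousAt.comp (f := fun z : ℝ × ℝ => (F.q z.2, (0 : ℝ), z.1))
        contDiff_polarMap.continuous.continuousAt
        (hq.prodMk (continuousAt_const.prodMk continuousAt_fst))
    have h3 : ContinuousAt (fun z : ℝ × ℝ => (z.2, (polarMap (F.q z.2) 0 z.1).1,
        (polarMap (F.q z.2) 0 z.1).2)) (s, 0) :=
      continuousAt_snd.prodMk (hm.fst.prodMk hm.snd)
    have h4 := ContinuousAt.comp (f := fun z : ℝ × ℝ => (z.2, (polarMap (F.q z.2) 0 z.1).1,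
        (polarMap (F.q z.2) 0 z.1).2)) hW.continuous_μ.continuousAt h3
    have h5 := ContinuousAt.comp (f := fun z : ℝ × ℝ => (z.2, (polarMap (F.q z.2) 0 z.1).1,
        (polarMap (F.q z.2) 0 z.1).2)) hW.smooth₁.continuous.continuousAt h3
    have h6 : Continuous fun w : ℝ × ℝ × ℝ => (perturbedField a b w.1 w.2).2 := by
      have e1 := (contDiff_cubicPoly b (n := 1)).continuous
      have e2 : Continuous fun w : ℝ × ℝ × ℝ => cubicPoly b w.2.1 w.2.2 :=
        e1.comp continuous_snd
      unfold perturbedField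
      fun_prop
    have h7 := ContinuousAt.comp (f := fun z : ℝ × ℝ => (z.2, polarMap (F.q z.2) 0 z.1))
      h6.continuousAt (continuousAt_snd.prodMk hm)
    refine ((h4.mul h7.neg).add ((continuousAt_snd.pow k).mul h5)).eventually (lt_mem_nhds ?_)
    have hu : |s| ≤ 1 / 2 := by rw [abs_of_pos hs0]; linarith
    have hx := abscissa_sq hu
    have hx0 := half_le_abscissa hu
    show 0 < μ 0 (polarMap (F.q 0) 0 s).1 (polarMap (F.q 0) 0 s).2 *
      -(perturbedField a b 0 (polarMap (F.q 0) 0 s)).2 +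
      (0 : ℝ) ^ k * η₁ 0 (polarMap (F.q 0) 0 s).1 (polarMap (F.q 0) 0 s).2
    rw [hW.μ_zero, zero_pow hk, F.q_zero]
    simp only [polarMap, perturbedField, Prod.fst_zero, Prod.snd_zero, Real.cos_zero, Real.sin_zero,
      mul_one, mul_zero, zero_add, zero_mul, add_zero, one_mul, neg_neg]
    have : abscissa s ^ 3 - abscissa s = abscissa s * s := by linear_combination abscissa s * hx
    rw [this]
    positivity
  obtain ⟨δ, hδ, hN⟩ := Metric.eventually_nhds_iff.1 hN
  filter_upwards [hΔ.filter_mono nhdsWithin_le_nhds,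
    F.eventually_good.filter_mono nhdsWithin_le_nhds,
    (F.eventually_mul_lt (δ := min δ (1 / 4 - s) / (2 * Real.pi))
      (by have : 0 < 1 / 4 - s := by linarith
          positivity)).filter_mono nhdsWithin_le_nhds,
    nhdsWithin_le_nhds (Metric.ball_mem_nhds (0 : ℝ) hδ), self_mem_nhdsWithin]
    with ε h1 hε h3 h4 hne
  rw [lt_div_iff₀ Real.two_pi_pos, lt_min_iff] at h3
  rw [Metric.mem_ball] at h4
  obtain ⟨s1, s2⟩ := hε.sol_spec s
  have hinc := hε.pow_mul_turnIntegral hW (ρ := s) (by rw [abs_of_pos hs0]; linarith [h3.2])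
  set P := F.sol ε s (2 * Real.pi)
  have hP : |P - s| ≤ 2 * Real.pi * (|ε| * F.M) := by
    have := s2.abs_sub_le hε.chart.abs_S_le 0 (2 * Real.pi)
    rw [s1, sub_zero, abs_of_pos Real.two_pi_pos] at this
    linarith
  let G : ℝ → ℝ := fun ρ => W ε (polarMap (F.q ε) 0 ρ).1 (polarMap (F.q ε) 0 ρ).2
  have hmono : StrictMonoOn G (Set.Icc (s - |P - s|) (s + |P - s|)) := by
    have hray : ∀ ρ ∈ Set.Icc (s - |P - s|) (s + |P - s|), ∃ d, 0 < d ∧ HasDerivAt G d ρ :=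
      fun ρ hρ => by
      have hd : |ρ - s| ≤ |P - s| := abs_le.2 ⟨by linarith [hρ.1], by linarith [hρ.2]⟩
      have habs : |ρ| < 1 / 4 := by
        have := abs_add_le s (ρ - s)
        rw [add_sub_cancel, abs_of_pos hs0] at this
        linarith [h3.2]
      obtain ⟨d1, d2⟩ := hasDerivAt_polarMap_ray hε.norm_le habs
      have hu : |(F.q ε).1 + ρ * Real.cos 0| ≤ 1 / 2 :=
        (abs_add_mul_le hε.norm_le (Real.abs_cos_le_one 0) habs.le).trans (by norm_num)
      have hxp : 0 < (polarMap (F.q ε) 0 ρ).1 :=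
        lt_of_lt_of_le (by norm_num) (half_le_abscissa hu)
      have hNp : 0 < N (ρ, ε) := hN (by
        rw [Prod.dist_eq, max_lt_iff]
        exact ⟨by rw [Real.dist_eq]; linarith [h3.1], h4⟩)
      refine ⟨N (ρ, ε) * (1 / (2 * (polarMap (F.q ε) 0 ρ).1)), by positivity,
        (hW.hasDerivAt ε _ _ _ _ ρ d1 d2).congr_deriv ?_⟩
      simp only [N]
      ring
    refine strictMonoOn_of_deriv_pos (convex_Icc _ _) (fun ρ hρ => ?_) fun ρ hρ => ?_
    · obtain ⟨d, -, h⟩ := hray ρ hρ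
      exact h.continuousAt.continuousWithinAt
    · obtain ⟨d, h0, h⟩ := hray ρ (interior_subset hρ)
      rwa [h.deriv]
  have hsmem : s ∈ Set.Icc (s - |P - s|) (s + |P - s|) :=
    ⟨by linarith [abs_nonneg (P - s)], by linarith [abs_nonneg (P - s)]⟩
  have hPmem : P ∈ Set.Icc (s - |P - s|) (s + |P - s|) :=
    ⟨by linarith [neg_abs_le (P - s)], by linarith [le_abs_self (P - s)]⟩
  have hsign : 0 < (P - s) * (ε ^ k * F.turnIntegral η₁ η₂ (s, ε)) := by
    rw [hinc]
    rcases lt_trichotomy P s with h | h | h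
    · exact mul_pos_of_neg_of_neg (sub_neg.2 h) (sub_neg.2 (hmono hPmem hsmem h))
    · rw [h, sub_self] at hinc
      rcases mul_eq_zero.1 hinc with h0 | h0
      · exact absurd h0 (pow_ne_zero k hne)
      · rw [h0, zero_mul] at h1
        exact absurd h1 (lt_irrefl _)
    · exact mul_pos (sub_pos.2 h) (sub_pos.2 (hmono hsmem hPmem h))
  have h5 := mul_pos hsign h1
  have hΔne : F.turnIntegral η₁ η₂ (s, ε) ≠ 0 := fun h => by
    rw [h, zero_mul] at h1; exact lt_irrefl _ h1
  have h6 : 0 < F.turnIntegral η₁ η₂ (s, ε) ^ 2 := by positivity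
  refine pos_of_mul_pos_left (b := F.turnIntegral η₁ η₂ (s, ε) ^ 2) ?_ h6.le
  calc 0 < _ := h5
    _ = _ := by ring

/-- Lower bound for the number of limit cycles near `(1, 0)`. -/
theorem eventually_le_numLimitCycles (hk : k ≠ 0) (hW : Reduction a b k W μ η₁ η₂) {R : ℝ}
    (hR : R ≤ 1 / 8) {j : ℕ} (hj : ∀ ρ ∈ Set.Icc (-R) R,
      iteratedDeriv (2 * j + 2) (orbitIntegral (η₁ 0) (η₂ 0)) ρ ≠ 0) {m : ℕ} {s : ℕ → ℝ}
    (hs0 : 0 < s 0) (hs : StrictMono s) (hsR : s m < R) {r : ℝ} (hr : r ≤ 1 / 2) (hsr : s m < r)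
    (hsign : ∀ i < m, orbitIntegral (η₁ 0) (η₂ 0) (s i) *
      orbitIntegral (η₁ 0) (η₂ 0) (s (i + 1)) < 0) :
    ∀ᶠ ε in 𝓝[≠] (0 : ℝ), (m : ℕ∞) ≤ numLimitCycles (perturbedField a b ε) (1, 0) r := by
  rcases Nat.eq_zero_or_pos m with rfl | hm
  · exact Eventually.of_forall fun _ => by simp
  obtain ⟨F⟩ := nonempty_centerFamily a b
  have hspos : ∀ i, 0 < s i := fun i => hs0.trans_le (hs.monotone (Nat.zero_le i))
  have hne : ∀ i ≤ m, orbitIntegral (η₁ 0) (η₂ 0) (s i) ≠ 0 := fun i hi h => by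
    rcases hi.lt_or_eq with h' | rfl
    · have := hsign i h'
      rw [h, zero_mul] at this
      exact lt_irrefl _ this
    · have := hsign (i - 1) (by omega)
      rw [show i - 1 + 1 = i by omega, h, mul_zero] at this
      exact lt_irrefl _ this
  have hall : ∀ᶠ ε in 𝓝[≠] (0 : ℝ), ∀ i ∈ Finset.range (m + 1),
      0 < (F.sol ε (s i) (2 * Real.pi) - s i) * ε ^ k * orbitIntegral (η₁ 0) (η₂ 0) (s i) := by
    rw [eventually_all_finset]
    intro i hi
    have hi' : i ≤ m := Nat.lt_succ_iff.1 (Finset.mem_range.1 hi)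
    refine F.eventually_sign_return hk hW (hspos i) ?_ (hne i hi')
    exact (hs.monotone hi').trans_lt (hsR.trans (by linarith))
  have hgap : 0 < min (r - s m) (R - s m) := lt_min (by linarith) (by linarith)
  have hR₁ : (s m + R) / 2 < R := by linarith
  filter_upwards [hall, F.eventually_encard_closedRadii_le hW ((hspos m).trans hsR) hR hj hR₁,
    F.eventually_good.filter_mono nhdsWithin_le_nhds,
    (F.eventually_mul_lt (δ := min (r - s m) (1 / 8) / (8 * Real.pi))
      (by have : 0 < r - s m := by linarith
          have := Real.pi_pos
          positivity)).filter_mono nhdsWithin_le_nhds,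
    (F.eventually_norm_q_lt (δ := (r - s m) / 2) (by linarith)).filter_mono nhdsWithin_le_nhds]
    with ε h1 h2 hε h3 h4
  rw [lt_div_iff₀ (by have := Real.pi_pos; positivity), lt_min_iff] at h3
  have hCnn := hε.chart.C_nonneg
  have hPm : StrictMono fun ρ => F.sol ε ρ (2 * Real.pi) := fun ρ ρ' h =>
    (hε.sol_spec ρ).2.lt_of_lt hε.chart.lipschitz (hε.sol_spec ρ').2
      (by rwa [(hε.sol_spec ρ).1, (hε.sol_spec ρ').1]) _
  have hPs : Function.Surjective fun ρ => F.sol ε ρ (2 * Real.pi) := fun w => by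
    obtain ⟨y, hy, hys⟩ := hε.chart.exists_sol (2 * Real.pi) w
    exact ⟨y 0, by simp only [hε.sol_eq hys, hy]⟩
  -- Continuity of the return map comes for free: it is monotone and surjective.
  have hPc : Continuous fun ρ => F.sol ε ρ (2 * Real.pi) - ρ :=
    (hPm.monotone.continuous_of_surjective hPs).sub continuous_id
  have hex : ∀ i < m, ∃ ρ ∈ Set.Ioo (s i) (s (i + 1)), F.sol ε ρ (2 * Real.pi) = ρ := by
    intro i hi
    have e1 := h1 i (Finset.mem_range.2 (by omega))
    have e2 := h1 (i + 1) (Finset.mem_range.2 (by omega))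
    have e3 := hsign i hi
    have hlt : s i < s (i + 1) := hs (Nat.lt_succ_self i)
    set A := F.sol ε (s i) (2 * Real.pi) - s i with hA
    set B := F.sol ε (s (i + 1)) (2 * Real.pi) - s (i + 1) with hB
    -- In the product of the two sign conditions εᵏ appears squared, so its sign is irrelevant.
    have hAB : A * B < 0 := by
      have e4 := mul_pos e1 e2
      by_contra hnn
      rw [not_lt] at hnn
      have : A * ε ^ k * orbitIntegral (η₁ 0) (η₂ 0) (s i) *
          (B * ε ^ k * orbitIntegral (η₁ 0) (η₂ 0) (s (i + 1))) =
          (A * B) * (ε ^ k) ^ 2 * (orbitIntegral (η₁ 0) (η₂ 0) (s i) *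
          orbitIntegral (η₁ 0) (η₂ 0) (s (i + 1))) := by ring
      rw [this] at e4
      have := mul_nonpos_of_nonneg_of_nonpos (mul_nonneg hnn (sq_nonneg (ε ^ k))) e3.le
      linarith
    have hz : (0 : ℝ) ∈ (fun ρ => F.sol ε ρ (2 * Real.pi) - ρ) '' Set.Ioo (s i) (s (i + 1)) := by
      rcases mul_neg_iff.1 hAB with ⟨hA', hB'⟩ | ⟨hA', hB'⟩
      · exact intermediate_value_Ioo' hlt.le hPc.continuousOn ⟨hB', hA'⟩
      · exact intermediate_value_Ioo hlt.le hPc.continuousOn ⟨hA', hB'⟩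
    obtain ⟨ρ, hρ, h⟩ := hz
    exact ⟨ρ, hρ, sub_eq_zero.1 h⟩
  choose! ρ hρ hfix using hex
  have hinj : Set.InjOn ρ (Finset.range m : Set ℕ) := by
    have hlt : ∀ i i', i < i' → i < m → i' < m → ρ i < ρ i' := fun i i' h hi hi' =>
      (hρ i hi).2.trans_le ((hs.monotone (by omega : i + 1 ≤ i')).trans (hρ i' hi').1.le)
    intro i hi i' hi' h
    rw [Finset.mem_coe, Finset.mem_range] at hi hi'
    rcases lt_trichotomy i i' with h' | h' | h'
    · exact absurd h (hlt i i' h' hi hi').ne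
    · exact h'
    · exact absurd h (hlt i' i h' hi' hi).ne'
  have hfinal := hε.chart.card_le_numLimitCycles (P := (1, 0)) (r := r) (R₁ := (s m + R) / 2)
    (R₂ := s m) ((Finset.range m).image ρ) (fun w hw => ?_) (by linarith) ?_
    (Set.finite_of_encard_le_coe h2) (fun θ w hw0 hw => polarMap_mem_ball hw0.le hr ?_)
  · rwa [Finset.card_image_of_injOn hinj, Finset.card_range] at hfinal
  · obtain ⟨i, hi, rfl⟩ := Finset.mem_image.1 hw
    rw [Finset.mem_range] at hi
    refine ⟨⟨_, (hε.sol_spec (ρ i)).2, (hε.sol_spec (ρ i)).1, hfix i hi⟩,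
      (hspos i).trans (hρ i hi).1, (hρ i hi).2.le.trans (hs.monotone (by omega))⟩
  · linarith [h3.2]
  · linarith [h3.1]

end LowerBound

/-! ### Reversible fields have centers. -/

section Reversible

variable {a b : ℕ → ℕ → ℝ}

theorem fieldA_reflect (ha : ∀ x y, cubicPoly a x (-y) = -cubicPoly a x y) (u v : ℝ) :
    fieldA a (u, -v) = -fieldA a (u, v) := by
  simp only [fieldA, neg_div, ha, mul_neg]

theorem fieldB_reflect (hb : ∀ x y, cubicPoly b x (-y) = cubicPoly b x y) (u v : ℝ) :
    fieldB b (u, -v) = fieldB b (u, v) := by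
  simp only [fieldB, neg_div, hb]

/-- The Hadamard quotients are compared after multiplication by the clamped radius, where they
become differences of values; when that radius is zero both sides vanish. -/
theorem polarS_reflect (ha : ∀ x y, cubicPoly a x (-y) = -cubicPoly a x y)
    (hb : ∀ x y, cubicPoly b x (-y) = cubicPoly b x y) (θ ρ u ε : ℝ) :
    polarS (fieldA a) (fieldB b) (-θ, ρ, (u, 0), ε) =
      -polarS (fieldA a) (fieldB b) (θ, ρ, (u, 0), ε) := by
  rcases eq_or_ne (clamp ρ) 0 with h0 | h0
  · simp [polarS, h0]
  · have hA : hadamardQuotient (fieldA a) (u, 0) (unitVec (-θ)) (clamp ρ) =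
        -hadamardQuotient (fieldA a) (u, 0) (unitVec θ) (clamp ρ) := by
      apply mul_left_cancel₀ h0
      rw [mul_neg, mul_hadamardQuotient (contDiff_fieldA a), mul_hadamardQuotient (contDiff_fieldA a)]
      have e1 : fieldA a (u, 0) = 0 := by
        have := fieldA_reflect ha u 0
        rw [neg_zero] at this
        linarith
      have e2 := fieldA_reflect ha (u + clamp ρ * Real.cos θ) (clamp ρ * -Real.sin θ)
      simp only [unitVec, Real.cos_neg, Real.sin_neg, neg_neg, Prod.smul_mk, smul_eq_mul,
        Prod.mk_add_mk, zero_add, e1, sub_zero]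
      rw [← e2]
      ring_nf
    have hB : hadamardQuotient (fieldB b) (u, 0) (unitVec (-θ)) (clamp ρ) =
        hadamardQuotient (fieldB b) (u, 0) (unitVec θ) (clamp ρ) := by
      apply mul_left_cancel₀ h0
      rw [mul_hadamardQuotient (contDiff_fieldB b), mul_hadamardQuotient (contDiff_fieldB b)]
      have e2 := fieldB_reflect hb (u + clamp ρ * Real.cos θ) (clamp ρ * -Real.sin θ)
      simp only [unitVec, Real.cos_neg, Real.sin_neg, neg_neg, Prod.smul_mk, smul_eq_mul,
        Prod.mk_add_mk, zero_add]
      rw [← e2]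
      ring_nf
    simp only [polarS, radialPart, angularPart, hA, hB, Real.cos_neg, Real.sin_neg]
    ring_nf

/-- A field that is reversible with respect to the `x`-axis has a center. -/
theorem eventually_numLimitCycles_eq_zero_of_reversible
    (ha : ∀ x y, cubicPoly a x (-y) = -cubicPoly a x y)
    (hb : ∀ x y, cubicPoly b x (-y) = cubicPoly b x y) {r : ℝ} (hr0 : 0 < r)
    (hr : r ≤ 1 / 64) :
    ∀ᶠ ε in 𝓝 (0 : ℝ), numLimitCycles (perturbedField a b ε) (1, 0) r = 0 := by
  obtain ⟨F⟩ := nonempty_centerFamily a b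
  have hlim : Tendsto (fun ε : ℝ => (ε, ((F.q ε).1, -(F.q ε).2))) (𝓝 0) (𝓝 (0, 0)) := by
    have h1 := F.smooth_q.continuousAt
    have h2 : ContinuousAt (fun ε : ℝ => (ε, ((F.q ε).1, -(F.q ε).2))) 0 :=
      continuousAt_id.prodMk (h1.fst.prodMk h1.snd.neg)
    have h3 : (fun ε : ℝ => (ε, ((F.q ε).1, -(F.q ε).2))) 0 = (0, 0) := by
      simp [F.q_zero]
    rw [← h3]
    exact h2
  filter_upwards [hlim.eventually F.unique, F.eventually_good,
    F.eventually_mul_lt (δ := 1 / 64) (by norm_num),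
    F.eventually_norm_q_lt (δ := r / 8) (by linarith)] with ε h1 hε hC hq
  -- The reflected equilibrium is an equilibrium as well, so uniqueness places it on the axis.
  have hv : (F.q ε).2 = 0 := by
    have := h1 (by
      show -(F.q ε).2 = -ε * fieldA a ((F.q ε).1, -(F.q ε).2)
      rw [fieldA_reflect ha, Prod.mk.eta]
      linarith [hε.eqA]) (by
      show (F.q ε).1 = ε * fieldB b ((F.q ε).1, -(F.q ε).2)
      rw [fieldB_reflect hb, Prod.mk.eta]
      exact hε.eqB)
    have h2 : (F.q ε).2 = -(F.q ε).2 := congrArg Prod.snd this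
    linarith
  have hq2 : F.q ε = ((F.q ε).1, 0) := by rw [← hv]
  have hrefl : ∀ θ ρ, F.field ε (-θ) ρ = -F.field ε θ ρ := fun θ ρ => by
    rw [CenterFamily.field, CenterFamily.field, hq2]
    exact polarS_reflect ha hb _ _ _ _
  refine hε.numLimitCycles_eq_zero hC hr hq.le fun y hy h0 hle => ?_
  have hy2 : IsSolution (F.field ε) fun θ => y (-θ) := fun θ => by
    have := (hy (-θ)).scomp θ (hasDerivAt_neg θ)
    simp only [smul_eq_mul, neg_mul, one_mul, hrefl, neg_neg] at this
    exact this
  have heven : y = fun θ => y (-θ) :=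
    hy.eq_of_eq hε.chart.lipschitz hy2 (θ := 0) (by simp)
  have hy3 := hε.chart.sol_shift_one hy
  -- An even solution takes the same value at −π and π, so it agrees with its shift by one turn.
  have h3 : y = fun θ => y (θ + 2 * Real.pi) :=
    hy.eq_of_eq hε.chart.lipschitz hy3 (θ := -Real.pi) (by
      have := congrFun heven (-Real.pi)
      simp only [neg_neg] at this
      rw [this]
      congr 1
      ring)
  have := congrFun h3 0
  simp only [zero_add] at this
  exact this.symm

end Reversible

/-! ### Transfer from (−1, 0) to (1, 0) by the half-turn. -/

section Symmetry

/-- The coefficients of the field rotated by half a turn. -/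
def rotatedCoeff (c : ℕ → ℕ → ℝ) (i j : ℕ) : ℝ := -((-1) ^ (i + j) * c i j)

theorem cubicPoly_rotatedCoeff (c : ℕ → ℕ → ℝ) (x y : ℝ) :
    cubicPoly (rotatedCoeff c) x y = -cubicPoly c (-x) (-y) := by
  simp only [cubicPoly, rotatedCoeff, ← Finset.sum_neg_distrib]
  refine Finset.sum_congr rfl fun i _ => Finset.sum_congr rfl fun j _ => ?_
  rw [neg_pow x, neg_pow y, pow_add]
  ring

theorem perturbedField_rotatedCoeff (a b : ℕ → ℕ → ℝ) (ε : ℝ) (p : ℝ × ℝ) :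
    perturbedField (rotatedCoeff a) (rotatedCoeff b) ε p = -perturbedField a b ε (-p) := by
  simp only [perturbedField, cubicPoly_rotatedCoeff, Prod.fst_neg, Prod.snd_neg, Prod.neg_mk]
  ext <;> simp only <;> ring

theorem isPeriodicOrbit_neg {X : ℝ × ℝ → ℝ × ℝ} {Γ : Set (ℝ × ℝ)} (h : IsPeriodicOrbit X Γ) :
    IsPeriodicOrbit (fun p => -X (-p)) (Neg.neg '' Γ) := by
  obtain ⟨γ, T, hT, hγ, hp, ⟨t, ht⟩, rfl⟩ := h
  refine ⟨fun t => -γ t, T, hT, fun t => ?_, fun t => by simp only [hp t],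
    ⟨t, fun h => ht (neg_injective h)⟩, ?_⟩
  · simp only [neg_neg]
    exact (hγ t).neg
  · rw [← Set.range_comp]; rfl

theorem image_neg_image_neg (Γ : Set (ℝ × ℝ)) : Neg.neg '' (Neg.neg '' Γ) = Γ := by
  rw [← Set.image_comp]
  simp

theorem isLimitCycle_neg {X : ℝ × ℝ → ℝ × ℝ} {Γ : Set (ℝ × ℝ)} (h : IsLimitCycle X Γ) :
    IsLimitCycle (fun p => -X (-p)) (Neg.neg '' Γ) := by
  obtain ⟨h1, U, hU, hsub, hiso⟩ := h
  refine ⟨isPeriodicOrbit_neg h1, Neg.neg '' U, ?_, Set.image_mono hsub, fun Γ' h' hne => ?_⟩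
  · exact (Homeomorph.neg (ℝ × ℝ)).isOpenMap U hU
  · have h2 := isPeriodicOrbit_neg h'
    simp only [neg_neg] at h2
    have h3 := hiso _ h2 (by
      obtain ⟨_, hp, p, hpU, rfl⟩ := hne
      exact ⟨p, ⟨_, hp, by simp⟩, hpU⟩)
    rw [← h3, image_neg_image_neg]

/-- The half-turn carries limit cycles injectively to limit cycles. One inequality suffices, because
passing from X to p ↦ −X(−p) is an involution. -/
theorem numLimitCycles_neg_le (X : ℝ × ℝ → ℝ × ℝ) (P : ℝ × ℝ) (r : ℝ) :
    numLimitCycles X P r ≤ numLimitCycles (fun p => -X (-p)) (-P) r := by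
  have hinj : Function.Injective fun Γ : Set (ℝ × ℝ) => Neg.neg '' Γ :=
    Set.image_injective.2 neg_injective
  rw [numLimitCycles, ← hinj.encard_image]
  refine Set.encard_le_encard ?_
  rintro _ ⟨Γ, ⟨h1, h2⟩, rfl⟩
  refine ⟨isLimitCycle_neg h1, ?_⟩
  rintro _ ⟨p, hp, rfl⟩
  have := h2 hp
  rwa [Metric.mem_ball, dist_neg_neg]

theorem numLimitCycles_neg (a b : ℕ → ℕ → ℝ) (ε r : ℝ) :
    numLimitCycles (perturbedField a b ε) (-1, 0) r =
      numLimitCycles (perturbedField (rotatedCoeff a) (rotatedCoeff b) ε) (1, 0) r := by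
  have h : perturbedField (rotatedCoeff a) (rotatedCoeff b) ε =
      fun p => -perturbedField a b ε (-p) := funext (perturbedField_rotatedCoeff a b ε)
  rw [h]
  apply le_antisymm
  · simpa using numLimitCycles_neg_le (perturbedField a b ε) (-1, 0) r
  · simpa using numLimitCycles_neg_le (fun p => -perturbedField a b ε (-p)) (1, 0) r

end Symmetry

/-! ### Taylor coefficients from polynomial approximations, and moments of the cosine. -/

section TaylorCoefficients

/-- By strong induction the lower derivatives vanish, so the Taylor polynomial is a single monomial
of degree n. It is o(xⁿ), hence its coefficient is zero. -/
theorem iteratedDeriv_eq_zero_of_isBigO {h : ℝ → ℝ} (hh : ContDiff ℝ ∞ h) {N : ℕ}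
    (hO : h =O[𝓝 0] fun x => x ^ (N + 1)) {n : ℕ} (hn : n ≤ N) : iteratedDeriv n h 0 = 0 := by
  induction n using Nat.strong_induction_on with
  | _ n ih =>
    have h1 := taylor_isLittleO_univ (x₀ := (0 : ℝ)) (n := n) (contDiff_infty.1 hh n)
    have hT : ∀ x, taylorWithinEval h n Set.univ 0 x =
        ((n.factorial : ℝ)⁻¹ * x ^ n) * iteratedDeriv n h 0 := by
      have hlow : ∀ m, m ≤ n → ∀ x, taylorWithinEval h m Set.univ 0 x =
          ((m.factorial : ℝ)⁻¹ * x ^ m) * iteratedDeriv m h 0 := by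
        intro m hm x
        rcases m with _ | m
        · simp
        · rw [taylorWithinEval_succ, iteratedDerivWithin_univ]
          have h0 : ∀ k, k < n → taylorWithinEval h k Set.univ 0 x = 0 := by
            intro k
            induction k with
            | zero =>
              intro hk
              have := ih 0 hk (by omega)
              simpa using this
            | succ k ihk =>
              intro hk
              rw [taylorWithinEval_succ, ihk (by omega), iteratedDerivWithin_univ,
                ih (k + 1) hk (by omega)]
              simp
          rw [h0 m (by omega), Nat.factorial_succ]
          simp
      exact hlow n le_rfl
    have h2 : (fun x : ℝ => x ^ (N + 1)) =o[𝓝 0] fun x => x ^ n := by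
      simpa using Asymptotics.isLittleO_pow_pow (𝕜 := ℝ) (show n < N + 1 by omega)
    have h3 := (hO.trans_isLittleO h2).sub (by simpa [hT] using h1)
    simp only [sub_sub_cancel] at h3
    by_contra hne
    have h4 : (fun x : ℝ => x ^ n) =O[𝓝 0]
        fun x => (n.factorial : ℝ)⁻¹ * x ^ n * iteratedDeriv n h 0 := by
      have : (fun x : ℝ => x ^ n) = fun x => (n.factorial * (iteratedDeriv n h 0)⁻¹) *
          ((n.factorial : ℝ)⁻¹ * x ^ n * iteratedDeriv n h 0) := by
        funext x
        have : (n.factorial : ℝ) ≠ 0 := by positivity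
        field_simp
      rw [this]
      exact (Asymptotics.isBigO_refl _ _).const_mul_left _ |>.trans
        (by simpa using Asymptotics.isBigO_refl _ _)
    have h5 := h4.trans_isLittleO h3
    refine Asymptotics.isLittleO_irrefl ?_ h5
    have h6 : ∀ᶠ x in 𝓝[≠] (0 : ℝ), x ^ n ≠ 0 :=
      eventually_mem_nhdsWithin.mono fun x hx => pow_ne_zero n hx
    exact h6.frequently.filter_mono nhdsWithin_le_nhds

theorem iteratedDeriv_sum_pow (p : ℕ → ℝ) (K n : ℕ) (hn : n < K) :
    iteratedDeriv n (fun x : ℝ => ∑ k ∈ Finset.range K, p k * x ^ k) 0 = n.factorial * p n := by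
  rw [iteratedDeriv_fun_sum fun k _ => by fun_prop, Finset.sum_eq_single n]
  · rw [iteratedDeriv_const_mul_field, iteratedDeriv_pow]
    simp [Nat.descFactorial_self, mul_comm]
  · intro k _ hk
    rw [iteratedDeriv_const_mul_field, iteratedDeriv_pow]
    rcases lt_or_gt_of_ne hk with h | h
    · rw [Nat.descFactorial_of_lt h]; simp
    · rw [zero_pow (by omega)]; simp
  · intro h
    exact absurd (Finset.mem_range.2 hn) h

/-- The Taylor coefficients of a smooth function with a given polynomial expansion. -/
theorem iteratedDeriv_eq_of_isBigO {f : ℝ → ℝ} (hf : ContDiff ℝ ∞ f) {p : ℕ → ℝ} {K N : ℕ}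
    (hO : (fun x => f x - ∑ k ∈ Finset.range K, p k * x ^ k) =O[𝓝 0] fun x => x ^ (N + 1))
    {n : ℕ} (hn : n ≤ N) (hK : n < K) : iteratedDeriv n f 0 = n.factorial * p n := by
  have hP : ContDiff ℝ ∞ fun x : ℝ => ∑ k ∈ Finset.range K, p k * x ^ k := by fun_prop
  have h := iteratedDeriv_eq_zero_of_isBigO (hf.sub hP) hO hn
  rw [iteratedDeriv_fun_sub (contDiff_infty.1 hf n).contDiffAt
    (contDiff_infty.1 hP n).contDiffAt, iteratedDeriv_sum_pow p K n hK] at h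
  linarith

/-- The coefficients of the binomial series of `(1 + z) ^ (-1/2)`. -/
noncomputable def invSqrtCoeff : ℕ → ℝ
  | 0 => 1
  | 1 => -1 / 2
  | 2 => 3 / 8
  | 3 => -5 / 16
  | 4 => 35 / 128
  | 5 => -63 / 256
  | 6 => 231 / 1024
  | 7 => -429 / 2048
  | 8 => 6435 / 32768
  | 9 => -12155 / 65536
  | 10 => 46189 / 262144
  | _ => 0

/-- A polynomial identity that replaces the convergence of the binomial series: the truncation is an
inverse square root of 1 + z up to order z¹¹. -/
theorem invSqrt_remainder (z : ℝ) :
    (1 + z) * (∑ n ∈ Finset.range 12, invSqrtCoeff n * z ^ n) ^ 2 = 1 + z ^ 11 * (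
      (88179/262144) * z ^ 0 + (-323323/2097152) * z ^ 1 + (223839/2097152) * z ^ 2 +
      (-692835/8388608) * z ^ 3 + (2263261/33554432) * z ^ 4 + (-61108047/1073741824) * z ^ 5 +
      (13180167/268435456) * z ^ 6 + (-46235189/1073741824) * z ^ 7 +
      (328513185/8589934592) * z ^ 8 + (-2357994639/68719476736) * z ^ 9 +
      (2133423721/68719476736) * z ^ 10) := by
  simp only [Finset.sum_range_succ, Finset.sum_range_zero, invSqrtCoeff]
  ring

/-- With g = 1/x and x² = 1 + z, the difference of squares (g − T)(g + T)(1 + z) is −z¹¹R by the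
previous identity, and (g + T)(1 + z) is bounded below because g(1 + z) = x ≥ 1/2. -/
theorem exists_abs_invSqrt_sub_le : ∃ δ K : ℝ, 0 < δ ∧ δ ≤ 1 / 2 ∧ 0 ≤ K ∧ ∀ z, |z| ≤ δ →
    |smoothInv (abscissa z) - ∑ n ∈ Finset.range 12, invSqrtCoeff n * z ^ n| ≤ K * |z| ^ 11 := by
  let T : ℝ → ℝ := fun z => ∑ n ∈ Finset.range 12, invSqrtCoeff n * z ^ n
  let R : ℝ → ℝ := fun z => (88179/262144) * z ^ 0 + (-323323/2097152) * z ^ 1 +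
    (223839/2097152) * z ^ 2 + (-692835/8388608) * z ^ 3 + (2263261/33554432) * z ^ 4 +
    (-61108047/1073741824) * z ^ 5 + (13180167/268435456) * z ^ 6 +
    (-46235189/1073741824) * z ^ 7 + (328513185/8589934592) * z ^ 8 +
    (-2357994639/68719476736) * z ^ 9 + (2133423721/68719476736) * z ^ 10
  have hT : Continuous T := by fun_prop
  have hR : Continuous R := by fun_prop
  have hT0 : T 0 = 1 := by
    simp [T, Finset.sum_range_succ, invSqrtCoeff]
  have e1 : ∀ᶠ z in 𝓝 (0 : ℝ), 0 < T z := hT.continuousAt.eventually (lt_mem_nhds (by rw [hT0]; norm_num))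
  have e2 : ∀ᶠ z in 𝓝 (0 : ℝ), |R z| < |R 0| + 1 :=
    hR.abs.continuousAt.eventually (gt_mem_nhds (by simp))
  obtain ⟨δ, hδ, h⟩ := Metric.eventually_nhds_iff.1 (e1.and e2)
  refine ⟨min (δ / 2) (1 / 2), 4 * (|R 0| + 1), by positivity, min_le_right _ _, by positivity,
    fun z hz => ?_⟩
  obtain ⟨h1, h2⟩ := h (y := z) (by
    rw [Real.dist_eq, sub_zero]
    have := hz.trans (min_le_left _ _)
    linarith)
  have hz2 : |z| ≤ 1 / 2 := hz.trans (min_le_right _ _)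
  have hx0 := half_le_abscissa hz2
  have hx3 := abscissa_le hz2
  have hsq := abscissa_sq hz2
  rw [smoothInv_eq hx0 hx3]
  set x := abscissa z
  show |x⁻¹ - T z| ≤ _
  have hrem : (1 + z) * T z ^ 2 = 1 + z ^ 11 * R z := invSqrt_remainder z
  have hxne : x ≠ 0 := by intro h; linarith
  have hg : x⁻¹ * (1 + z) = x := by rw [← hsq]; field_simp
  have key : (x⁻¹ - T z) * ((x⁻¹ + T z) * (1 + z)) = -(z ^ 11 * R z) := by
    have e3 : x⁻¹ * x = 1 := inv_mul_cancel₀ hxne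
    linear_combination x⁻¹ * hg + e3 - hrem
  have hb : 1 / 4 ≤ (x⁻¹ + T z) * (1 + z) := by
    have : 0 ≤ T z * (1 + z) := mul_nonneg h1.le (by linarith [(abs_le.1 hz2).1])
    rw [add_mul, hg]
    linarith
  have := congrArg abs key
  rw [abs_mul, abs_neg, abs_mul (z ^ 11), abs_pow, abs_of_pos (show 0 < (x⁻¹ + T z) * (1 + z) by linarith)]
    at this
  have h3 : |x⁻¹ - T z| * (1 / 4) ≤ |z| ^ 11 * (|R 0| + 1) := by
    calc _ ≤ |x⁻¹ - T z| * ((x⁻¹ + T z) * (1 + z)) := by gcongr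
      _ = |z| ^ 11 * |R z| := this
      _ ≤ _ := by gcongr
  linarith

/-- The moments of the cosine. -/
noncomputable def cosMoment (n : ℕ) : ℝ := ∫ θ in (0 : ℝ)..2 * Real.pi, Real.cos θ ^ n

theorem cosMoment_zero : cosMoment 0 = 2 * Real.pi := by simp [cosMoment]

theorem cosMoment_add_two (n : ℕ) : cosMoment (n + 2) = (n + 1) / (n + 2) * cosMoment n := by
  rw [cosMoment, integral_cos_pow]
  simp [cosMoment]

theorem integral_cos_pow_mul_sin_sq (n : ℕ) :
    ∫ θ in (0 : ℝ)..2 * Real.pi, Real.cos θ ^ n * Real.sin θ ^ 2 =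
      cosMoment n - cosMoment (n + 2) := by
  rw [cosMoment, cosMoment, ← intervalIntegral.integral_sub
    (by apply Continuous.intervalIntegrable; fun_prop)
    (by apply Continuous.intervalIntegrable; fun_prop)]
  congr 1
  funext θ
  rw [Real.sin_sq]
  ring

theorem integral_cos_pow_mul_sin_pow_four (n : ℕ) :
    ∫ θ in (0 : ℝ)..2 * Real.pi, Real.cos θ ^ n * Real.sin θ ^ 4 =
      cosMoment n - 2 * cosMoment (n + 2) + cosMoment (n + 4) := by
  rw [cosMoment, cosMoment, cosMoment, ← intervalIntegral.integral_const_mul,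
    ← intervalIntegral.integral_sub (by apply Continuous.intervalIntegrable; fun_prop)
    (by apply Continuous.intervalIntegrable; fun_prop),
    ← intervalIntegral.integral_add (by apply Continuous.intervalIntegrable; fun_prop)
    (by apply Continuous.intervalIntegrable; fun_prop)]
  congr 1
  funext θ
  rw [show Real.sin θ ^ 4 = (Real.sin θ ^ 2) ^ 2 by ring, Real.sin_sq]
  ring

end TaylorCoefficients

/-! ### Expansion of the cycle integrals at the center. -/

section CycleIntegral

theorem contDiff_orbitIntegral {η₁ η₂ : ℝ → ℝ → ℝ}
    (h₁ : ContDiff ℝ ∞ fun z : ℝ × ℝ => η₁ z.1 z.2)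
    (h₂ : ContDiff ℝ ∞ fun z : ℝ × ℝ => η₂ z.1 z.2) : ContDiff ℝ ∞ (orbitIntegral η₁ η₂) := by
  have hz : ContDiff ℝ ∞ fun p : ℝ × ℝ => p.2 * Real.cos p.1 :=
    contDiff_snd.mul (Real.contDiff_cos.comp contDiff_fst)
  have hs : ContDiff ℝ ∞ fun p : ℝ × ℝ => p.2 * Real.sin p.1 :=
    contDiff_snd.mul (Real.contDiff_sin.comp contDiff_fst)
  have hx : ContDiff ℝ ∞ fun p : ℝ × ℝ => abscissa (p.2 * Real.cos p.1) := contDiff_abscissa.comp hz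
  have hi : ContDiff ℝ ∞ fun p : ℝ × ℝ => smoothInv (abscissa (p.2 * Real.cos p.1)) :=
    contDiff_smoothInv.comp hx
  have hxy : ContDiff ℝ ∞ fun p : ℝ × ℝ =>
      (abscissa (p.2 * Real.cos p.1), -(p.2 * Real.sin p.1) / √2) :=
    hx.prodMk (hs.neg.div_const _)
  exact contDiff_parametric_integral Real.two_pi_pos.le
    (fun p : ℝ × ℝ => η₁ (abscissa (p.2 * Real.cos p.1)) (-(p.2 * Real.sin p.1) / √2) *
      (-(p.2 * Real.sin p.1) * (smoothInv (abscissa (p.2 * Real.cos p.1)) / 2)) +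
    η₂ (abscissa (p.2 * Real.cos p.1)) (-(p.2 * Real.sin p.1) / √2) *
      (-(p.2 * Real.cos p.1) / √2))
    (((h₁.comp hxy).mul (hs.neg.mul (hi.div_const 2))).add ((h₂.comp hxy).mul (hz.neg.div_const _)))

/-- The standard one-forms `N dx`, odd with respect to `y`. -/
def oddForm (v : Fin 6 → ℝ) (x y : ℝ) : ℝ :=
  v 0 * y + v 1 * (x ^ 2 * y) + v 2 * y ^ 3 + v 3 * (x ^ 2 * y ^ 3) + v 4 * (x * y) +
    v 5 * (x * y ^ 3)

/-- The integral of a standard one-form along the closed orbits around `(1, 0)`. -/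
noncomputable def cycleIntegral (v : Fin 6 → ℝ) : ℝ → ℝ := orbitIntegral (oddForm v) fun _ _ => 0

theorem contDiff_cycleIntegral (v : Fin 6 → ℝ) : ContDiff ℝ ∞ (cycleIntegral v) :=
  contDiff_orbitIntegral (by unfold oddForm; fun_prop) contDiff_const

/-- On the circle dx = du/(2x) and x² = 1 + ρ cos θ. The terms with a factor x lose their 1/x and
become polynomial; 1/x is the only transcendental factor left. This is why v 4 and v 5 enter only
the two lowest orders. -/
theorem cycleIntegral_eq (v : Fin 6 → ℝ) {ρ : ℝ} (hρ : |ρ| ≤ 1 / 2) :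
    cycleIntegral v ρ = 1 / (2 * √2) * ∫ θ in (0 : ℝ)..2 * Real.pi,
      (ρ ^ 2 * Real.sin θ ^ 2 * ((v 0 + v 1 * (1 + ρ * Real.cos θ)) *
        smoothInv (abscissa (ρ * Real.cos θ)) + v 4) +
      ρ ^ 4 * Real.sin θ ^ 4 / 2 * ((v 2 + v 3 * (1 + ρ * Real.cos θ)) *
        smoothInv (abscissa (ρ * Real.cos θ)) + v 5)) := by
  rw [cycleIntegral, orbitIntegral, ← intervalIntegral.integral_const_mul]
  congr 1
  funext θ
  have hz : |ρ * Real.cos θ| ≤ 1 / 2 := by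
    rw [abs_mul]
    exact (mul_le_of_le_one_right (abs_nonneg _) (Real.abs_cos_le_one θ)).trans hρ
  have hx0 := half_le_abscissa hz
  have hsq := abscissa_sq hz
  rw [smoothInv_eq hx0 (abscissa_le hz), oddForm, ← hsq]
  set x := abscissa (ρ * Real.cos θ)
  have hx : x ≠ 0 := by intro h; linarith
  have h2 : √2 ^ 2 = 2 := Real.sq_sqrt (by norm_num)
  have h2ne : √2 ≠ 0 := by positivity
  have h3 : √2 ^ 3 = 2 * √2 := by rw [pow_succ, h2]
  rw [div_pow, h3]
  field_simp
  ring


/-- The truncation error of order 11 gains the factor ρ² of the integrand, which leaves exact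
coefficients up to ρ¹². -/
theorem cycleIntegral_isBigO (v : Fin 6 → ℝ) :
    (fun ρ => cycleIntegral v ρ - 1 / (2 * √2) * ∫ θ in (0 : ℝ)..2 * Real.pi,
      (ρ ^ 2 * Real.sin θ ^ 2 * ((v 0 + v 1 * (1 + ρ * Real.cos θ)) *
        (∑ n ∈ Finset.range 12, invSqrtCoeff n * (ρ * Real.cos θ) ^ n) + v 4) +
      ρ ^ 4 * Real.sin θ ^ 4 / 2 * ((v 2 + v 3 * (1 + ρ * Real.cos θ)) *
        (∑ n ∈ Finset.range 12, invSqrtCoeff n * (ρ * Real.cos θ) ^ n) + v 5))) =O[𝓝 0]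
      fun ρ => ρ ^ (12 + 1) := by
  obtain ⟨δ, K, hδ, hδ2, hK, hT⟩ := exists_abs_invSqrt_sub_le
  let V := |v 0| + |v 1| * 2 + (|v 2| + |v 3| * 2)
  refine Asymptotics.IsBigO.of_bound (1 / (2 * √2) * (V * K * |2 * Real.pi - 0|)) ?_
  filter_upwards [Metric.closedBall_mem_nhds (0 : ℝ) hδ] with ρ hρ
  rw [Metric.mem_closedBall, Real.dist_eq, sub_zero] at hρ
  have hρ2 : |ρ| ≤ 1 / 2 := hρ.trans hδ2
  rw [cycleIntegral_eq v hρ2, ← mul_sub, ← intervalIntegral.integral_sub]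
  · rw [norm_mul, norm_pow, Real.norm_of_nonneg (show (0 : ℝ) ≤ 1 / (2 * √2) by positivity),
      Real.norm_eq_abs ρ, mul_assoc (1 / (2 * √2))]
    refine mul_le_mul_of_nonneg_left ?_ (by positivity)
    rw [mul_assoc, mul_comm |2 * Real.pi - 0|, ← mul_assoc]
    refine intervalIntegral.norm_integral_le_of_norm_le_const fun θ _ => ?_
    have hz : |ρ * Real.cos θ| ≤ |ρ| := by
      rw [abs_mul]
      exact mul_le_of_le_one_right (abs_nonneg _) (Real.abs_cos_le_one θ)
    have hr := hT (ρ * Real.cos θ) (hz.trans hρ)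
    have hr2 : |smoothInv (abscissa (ρ * Real.cos θ)) -
        ∑ n ∈ Finset.range 12, invSqrtCoeff n * (ρ * Real.cos θ) ^ n| ≤ K * |ρ| ^ 11 :=
      hr.trans (by gcongr)
    set g := smoothInv (abscissa (ρ * Real.cos θ))
    set T := ∑ n ∈ Finset.range 12, invSqrtCoeff n * (ρ * Real.cos θ) ^ n
    have hz1 : |1 + ρ * Real.cos θ| ≤ 2 := by
      refine (abs_add_le _ _).trans ?_
      rw [abs_one]
      linarith
    have hs2 : |Real.sin θ ^ 2| ≤ 1 := by
      rw [abs_pow]; exact pow_le_one₀ (abs_nonneg _) (Real.abs_sin_le_one θ)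
    have hs4 : |Real.sin θ ^ 4| ≤ 1 := by
      rw [abs_pow]; exact pow_le_one₀ (abs_nonneg _) (Real.abs_sin_le_one θ)
    have e1 : ∀ c d : ℝ, |c + d * (1 + ρ * Real.cos θ)| ≤ |c| + |d| * 2 := fun c d => by
      refine (abs_add_le _ _).trans ?_
      rw [abs_mul]
      gcongr
    have hρ4 : |ρ ^ 4| ≤ |ρ| ^ 2 := by
      rw [abs_pow]
      exact pow_le_pow_of_le_one (abs_nonneg _) (by linarith) (by norm_num)
    calc _ = |ρ ^ 2 * Real.sin θ ^ 2 * ((v 0 + v 1 * (1 + ρ * Real.cos θ)) * (g - T)) +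
          ρ ^ 4 * Real.sin θ ^ 4 / 2 * ((v 2 + v 3 * (1 + ρ * Real.cos θ)) * (g - T))| := by
          rw [Real.norm_eq_abs]; congr 1; ring
      _ ≤ |ρ| ^ 2 * 1 * ((|v 0| + |v 1| * 2) * (K * |ρ| ^ 11)) +
          |ρ| ^ 2 * 1 / 1 * ((|v 2| + |v 3| * 2) * (K * |ρ| ^ 11)) := by
          refine (abs_add_le _ _).trans ?_
          rw [abs_mul, abs_mul, abs_mul, abs_pow ρ 2, abs_mul, abs_div, abs_mul, abs_mul, abs_two]
          have := e1 (v 0) (v 1)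
          have := e1 (v 2) (v 3)
          gcongr
          norm_num
      _ = V * K * |ρ| ^ 13 := by simp only [V]; ring
  · apply Continuous.intervalIntegrable
    have h1 := contDiff_abscissa.continuous
    have h2 := contDiff_smoothInv.continuous
    fun_prop
  · apply Continuous.intervalIntegrable
    fun_prop

theorem sum_shift (α β : ℕ → ℝ) (ρ : ℝ) :
    ∑ n ∈ Finset.range 13, (ρ ^ (n + 2) * α n + ρ ^ (n + 4) * β n) =
      ∑ k ∈ Finset.range 17, ((if 2 ≤ k ∧ k < 15 then α (k - 2) else 0) +
        (if 4 ≤ k then β (k - 4) else 0)) * ρ ^ k := by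
  simp only [Finset.sum_range_succ, Finset.sum_range_zero]
  norm_num
  ring

/-- Termwise integration in moments. Multiplication by 1 + z adds neighbouring binomial coefficients
and raises the degree by one, hence thirteen terms. -/
theorem approx_integral_eq (v : Fin 6 → ℝ) (ρ : ℝ) :
    ∫ θ in (0 : ℝ)..2 * Real.pi,
      (ρ ^ 2 * Real.sin θ ^ 2 * ((v 0 + v 1 * (1 + ρ * Real.cos θ)) *
        (∑ n ∈ Finset.range 12, invSqrtCoeff n * (ρ * Real.cos θ) ^ n) + v 4) +
      ρ ^ 4 * Real.sin θ ^ 4 / 2 * ((v 2 + v 3 * (1 + ρ * Real.cos θ)) *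
        (∑ n ∈ Finset.range 12, invSqrtCoeff n * (ρ * Real.cos θ) ^ n) + v 5)) =
    ∑ n ∈ Finset.range 13,
      (ρ ^ (n + 2) * ((v 0 * invSqrtCoeff n +
          v 1 * (invSqrtCoeff n + if n = 0 then 0 else invSqrtCoeff (n - 1)) +
          v 4 * (if n = 0 then 1 else 0)) * (cosMoment n - cosMoment (n + 2))) +
        ρ ^ (n + 4) * ((v 2 * invSqrtCoeff n +
          v 3 * (invSqrtCoeff n + if n = 0 then 0 else invSqrtCoeff (n - 1)) +
          v 5 * (if n = 0 then 1 else 0)) / 2 *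
          (cosMoment n - 2 * cosMoment (n + 2) + cosMoment (n + 4)))) := by
  simp only [← integral_cos_pow_mul_sin_sq, ← integral_cos_pow_mul_sin_pow_four,
    ← intervalIntegral.integral_const_mul]
  have hadd : ∀ n : ℕ, ∀ p q r s : ℝ,
      (∫ θ in (0 : ℝ)..2 * Real.pi, p * (q * (Real.cos θ ^ n * Real.sin θ ^ 2))) +
        ∫ θ in (0 : ℝ)..2 * Real.pi, r * (s * (Real.cos θ ^ n * Real.sin θ ^ 4)) =
      ∫ θ in (0 : ℝ)..2 * Real.pi, (p * (q * (Real.cos θ ^ n * Real.sin θ ^ 2)) +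
        r * (s * (Real.cos θ ^ n * Real.sin θ ^ 4))) := fun n p q r s => by
    rw [intervalIntegral.integral_add] <;>
    · apply Continuous.intervalIntegrable
      fun_prop
  simp only [hadd]
  rw [← intervalIntegral.integral_finsetSum fun n _ => by
    apply Continuous.intervalIntegrable
    fun_prop]
  congr 1
  funext θ
  have h11 : invSqrtCoeff 11 = 0 := rfl
  have h12 : invSqrtCoeff 12 = 0 := rfl
  simp only [Finset.sum_range_succ, Finset.sum_range_zero, h11, h12, mul_pow]
  norm_num
  ring

/-- The coefficients of the expansion of the cycle integral at the center. -/
noncomputable def orderCoeff (v : Fin 6 → ℝ) : ℕ → ℝ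
  | 0 => v 0 + v 1 + v 4
  | 1 => 3 / 32 * v 0 - 1 / 32 * v 1 + 3 / 8 * v 2 + 3 / 8 * v 3 + 3 / 8 * v 5
  | 2 => 35 / 1024 * v 0 - 5 / 1024 * v 1 + 3 / 128 * v 2 - 1 / 128 * v 3
  | 3 => 1155 / 65536 * v 0 - 105 / 65536 * v 1 + 105 / 16384 * v 2 - 15 / 16384 * v 3
  | 4 => 45045 / 4194304 * v 0 - 3003 / 4194304 * v 1 + 693 / 262144 * v 2 - 63 / 262144 * v 3
  | 5 => 969969 / 134217728 * v 0 - 51051 / 134217728 * v 1 + 45045 / 33554432 * v 2 -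
      3003 / 33554432 * v 3
  | _ => 0

/-- Order j = 5 corresponds to ρ¹², the last power that the truncation determines. The moments
follow from the recursion for powers of the cosine. -/
theorem iteratedDeriv_cycleIntegral (v : Fin 6 → ℝ) {j : ℕ} (hj : j < 6) :
    iteratedDeriv (2 * j + 2) (cycleIntegral v) 0 =
      (2 * j + 2).factorial * (Real.pi / (2 * √2) * orderCoeff v j) := by
  have hO := cycleIntegral_isBigO v
  simp only [approx_integral_eq, sum_shift] at hO
  simp only [Finset.mul_sum, ← mul_assoc] at hO
  rw [iteratedDeriv_eq_of_isBigO (contDiff_cycleIntegral v) hO (by omega) (by omega)]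
  congr 1
  have e2 := cosMoment_add_two 0
  have e4 := cosMoment_add_two 2
  have e6 := cosMoment_add_two 4
  have e8 := cosMoment_add_two 6
  have e10 := cosMoment_add_two 8
  have e12 := cosMoment_add_two 10
  norm_num [cosMoment_zero] at e2 e4 e6 e8 e10 e12
  rw [e2] at e4
  rw [e4] at e6
  rw [e6] at e8
  rw [e8] at e10
  rw [e10] at e12
  interval_cases j <;>
  · norm_num [invSqrtCoeff, orderCoeff, cosMoment_zero, e2, e4, e6, e8, e10, e12]
    ring

end CycleIntegral

/-! ### Orders at the two centers. -/

section Pairs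

/-- The effect of the rotation by half a turn on the standard one-forms. -/
def flipOdd (v : Fin 6 → ℝ) : Fin 6 → ℝ := ![v 0, v 1, v 2, v 3, -v 4, -v 5]

/-- The coefficients of order 2 to 5 involve only v 0, …, v 3, so they agree at both centers, and
together they determine these four entries. A nonzero coefficient of order 2 or 3 leads to 3 + 3.
Otherwise the coefficients of order 0 and 1 at the two centers are examined: in each branch one more
vanishing would force, by linear algebra, a coefficient known to be nonzero to vanish, or v to be
zero. -/
theorem exists_orderCoeff_ne_zero {v : Fin 6 → ℝ} (hv : v ≠ 0) :
    ∃ d ∈ maximalDistributions, ∃ i j, i ≤ d.1 ∧ j ≤ d.2 ∧ orderCoeff v i ≠ 0 ∧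
      orderCoeff (flipOdd v) j ≠ 0 := by
  have f4 : flipOdd v 4 = -v 4 := rfl
  have f5 : flipOdd v 5 = -v 5 := rfl
  have f0 : flipOdd v 0 = v 0 := rfl
  have f1 : flipOdd v 1 = v 1 := rfl
  have f2 : flipOdd v 2 = v 2 := rfl
  have f3 : flipOdd v 3 = v 3 := rfl
  have hm : ∀ w : Fin 6 → ℝ, orderCoeff w 0 = w 0 + w 1 + w 4 ∧
      orderCoeff w 1 = 3 / 32 * w 0 - 1 / 32 * w 1 + 3 / 8 * w 2 + 3 / 8 * w 3 + 3 / 8 * w 5 ∧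
      orderCoeff w 2 = 35 / 1024 * w 0 - 5 / 1024 * w 1 + 3 / 128 * w 2 - 1 / 128 * w 3 ∧
      orderCoeff w 3 = 1155 / 65536 * w 0 - 105 / 65536 * w 1 + 105 / 16384 * w 2 -
        15 / 16384 * w 3 ∧
      orderCoeff w 4 = 45045 / 4194304 * w 0 - 3003 / 4194304 * w 1 + 693 / 262144 * w 2 -
        63 / 262144 * w 3 ∧
      orderCoeff w 5 = 969969 / 134217728 * w 0 - 51051 / 134217728 * w 1 +
        45045 / 33554432 * w 2 - 3003 / 33554432 * w 3 := fun w => ⟨rfl, rfl, rfl, rfl, rfl, rfl⟩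
  obtain ⟨m0, m1, m2, m3, m4, m5⟩ := hm v
  obtain ⟨n0, n1, n2, n3, n4, n5⟩ := hm (flipOdd v)
  rw [f0, f1, f4] at n0
  rw [f0, f1, f2, f3, f5] at n1
  rw [f0, f1, f2, f3] at n2 n3 n4 n5
  have hzero : v 0 = 0 → v 1 = 0 → v 2 = 0 → v 3 = 0 → v 4 = 0 → v 5 = 0 → False :=
    fun h0 h1 h2 h3 h4 h5 => hv (by ext i; fin_cases i <;> assumption)
  have mem : (5, 0) ∈ maximalDistributions ∧ (0, 5) ∈ maximalDistributions ∧
    (4, 1) ∈ maximalDistributions ∧ (1, 4) ∈ maximalDistributions ∧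
    (3, 3) ∈ maximalDistributions := by decide
  obtain ⟨d50, d05, d41, d14, d33⟩ := mem
  by_cases h2 : orderCoeff v 2 = 0
  swap
  · exact ⟨_, d33, 2, 2, by norm_num, by norm_num, h2, by rwa [n2, ← m2]⟩
  by_cases h3 : orderCoeff v 3 = 0
  swap
  · exact ⟨_, d33, 3, 3, by norm_num, by norm_num, h3, by rwa [n3, ← m3]⟩
  by_cases k0 : orderCoeff v 0 = 0
  swap
  · by_cases h4 : orderCoeff (flipOdd v) 4 = 0
    swap
    · exact ⟨_, d05, 0, 4, by norm_num, by norm_num, k0, h4⟩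
    by_cases h5 : orderCoeff (flipOdd v) 5 = 0
    swap
    · exact ⟨_, d05, 0, 5, by norm_num, by norm_num, k0, h5⟩
    refine ⟨_, d33, 0, 0, by norm_num, by norm_num, k0, fun h0 => k0 ?_⟩
    linarith
  by_cases k1 : orderCoeff v 1 = 0
  swap
  · by_cases h4 : orderCoeff (flipOdd v) 4 = 0
    swap
    · exact ⟨_, d14, 1, 4, by norm_num, by norm_num, k1, h4⟩
    by_cases h0 : orderCoeff (flipOdd v) 0 = 0
    swap
    · exact ⟨_, d33, 1, 0, by norm_num, by norm_num, k1, h0⟩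
    refine ⟨_, d33, 1, 1, by norm_num, by norm_num, k1, fun h1 => k1 ?_⟩
    linarith
  by_cases h0 : orderCoeff (flipOdd v) 0 = 0
  swap
  · by_cases h4 : orderCoeff v 4 = 0
    swap
    · exact ⟨_, d41, 4, 0, by norm_num, by norm_num, h4, h0⟩
    refine ⟨_, d50, 5, 0, by norm_num, by norm_num, fun h5 => h0 ?_, h0⟩
    linarith
  by_cases h1 : orderCoeff (flipOdd v) 1 = 0
  swap
  · refine ⟨_, d41, 4, 1, by norm_num, by norm_num, fun h4 => h1 ?_, h1⟩
    linarith
  exfalso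
  refine hzero ?_ ?_ ?_ ?_ ?_ ?_ <;> linarith

end Pairs

/-! ### One radius for all Melnikov vectors. -/

section UniformRadius

theorem orbitIntegral_integrand_continuous {η₁ η₂ : ℝ → ℝ → ℝ}
    (h₁ : Continuous fun z : ℝ × ℝ => η₁ z.1 z.2) (h₂ : Continuous fun z : ℝ × ℝ => η₂ z.1 z.2)
    (ρ : ℝ) : Continuous fun θ : ℝ =>
      η₁ (abscissa (ρ * Real.cos θ)) (-(ρ * Real.sin θ) / √2) *
      (-(ρ * Real.sin θ) * (smoothInv (abscissa (ρ * Real.cos θ)) / 2)) +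
      η₂ (abscissa (ρ * Real.cos θ)) (-(ρ * Real.sin θ) / √2) * (-(ρ * Real.cos θ) / √2) := by
  have h3 := contDiff_abscissa.continuous
  have h4 := contDiff_smoothInv.continuous
  have h5 : Continuous fun θ : ℝ => (abscissa (ρ * Real.cos θ), -(ρ * Real.sin θ) / √2) := by
    fun_prop
  have h6 := h₁.comp h5
  have h7 := h₂.comp h5
  simp only [Function.comp_def] at h6 h7
  fun_prop

theorem continuous_oddForm (v : Fin 6 → ℝ) : Continuous fun z : ℝ × ℝ => oddForm v z.1 z.2 := by
  unfold oddForm; fun_prop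

/-- The cycle integral, as a linear map. -/
noncomputable def cycleIntegralL : (Fin 6 → ℝ) →ₗ[ℝ] (ℝ → ℝ) where
  toFun := cycleIntegral
  map_add' v w := by
    funext ρ
    simp only [cycleIntegral, orbitIntegral, Pi.add_apply]
    rw [← intervalIntegral.integral_add
      ((orbitIntegral_integrand_continuous (η₂ := fun _ _ => 0) (continuous_oddForm v) continuous_const ρ
        ).intervalIntegrable _ _)
      ((orbitIntegral_integrand_continuous (η₂ := fun _ _ => 0) (continuous_oddForm w) continuous_const ρ
        ).intervalIntegrable _ _)]
    congr 1
    funext θ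
    simp only [oddForm, Pi.add_apply]
    ring
  map_smul' c v := by
    funext ρ
    simp only [cycleIntegral, orbitIntegral, Pi.smul_apply, smul_eq_mul, RingHom.id_apply]
    rw [← intervalIntegral.integral_const_mul]
    congr 1
    funext θ
    simp only [oddForm, Pi.smul_apply, smul_eq_mul]
    ring

theorem cycleIntegral_smul (c : ℝ) (v : Fin 6 → ℝ) (ρ : ℝ) :
    cycleIntegral (c • v) ρ = c * cycleIntegral v ρ :=
  congrFun (cycleIntegralL.map_smul c v) ρ

theorem iteratedDeriv_cycleIntegral_eq_sum (n : ℕ) (v : Fin 6 → ℝ) (ρ : ℝ) :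
    iteratedDeriv n (cycleIntegral v) ρ =
      ∑ i, v i * iteratedDeriv n (cycleIntegral fun j => if i = j then 1 else 0) ρ := by
  have h : cycleIntegral v = fun ρ => ∑ i, v i * cycleIntegral (fun j => if i = j then 1 else 0) ρ := by
    funext ρ
    have := congrFun (LinearMap.pi_apply_eq_sum_univ cycleIntegralL v) ρ
    simp only [Finset.sum_apply, Pi.smul_apply, smul_eq_mul] at this
    exact this
  rw [h, iteratedDeriv_fun_sum fun i _ =>
    (contDiff_const.mul (contDiff_infty.1 (contDiff_cycleIntegral _) n)).contDiffAt]
  simp only [iteratedDeriv_const_mul_field]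

theorem continuous_iteratedDeriv_cycleIntegral (n : ℕ) :
    Continuous fun z : ℝ × (Fin 6 → ℝ) => iteratedDeriv n (cycleIntegral z.2) z.1 := by
  have h : (fun z : ℝ × (Fin 6 → ℝ) => iteratedDeriv n (cycleIntegral z.2) z.1) = fun z =>
      ∑ i, z.2 i * iteratedDeriv n (cycleIntegral fun j => if i = j then 1 else 0) z.1 :=
    funext fun z => iteratedDeriv_cycleIntegral_eq_sum n z.2 z.1
  rw [h]
  have : ∀ w, Continuous (iteratedDeriv n (cycleIntegral w)) := fun w =>
    (contDiff_cycleIntegral w).continuous_iteratedDeriv n (by exact_mod_cast le_top)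
  fun_prop

theorem continuous_flipOdd : Continuous flipOdd := by
  refine continuous_pi fun i => ?_
  fin_cases i
  exacts [continuous_apply _, continuous_apply _, continuous_apply _, continuous_apply _,
    (continuous_apply _).neg, (continuous_apply _).neg]

/-- A neighbourhood of the center in which the orders of the cycle integrals control their
zeros. -/
theorem exists_uniform_radius : ∃ R : ℝ, 0 < R ∧ R ≤ 1 / 8 ∧ ∀ v : Fin 6 → ℝ, v ≠ 0 →
    ∃ d ∈ maximalDistributions, ∃ i j, i ≤ d.1 ∧ j ≤ d.2 ∧ ∀ ρ ∈ Set.Icc (-R) R,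
      iteratedDeriv (2 * i + 2) (cycleIntegral v) ρ ≠ 0 ∧
      iteratedDeriv (2 * j + 2) (cycleIntegral (flipOdd v)) ρ ≠ 0 := by
  let P : ℝ → (Fin 6 → ℝ) → Prop := fun R v =>
    ∃ d ∈ maximalDistributions, ∃ i j, i ≤ d.1 ∧ j ≤ d.2 ∧ ∀ ρ ∈ Set.Icc (-R) R,
      iteratedDeriv (2 * i + 2) (cycleIntegral v) ρ ≠ 0 ∧
      iteratedDeriv (2 * j + 2) (cycleIntegral (flipOdd v)) ρ ≠ 0
  have hlt : ∀ d ∈ maximalDistributions, d.1 < 6 ∧ d.2 < 6 := by decide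
  -- The derivatives are jointly continuous in ρ and v, so a nonzero value at (0, v) persists with
  -- the same orders nearby.
  have hloc : ∀ v ∈ Metric.sphere (0 : Fin 6 → ℝ) 1, ∀ᶠ z : ℝ × (Fin 6 → ℝ) in 𝓝 (0, v),
      P z.1 z.2 := by
    intro v hv
    have hv0 : v ≠ 0 := by
      rintro rfl
      simp at hv
    obtain ⟨d, hd, i, j, hi, hj, h1, h2⟩ := exists_orderCoeff_ne_zero hv0
    have hpos : (0 : ℝ) < Real.pi / (2 * √2) := by have := Real.pi_pos; positivity
    have e1 : iteratedDeriv (2 * i + 2) (cycleIntegral v) 0 ≠ 0 := by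
      rw [iteratedDeriv_cycleIntegral v (hi.trans_lt (hlt d hd).1)]
      exact mul_ne_zero (by positivity) (mul_ne_zero hpos.ne' h1)
    have e2 : iteratedDeriv (2 * j + 2) (cycleIntegral (flipOdd v)) 0 ≠ 0 := by
      rw [iteratedDeriv_cycleIntegral _ (hj.trans_lt (hlt d hd).2)]
      exact mul_ne_zero (by positivity) (mul_ne_zero hpos.ne' h2)
    have c1 := (continuous_iteratedDeriv_cycleIntegral (2 * i + 2)).continuousAt
      (x := (0, v)) |>.eventually_ne e1
    have c2 := ((continuous_iteratedDeriv_cycleIntegral (2 * j + 2)).comp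
      (continuous_fst.prodMk (continuous_flipOdd.comp continuous_snd))).continuousAt
      (x := ((0 : ℝ), v)) |>.eventually_ne e2
    obtain ⟨δ, hδ, h⟩ := Metric.eventually_nhds_iff.1 (c1.and c2)
    filter_upwards [Metric.ball_mem_nhds ((0 : ℝ), v) hδ] with z hz
    rw [Metric.mem_ball, Prod.dist_eq, max_lt_iff, Real.dist_eq, sub_zero] at hz
    refine ⟨d, hd, i, j, hi, hj, fun ρ hρ => h (y := (ρ, z.2)) ?_⟩
    rw [Prod.dist_eq, max_lt_iff, Real.dist_eq, sub_zero]
    exact ⟨(abs_le.2 hρ).trans_lt ((le_abs_self _).trans_lt hz.1), hz.2⟩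
  have hall := (isCompact_sphere (0 : Fin 6 → ℝ) 1).eventually_forall_of_forall_eventually hloc
  obtain ⟨δ, hδ, h⟩ := Metric.eventually_nhds_iff.1 hall
  refine ⟨min (δ / 2) (1 / 8), by positivity, min_le_right _ _, fun v hv => ?_⟩
  have hn : 0 < ‖v‖ := norm_pos_iff.2 hv
  -- Cycle integrals are linear in v, so it suffices to treat the normalized vector.
  obtain ⟨d, hd, i, j, hi, hj, hne⟩ := h (y := min (δ / 2) (1 / 8)) (by
    rw [Real.dist_eq, sub_zero, abs_of_pos (by positivity)]
    exact (min_le_left _ _).trans_lt (by linarith)) (‖v‖⁻¹ • v) (by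
    rw [mem_sphere_zero_iff_norm, norm_smul, norm_inv, norm_norm, inv_mul_cancel₀ hn.ne'])
  refine ⟨d, hd, i, j, hi, hj, fun ρ hρ => ?_⟩
  have hf : flipOdd (‖v‖⁻¹ • v) = ‖v‖⁻¹ • flipOdd v := by
    ext i
    fin_cases i <;> simp [flipOdd]
  have hd : ∀ (n : ℕ) (w : Fin 6 → ℝ), iteratedDeriv n (cycleIntegral (‖v‖⁻¹ • w)) ρ =
      ‖v‖⁻¹ * iteratedDeriv n (cycleIntegral w) ρ := fun n w => by
    rw [funext (cycleIntegral_smul ‖v‖⁻¹ w), iteratedDeriv_const_mul_field]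
  have := hne ρ hρ
  rw [hf, hd, hd] at this
  exact ⟨right_ne_zero_of_mul this.1, right_ne_zero_of_mul this.2⟩

end UniformRadius

/-! ### Zeros in maximal number are sign changes. -/

section SignChanges

/-- Replacing ρ by −ρ amounts to shifting θ by π. -/
theorem orbitIntegral_neg (η₁ η₂ : ℝ → ℝ → ℝ) (ρ : ℝ) :
    orbitIntegral η₁ η₂ (-ρ) = orbitIntegral η₁ η₂ ρ := by
  let I : ℝ → ℝ := fun θ => η₁ (abscissa (ρ * Real.cos θ)) (-(ρ * Real.sin θ) / √2) *
      (-(ρ * Real.sin θ) * (smoothInv (abscissa (ρ * Real.cos θ)) / 2)) +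
    η₂ (abscissa (ρ * Real.cos θ)) (-(ρ * Real.sin θ) / √2) * (-(ρ * Real.cos θ) / √2)
  have hper : Function.Periodic I (2 * Real.pi) := fun θ => by
    simp only [I, Real.cos_add_two_pi, Real.sin_add_two_pi]
  have h1 : orbitIntegral η₁ η₂ (-ρ) = ∫ θ in (0 : ℝ)..2 * Real.pi, I (θ + Real.pi) := by
    rw [orbitIntegral]
    congr 1
    funext θ
    simp only [I, Real.cos_add_pi, Real.sin_add_pi, neg_mul, mul_neg]
  rw [h1, intervalIntegral.integral_comp_add_right, zero_add, add_comm,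
    hper.intervalIntegral_add_eq Real.pi 0, zero_add]
  rfl

theorem cycleIntegral_neg (v : Fin 6 → ℝ) (ρ : ℝ) : cycleIntegral v (-ρ) = cycleIntegral v ρ :=
  orbitIntegral_neg _ _ ρ

theorem cycleIntegral_zero (v : Fin 6 → ℝ) : cycleIntegral v 0 = 0 := by
  simp [cycleIntegral, orbitIntegral]

theorem card_zeros_le_of_iteratedDeriv_ne_zero {f : ℝ → ℝ} (hf : ContDiff ℝ ∞ f) {R : ℝ} {n : ℕ}
    (hn : ∀ x ∈ Set.Icc (-R) R, iteratedDeriv n f x ≠ 0) (s : Finset ℝ)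
    (hs : ∀ x ∈ s, x ∈ Set.Icc (-R) R ∧ f x = 0) : s.card ≤ n := by
  by_contra hlt
  rw [not_le] at hlt
  obtain ⟨x, hx, h0⟩ := exists_zero_of_card_zeros n (fun i => iteratedDeriv i f)
    (fun i _ x _ => by
      have hd : Differentiable ℝ (iteratedDeriv i f) :=
        hf.differentiable_iteratedDeriv i (by exact_mod_cast ENat.natCast_lt_top i)
      simp only [iteratedDeriv_succ]
      exact (hd x).hasDerivAt) s (by simpa using hs) hlt
  exact hn x hx h0

theorem card_union_image_neg {s : Finset ℝ} (hs : ∀ x ∈ s, 0 < x) :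
    (s ∪ s.image Neg.neg).card = 2 * s.card := by
  rw [Finset.card_union_of_disjoint, Finset.card_image_of_injective _ neg_injective, two_mul]
  rw [Finset.disjoint_left]
  intro x hx hx'
  obtain ⟨y, hy, rfl⟩ := Finset.mem_image.1 hx'
  linarith [hs _ hx, hs y hy]

/-- Bound for the positive zeros of an even function vanishing at the origin. -/
theorem card_pos_zeros_le {f : ℝ → ℝ} (hf : ContDiff ℝ ∞ f) (heven : ∀ x, f (-x) = f x)
    (h0 : f 0 = 0) {R : ℝ} {n : ℕ} (hR : 0 ≤ R)
    (hn : ∀ x ∈ Set.Icc (-R) R, iteratedDeriv (2 * n + 2) f x ≠ 0) (s : Finset ℝ)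
    (hs : ∀ x ∈ s, 0 < x ∧ x ≤ R ∧ f x = 0) : s.card ≤ n := by
  have hnot : (0 : ℝ) ∉ s ∪ s.image Neg.neg := by
    rw [Finset.mem_union, Finset.mem_image]
    rintro (h | ⟨y, hy, h⟩)
    · exact lt_irrefl _ (hs _ h).1
    · have := (hs y hy).1
      linarith
  have h := card_zeros_le_of_iteratedDeriv_ne_zero hf hn (insert 0 (s ∪ s.image Neg.neg))
    (fun x hx => by
      rw [Finset.mem_insert, Finset.mem_union, Finset.mem_image] at hx
      rcases hx with rfl | hx | ⟨y, hy, rfl⟩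
      · exact ⟨⟨by linarith, hR⟩, h0⟩
      · obtain ⟨a1, a2, a3⟩ := hs x hx
        exact ⟨⟨by linarith, a2⟩, a3⟩
      · obtain ⟨a1, a2, a3⟩ := hs y hy
        exact ⟨⟨by linarith, by linarith⟩, by rw [heven, a3]⟩)
  rw [Finset.card_insert_of_notMem hnot, card_union_image_neg fun x hx => (hs x hx).1] at h
  omega

/-- Zeros in maximal number are simple. -/
theorem sign_change_of_zeros {f : ℝ → ℝ} (hf : ContDiff ℝ ∞ f) (heven : ∀ x, f (-x) = f x)
    (h0 : f 0 = 0) {R h : ℝ} {n : ℕ} (hh : 0 < h) (hR : (n + 1) * h ≤ R)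
    (hn : ∀ x ∈ Set.Icc (-R) R, iteratedDeriv (2 * n + 2) f x ≠ 0)
    (hz : ∀ i < n, f ((i + 1) * h) = 0) {i : ℕ} (hi : i < n) :
    f ((i + 1 / 2) * h) * f (((i + 1 : ℕ) + 1 / 2) * h) < 0 := by
  have hR0 : 0 ≤ R := le_trans (by positivity) hR
  let ζ : ℕ → ℝ := fun k => (k + 1) * h
  have hζinj : Function.Injective ζ := fun k l hkl => by
    have := mul_right_cancel₀ hh.ne' hkl
    exact_mod_cast add_right_cancel this
  have hζle : ∀ k < n, ζ k ≤ R := fun k hk => by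
    refine le_trans ?_ hR
    have : (k : ℝ) < n := by exact_mod_cast hk
    simp only [ζ]
    gcongr
  -- Another zero between the grid points would exceed the maximal number n of positive zeros.
  have hgap : ∀ k ≤ n, ∀ z, k * h < z → z < (k + 1) * h → f z ≠ 0 := by
    intro k hk z hz1 hz2 hfz
    have hzR : z ≤ R := by
      refine hz2.le.trans (le_trans ?_ hR)
      have : (k : ℝ) ≤ n := by exact_mod_cast hk
      gcongr
    have hnot : z ∉ (Finset.range n).image ζ := fun hmem => by
      obtain ⟨l, -, rfl⟩ := Finset.mem_image.1 hmem
      have e1 := lt_of_mul_lt_mul_right hz1 hh.le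
      have e2 := lt_of_mul_lt_mul_right hz2 hh.le
      have e3 : k < l + 1 := by exact_mod_cast e1
      have e4 : l + 1 < k + 1 := by exact_mod_cast e2
      omega
    have := card_pos_zeros_le hf heven h0 hR0 hn (insert z ((Finset.range n).image ζ))
      (fun x hx => by
        rcases Finset.mem_insert.1 hx with rfl | hx
        · exact ⟨lt_of_le_of_lt (by positivity) hz1, hzR, hfz⟩
        · obtain ⟨l, hl, rfl⟩ := Finset.mem_image.1 hx
          rw [Finset.mem_range] at hl
          exact ⟨by simp only [ζ]; positivity, hζle l hl, hz l hl⟩)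
    rw [Finset.card_insert_of_notMem hnot, Finset.card_image_of_injective _ hζinj,
      Finset.card_range] at this
    omega
  have hcont := hf.continuous
  have hsame : ∀ k ≤ n, ∀ z, k * h < z → z < (k + 1) * h → 0 ≤ f z * f ((k + 1 / 2) * h) := by
    intro k hk z hz1 hz2
    by_contra hneg
    rw [not_le] at hneg
    have hs1 : k * h < (k + 1 / 2) * h := by nlinarith
    have hs2 : (k + 1 / 2) * h < (k + 1) * h := by nlinarith
    have hmem : (0 : ℝ) ∈ Set.uIcc (f z) (f ((k + 1 / 2) * h)) := by
      rw [Set.mem_uIcc]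
      rcases mul_neg_iff.1 hneg with ⟨p, q⟩ | ⟨p, q⟩
      · exact Or.inr ⟨q.le, p.le⟩
      · exact Or.inl ⟨p.le, q.le⟩
    obtain ⟨c, hc, hfc⟩ := intermediate_value_uIcc hcont.continuousOn hmem
    rw [Set.mem_uIcc] at hc
    refine hgap k hk c ?_ ?_ hfc
    · rcases hc with hc | hc <;> linarith [hc.1]
    · rcases hc with hc | hc <;> linarith [hc.2]
  have hs1 : ∀ k : ℕ, (k : ℝ) * h < (k + 1 / 2) * h := fun k => by nlinarith
  have hs2 : ∀ k : ℕ, ((k : ℝ) + 1 / 2) * h < (k + 1) * h := fun k => by nlinarith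
  by_contra hnn
  rw [not_lt] at hnn
  have hne1 := hgap i hi.le _ (hs1 i) (hs2 i)
  have hne2 := hgap (i + 1) hi _ (hs1 (i + 1)) (hs2 (i + 1))
  set p := f ((i + 1 / 2) * h)
  set q := f (((i + 1 : ℕ) + 1 / 2) * h)
  have hpq : 0 < p * q := lt_of_le_of_ne hnn (mul_ne_zero hne1 hne2).symm
  -- Without a sign change f keeps the sign of p on both sides of the zero, so the derivative
  -- vanishes there.
  have hmin : IsLocalMin (fun x => f x * p) (ζ i) := by
    have hnb : Set.Ioo ((i : ℝ) * h) ((i + 1 + 1) * h) ∈ 𝓝 (ζ i) :=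
      Ioo_mem_nhds (by simp only [ζ]; nlinarith) (by simp only [ζ]; nlinarith)
    filter_upwards [hnb] with z hz'
    rw [hz i hi, zero_mul]
    rcases lt_trichotomy z (ζ i) with hlt | heq | hgt
    · exact hsame i hi.le z hz'.1 hlt
    · rw [heq, hz i hi, zero_mul]
    · have := hsame (i + 1) hi z (by push_cast; exact hgt) (by push_cast; exact hz'.2)
      have e : 0 ≤ (f z * p) * (q * q) := by
        calc 0 ≤ (f z * q) * (p * q) := mul_nonneg this hpq.le
          _ = _ := by ring
      exact nonneg_of_mul_nonneg_left e (mul_self_pos.2 hne2)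
  have hdiff : Differentiable ℝ f := hf.differentiable (by simp)
  have hd0 : deriv f (ζ i) = 0 := by
    have h1 := hmin.deriv_eq_zero
    rw [deriv_mul_const (hdiff _)] at h1
    exact (mul_eq_zero.1 h1).resolve_right hne1
  have hodd : ∀ x, deriv f (-x) = -deriv f x := fun x => by
    have h1 : deriv (fun x => f (-x)) x = -deriv f (-x) := deriv_comp_neg f x
    rw [funext heven] at h1
    linarith
  -- Rolle between consecutive zeros, starting with the zero at the origin.
  have hrolle : ∀ k < n, ∃ ξ ∈ Set.Ioo ((k : ℝ) * h) ((k + 1) * h), deriv f ξ = 0 := by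
    intro k hk
    refine exists_deriv_eq_zero (by nlinarith) hcont.continuousOn ?_
    rw [hz k hk]
    rcases k with _ | k
    · simpa using h0
    · have := hz k (by omega)
      push_cast
      exact this
  choose! ξ hξ hξ0 using hrolle
  have hfl : ∀ k < n, ∀ l < n, ξ k = ξ l → k = l := by
    intro k hk l hl heq
    have a := hξ k hk
    have b := hξ l hl
    rw [heq] at a
    have e1 := lt_of_mul_lt_mul_right (a.1.trans b.2) hh.le
    have e2 := lt_of_mul_lt_mul_right (b.1.trans a.2) hh.le
    have e3 : k < l + 1 := by exact_mod_cast e1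
    have e4 : l < k + 1 := by exact_mod_cast e2
    omega
  have hinj : Set.InjOn ξ (Finset.range n : Set ℕ) := fun k hk l hl =>
    hfl k (Finset.mem_range.1 hk) l (Finset.mem_range.1 hl)
  have hnot : ζ i ∉ (Finset.range n).image ξ := fun hmem => by
    obtain ⟨l, hl, heq⟩ := Finset.mem_image.1 hmem
    have b := hξ l (Finset.mem_range.1 hl)
    rw [heq] at b
    have e1 := lt_of_mul_lt_mul_right b.1 hh.le
    have e2 := lt_of_mul_lt_mul_right b.2 hh.le
    have e3 : l < i + 1 := by exact_mod_cast e1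
    have e4 : i + 1 < l + 1 := by exact_mod_cast e2
    omega
  let s := insert (ζ i) ((Finset.range n).image ξ)
  have hspos : ∀ x ∈ s, 0 < x ∧ x ≤ R ∧ deriv f x = 0 := fun x hx => by
    rcases Finset.mem_insert.1 hx with rfl | hx
    · exact ⟨by simp only [ζ]; positivity, hζle i hi, hd0⟩
    · obtain ⟨l, hl, rfl⟩ := Finset.mem_image.1 hx
      rw [Finset.mem_range] at hl
      exact ⟨lt_of_le_of_lt (by positivity) (hξ l hl).1, (hξ l hl).2.le.trans (hζle l hl),
        hξ0 l hl⟩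
  have hdsm : ContDiff ℝ ∞ (deriv f) := (contDiff_infty_iff_deriv.1 hf).2
  -- The odd function f' would have n + 1 positive zeros, hence 2n + 2 in all, whereas its
  -- derivative of order 2n + 1 allows only 2n + 1.
  have hcount := card_zeros_le_of_iteratedDeriv_ne_zero (f := deriv f) hdsm
    (R := R) (n := 2 * n + 1) (fun x hx => by
      rw [← iteratedDeriv_succ']
      exact hn x hx) (s ∪ s.image Neg.neg) (fun x hx => by
      rw [Finset.mem_union, Finset.mem_image] at hx
      rcases hx with hx | ⟨y, hy, rfl⟩
      · obtain ⟨a1, a2, a3⟩ := hspos x hx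
        exact ⟨⟨by linarith, a2⟩, a3⟩
      · obtain ⟨a1, a2, a3⟩ := hspos y hy
        exact ⟨⟨by linarith, by linarith⟩, by rw [hodd, a3, neg_zero]⟩)
  rw [card_union_image_neg fun x hx => (hspos x hx).1, Finset.card_insert_of_notMem hnot,
    Finset.card_image_of_injOn hinj, Finset.card_range] at hcount
  omega

end SignChanges

/-! ### Relative cohomology of one-forms along the unperturbed orbits. -/

section Cohomology

theorem integral_eq_zero_of_odd_reflection {f : ℝ → ℝ} (h : ∀ θ, f (2 * Real.pi - θ) = -f θ) :
    ∫ θ in (0 : ℝ)..2 * Real.pi, f θ = 0 := by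
  have h1 := intervalIntegral.integral_comp_sub_left (a := 0) (b := 2 * Real.pi) f (2 * Real.pi)
  simp only [h, intervalIntegral.integral_neg, sub_self, sub_zero] at h1
  linarith

/-- One-forms which differ by an exact form, a multiple of the differential of the Hamiltonian
and a form even with respect to `y` have the same integrals along the unperturbed orbits. -/
theorem orbitIntegral_eq_of_cohomologous {η₁ η₂ p e₁ e₂ r F : ℝ → ℝ → ℝ}
    (hη₁ : Continuous fun z : ℝ × ℝ => η₁ z.1 z.2) (hη₂ : Continuous fun z : ℝ × ℝ => η₂ z.1 z.2)
    (hp : Continuous fun z : ℝ × ℝ => p z.1 z.2)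
    (he₁ : Continuous fun z : ℝ × ℝ => e₁ z.1 z.2) (he₂ : Continuous fun z : ℝ × ℝ => e₂ z.1 z.2)
    (hr : Continuous fun z : ℝ × ℝ => r z.1 z.2)
    (heven : ∀ x y, e₁ x (-y) = e₁ x y) (hodd : ∀ x y, e₂ x (-y) = -e₂ x y)
    (hF : ∀ (x y : ℝ → ℝ) (x' y' t : ℝ), HasDerivAt x x' t → HasDerivAt y y' t →
      HasDerivAt (fun s => F (x s) (y s))
        ((η₁ (x t) (y t) - p (x t) (y t) - e₁ (x t) (y t) - r (x t) (y t) * (x t ^ 3 - x t)) * x' +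
          (η₂ (x t) (y t) - e₂ (x t) (y t) - r (x t) (y t) * y t) * y') t)
    {ρ : ℝ} (hρ : |ρ| < 1 / 2) :
    orbitIntegral η₁ η₂ ρ = orbitIntegral p (fun _ _ => 0) ρ := by
  let X : ℝ → ℝ := fun θ => abscissa (ρ * Real.cos θ)
  let Y : ℝ → ℝ := fun θ => -(ρ * Real.sin θ) / √2
  let X' : ℝ → ℝ := fun θ => -(ρ * Real.sin θ) * (smoothInv (X θ) / 2)
  let Y' : ℝ → ℝ := fun θ => -(ρ * Real.cos θ) / √2
  have hlt : ∀ θ, |ρ * Real.cos θ| < 1 / 2 := fun θ => by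
    rw [abs_mul]
    nlinarith [abs_nonneg ρ, abs_nonneg (Real.cos θ), Real.abs_cos_le_one θ]
  have hu : ∀ θ, |ρ * Real.cos θ| ≤ 1 / 2 := fun θ => (hlt θ).le
  have hX : ∀ θ, HasDerivAt X (X' θ) θ := fun θ => by
    have h1 := (hasDerivAt_abscissa (hlt θ)).comp θ ((Real.hasDerivAt_cos θ).const_mul ρ)
    refine h1.congr_deriv ?_
    simp only [X', X, smoothInv_eq (half_le_abscissa (hu θ)) (abscissa_le (hu θ))]
    have := half_le_abscissa (hu θ)
    field_simp
  have hY : ∀ θ, HasDerivAt Y (Y' θ) θ := fun θ =>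
    (((Real.hasDerivAt_sin θ).const_mul ρ).neg.div_const _)
  -- The differential of the Hamiltonian vanishes along an unperturbed orbit.
  have hH : ∀ θ, (X θ ^ 3 - X θ) * X' θ + Y θ * Y' θ = 0 := fun θ => by
    have h1 := half_le_abscissa (hu θ)
    have h2 := abscissa_sq (hu θ)
    have h3 : √2 * √2 = (2 : ℝ) := Real.mul_self_sqrt (by norm_num)
    simp only [X', Y', Y, X, smoothInv_eq (half_le_abscissa (hu θ)) (abscissa_le (hu θ))]
    set a := abscissa (ρ * Real.cos θ)
    have h4 : a ^ 3 - a = a * (ρ * Real.cos θ) := by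
      rw [show a ^ 3 - a = a * (a ^ 2 - 1) by ring, h2]; ring
    rw [h4]
    field_simp
    rw [show √2 ^ 2 = 2 by rw [sq, h3]]
    ring
  have hXc : Continuous X := continuous_iff_continuousAt.2 fun θ => (hX θ).continuousAt
  have hYc : Continuous Y := continuous_iff_continuousAt.2 fun θ => (hY θ).continuousAt
  have hX'c : Continuous X' :=
    (by fun_prop : Continuous fun θ => -(ρ * Real.sin θ)).mul
      ((contDiff_smoothInv.continuous.comp hXc).div_const 2)
  have hY'c : Continuous Y' := by fun_prop
  have hXY : Continuous fun θ => (X θ, Y θ) := hXc.prodMk hYc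
  have cη₁ : Continuous fun θ => η₁ (X θ) (Y θ) := hη₁.comp hXY
  have cη₂ : Continuous fun θ => η₂ (X θ) (Y θ) := hη₂.comp hXY
  have cp : Continuous fun θ => p (X θ) (Y θ) := hp.comp hXY
  have ce₁ : Continuous fun θ => e₁ (X θ) (Y θ) := he₁.comp hXY
  have ce₂ : Continuous fun θ => e₂ (X θ) (Y θ) := he₂.comp hXY
  have cr : Continuous fun θ => r (X θ) (Y θ) := hr.comp hXY
  have hexact := intervalIntegral.integral_eq_sub_of_hasDerivAt (a := 0) (b := 2 * Real.pi)
    (fun θ _ => hF X Y _ _ θ (hX θ) (hY θ))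
    (Continuous.intervalIntegrable (by fun_prop) _ _)
  have hX0 : X (2 * Real.pi) = X 0 := by simp [X]
  have hY0 : Y (2 * Real.pi) = Y 0 := by simp [Y]
  rw [hX0, hY0, sub_self] at hexact
  -- Reflection in the x-axis preserves the even form but reverses the orientation of the orbit.
  have hpar : ∫ θ in (0 : ℝ)..2 * Real.pi, (e₁ (X θ) (Y θ) * X' θ + e₂ (X θ) (Y θ) * Y' θ) = 0 := by
    refine integral_eq_zero_of_odd_reflection fun θ => ?_
    have x1 : X (2 * Real.pi - θ) = X θ := by simp [X]
    have x2 : X' (2 * Real.pi - θ) = -X' θ := by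
      simp only [X', x1, Real.sin_two_pi_sub]; ring
    have y1 : Y (2 * Real.pi - θ) = -Y θ := by
      simp only [Y, Real.sin_two_pi_sub]; ring
    have y2 : Y' (2 * Real.pi - θ) = Y' θ := by simp [Y']
    rw [x1, x2, y1, y2, heven, hodd]
    ring
  have hsum : orbitIntegral η₁ η₂ ρ - orbitIntegral p (fun _ _ => 0) ρ =
      (∫ θ in (0 : ℝ)..2 * Real.pi, ((η₁ (X θ) (Y θ) - p (X θ) (Y θ) - e₁ (X θ) (Y θ) -
        r (X θ) (Y θ) * (X θ ^ 3 - X θ)) * X' θ +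
        (η₂ (X θ) (Y θ) - e₂ (X θ) (Y θ) - r (X θ) (Y θ) * Y θ) * Y' θ)) +
      ∫ θ in (0 : ℝ)..2 * Real.pi, (e₁ (X θ) (Y θ) * X' θ + e₂ (X θ) (Y θ) * Y' θ) := by
    simp only [orbitIntegral]
    rw [← intervalIntegral.integral_sub, ← intervalIntegral.integral_add]
    · congr 1
      funext θ
      have := hH θ
      show η₁ (X θ) (Y θ) * X' θ + η₂ (X θ) (Y θ) * Y' θ -
        (p (X θ) (Y θ) * X' θ + 0 * Y' θ) = _
      linear_combination r (X θ) (Y θ) * this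
    · exact Continuous.intervalIntegrable (by fun_prop) _ _
    · exact Continuous.intervalIntegrable (by fun_prop) _ _
    · exact (orbitIntegral_integrand_continuous hη₁ hη₂ ρ).intervalIntegrable _ _
    · exact (orbitIntegral_integrand_continuous (η₂ := fun _ _ => 0) hp continuous_const
        ρ).intervalIntegrable _ _
  rw [hexact, hpar] at hsum
  linarith

end Cohomology

/-! ### Limit cycles in terms of the Melnikov vector. -/

section MelnikovVector

/-- The first nonvanishing Melnikov function of the perturbation at `(1, 0)` is the integral of
`p dx` along the unperturbed orbits. -/
def HasMelnikovForm (a b : ℕ → ℕ → ℝ) (p : ℝ → ℝ → ℝ) : Prop :=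
  ∃ (k : ℕ) (W μ η₁ η₂ : ℝ → ℝ → ℝ → ℝ), k ≠ 0 ∧ Reduction a b k W μ η₁ η₂ ∧
    ∀ ρ, |ρ| < 1 / 2 → orbitIntegral (η₁ 0) (η₂ 0) ρ = orbitIntegral p (fun _ _ => 0) ρ

/-- The first nonvanishing Melnikov function of the perturbation at `(1, 0)` is the cycle integral
with coefficients `v`. -/
def HasMelnikovVector (a b : ℕ → ℕ → ℝ) (v : Fin 6 → ℝ) : Prop := HasMelnikovForm a b (oddForm v)

variable {a b : ℕ → ℕ → ℝ} {v : Fin 6 → ℝ}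

theorem iteratedDeriv_eq_of_eq_of_abs_lt {f g : ℝ → ℝ} (h : ∀ ρ, |ρ| < 1 / 2 → f ρ = g ρ) (n : ℕ)
    {ρ : ℝ} (hρ : |ρ| < 1 / 2) : iteratedDeriv n f ρ = iteratedDeriv n g ρ := by
  refine Filter.EventuallyEq.iteratedDeriv_eq n ?_
  filter_upwards [(isOpen_lt continuous_abs continuous_const).mem_nhds hρ] with x hx
  exact h x hx

theorem HasMelnikovVector.eventually_numLimitCycles_le (h : HasMelnikovVector a b v) {R : ℝ}
    (hR : R ≤ 1 / 8) {j : ℕ}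
    (hj : ∀ ρ ∈ Set.Icc (-R) R, iteratedDeriv (2 * j + 2) (cycleIntegral v) ρ ≠ 0) {r : ℝ}
    (hr0 : 0 < r) (hr : 8 * r ≤ R) :
    ∀ᶠ ε in 𝓝[≠] (0 : ℝ), numLimitCycles (perturbedField a b ε) (1, 0) r ≤ j := by
  obtain ⟨k, W, μ, η₁, η₂, -, hW, he⟩ := h
  refine _root_.eventually_numLimitCycles_le hW hR (fun ρ hρ => ?_) hr0 hr
  rw [iteratedDeriv_eq_of_eq_of_abs_lt he _ ((abs_le.2 hρ).trans_lt (by linarith))]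
  exact hj ρ hρ

theorem HasMelnikovVector.eventually_le_numLimitCycles (h : HasMelnikovVector a b v) {R : ℝ}
    (hR : R ≤ 1 / 8) {j : ℕ}
    (hj : ∀ ρ ∈ Set.Icc (-R) R, iteratedDeriv (2 * j + 2) (cycleIntegral v) ρ ≠ 0)
    {m : ℕ} {s : ℕ → ℝ} (hs0 : 0 < s 0) (hs : StrictMono s) (hsR : s m < R) {r : ℝ}
    (hr : r ≤ 1 / 2) (hsr : s m < r)
    (hsign : ∀ i < m, cycleIntegral v (s i) * cycleIntegral v (s (i + 1)) < 0) :
    ∀ᶠ ε in 𝓝[≠] (0 : ℝ), (m : ℕ∞) ≤ numLimitCycles (perturbedField a b ε) (1, 0) r := by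
  obtain ⟨k, W, μ, η₁, η₂, hk, hW, he⟩ := h
  have hlt : ∀ i ≤ m, |s i| < 1 / 2 := fun i hi => by
    rw [abs_of_pos (hs0.trans_le (hs.monotone (Nat.zero_le i)))]
    linarith [hs.monotone hi]
  refine _root_.eventually_le_numLimitCycles hk hW hR (j := j) (fun ρ hρ => ?_) hs0 hs hsR hr hsr
    fun i hi => ?_
  · rw [iteratedDeriv_eq_of_eq_of_abs_lt he _ ((abs_le.2 hρ).trans_lt (by linarith))]
    exact hj ρ hρ
  · rw [he _ (hlt i hi.le), he _ (hlt (i + 1) hi)]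
    exact hsign i hi

end MelnikovVector

/-! ### Melnikov functions of order one and two. -/

section Reductions

theorem cubicPoly_eq (c : ℕ → ℕ → ℝ) (x y : ℝ) :
    cubicPoly c x y = c 0 0 + c 0 1 * y + c 0 2 * y ^ 2 + c 0 3 * y ^ 3 + c 1 0 * x +
      c 1 1 * x * y + c 1 2 * x * y ^ 2 + c 2 0 * x ^ 2 + c 2 1 * x ^ 2 * y + c 3 0 * x ^ 3 := by
  simp [cubicPoly, Finset.sum_range_succ]
  ring

theorem exists_primitive {f : ℝ → ℝ} (hf : ContDiff ℝ ∞ f) :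
    ∃ G : ℝ → ℝ, ContDiff ℝ ∞ G ∧ ∀ x, HasDerivAt G (f x) x := by
  have h : ∀ x, HasDerivAt (fun x => ∫ t in (0 : ℝ)..x, f t) (f x) x := fun x =>
    hf.continuous.integral_hasStrictDerivAt 0 x |>.hasDerivAt
  refine ⟨_, contDiff_infty_iff_deriv.2 ⟨fun x => (h x).differentiableAt, ?_⟩, h⟩
  rw [show deriv (fun x => ∫ t in (0 : ℝ)..x, f t) = f from funext fun x => (h x).deriv]
  exact hf

theorem hasDerivAt_eightLoop {x y : ℝ → ℝ} {x' y' t : ℝ} (hx : HasDerivAt x x' t)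
    (hy : HasDerivAt y y' t) :
    HasDerivAt (fun s => eightLoop (x s) (y s)) ((x t ^ 3 - x t) * x' + y t * y') t := by
  refine ((((hy.pow 2).div_const 2).sub ((hx.pow 2).div_const 2)).add
    ((hx.pow 4).div_const 4)).congr_deriv ?_
  norm_num
  ring

variable {a b : ℕ → ℕ → ℝ}

theorem HasMelnikovForm.congr {p p' F r : ℝ → ℝ → ℝ} (h : HasMelnikovForm a b p)
    (hp : Continuous fun z : ℝ × ℝ => p z.1 z.2) (hp' : Continuous fun z : ℝ × ℝ => p' z.1 z.2)
    (hr : Continuous fun z : ℝ × ℝ => r z.1 z.2)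
    (hF : ∀ (x y : ℝ → ℝ) (x' y' t : ℝ), HasDerivAt x x' t → HasDerivAt y y' t →
      HasDerivAt (fun s => F (x s) (y s))
        ((p (x t) (y t) - p' (x t) (y t) - r (x t) (y t) * (x t ^ 3 - x t)) * x' +
          (-(r (x t) (y t) * y t)) * y') t) : HasMelnikovForm a b p' := by
  obtain ⟨k, W, μ, η₁, η₂, hk, hW, he⟩ := h
  refine ⟨k, W, μ, η₁, η₂, hk, hW, fun ρ hρ => (he ρ hρ).trans ?_⟩
  refine orbitIntegral_eq_of_cohomologous (e₁ := fun _ _ => 0) (e₂ := fun _ _ => 0) (r := r) (F := F)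
    hp continuous_const hp' continuous_const continuous_const hr (fun _ _ => rfl)
    (fun _ _ => by simp) (fun x y x' y' t hx hy => ?_) hρ
  exact (hF x y x' y' t hx hy).congr_deriv (by ring)

/-- The form η is split by parity in y. Its even part integrates to zero, so only the remaining part
must match p dx modulo exact forms and multiples of dH. -/
theorem HasMelnikovForm.of_reduction {k : ℕ} {W μ η₁ η₂ : ℝ → ℝ → ℝ → ℝ} {p F r : ℝ → ℝ → ℝ}
    (hk : k ≠ 0) (hW : Reduction a b k W μ η₁ η₂) (hp : Continuous fun z : ℝ × ℝ => p z.1 z.2)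
    (hr : Continuous fun z : ℝ × ℝ => r z.1 z.2)
    (hF : ∀ (x y : ℝ → ℝ) (x' y' t : ℝ), HasDerivAt x x' t → HasDerivAt y y' t →
      HasDerivAt (fun s => F (x s) (y s))
        (((η₁ 0 (x t) (y t) - η₁ 0 (x t) (-y t)) / 2 - p (x t) (y t) -
          r (x t) (y t) * (x t ^ 3 - x t)) * x' +
          ((η₂ 0 (x t) (y t) + η₂ 0 (x t) (-y t)) / 2 - r (x t) (y t) * y t) * y') t) :
    HasMelnikovForm a b p := by
  refine ⟨k, W, μ, η₁, η₂, hk, hW, fun ρ hρ => ?_⟩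
  have h₁ := hW.smooth₁.continuous
  have h₂ := hW.smooth₂.continuous
  have g₁ : Continuous fun z : ℝ × ℝ => η₁ 0 z.1 z.2 :=
    h₁.comp (by fun_prop : Continuous fun z : ℝ × ℝ => ((0 : ℝ), z.1, z.2))
  have g₂ : Continuous fun z : ℝ × ℝ => η₂ 0 z.1 z.2 :=
    h₂.comp (by fun_prop : Continuous fun z : ℝ × ℝ => ((0 : ℝ), z.1, z.2))
  have k₁ : Continuous fun z : ℝ × ℝ => η₁ 0 z.1 (-z.2) :=
    h₁.comp (by fun_prop : Continuous fun z : ℝ × ℝ => ((0 : ℝ), z.1, -z.2))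
  have k₂ : Continuous fun z : ℝ × ℝ => η₂ 0 z.1 (-z.2) :=
    h₂.comp (by fun_prop : Continuous fun z : ℝ × ℝ => ((0 : ℝ), z.1, -z.2))
  refine orbitIntegral_eq_of_cohomologous (e₁ := fun x y => (η₁ 0 x y + η₁ 0 x (-y)) / 2)
    (e₂ := fun x y => (η₂ 0 x y - η₂ 0 x (-y)) / 2) (r := r) (F := F) g₁ g₂ hp
    ((g₁.add k₁).div_const 2) ((g₂.sub k₂).div_const 2) hr (fun x y => by rw [neg_neg, add_comm])
    (fun x y => by rw [neg_neg]; ring) (fun x y x' y' t hx hy => ?_) hρ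
  exact (hF x y x' y' t hx hy).congr_deriv (by ring)

/-- A primitive of the exact part of the perturbation. -/
noncomputable def potential (a b : ℕ → ℕ → ℝ) (x y : ℝ) : ℝ :=
  b 0 0 * x + b 1 0 * x ^ 2 / 2 + b 2 0 * x ^ 3 / 3 + b 3 0 * x ^ 4 / 4 -
    (a 0 0 * y + a 1 0 * x * y + a 2 0 * x ^ 2 * y + a 3 0 * x ^ 3 * y + a 0 1 * y ^ 2 / 2 +
      a 1 1 * x * y ^ 2 / 2 + a 2 1 * x ^ 2 * y ^ 2 / 2 + a 0 2 * y ^ 3 / 3 +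
      a 1 2 * x * y ^ 3 / 3 + a 0 3 * y ^ 4 / 4)

/-- The coefficients of the first order Melnikov function. -/
noncomputable def firstVector (a b : ℕ → ℕ → ℝ) : Fin 6 → ℝ :=
  ![a 1 0 + b 0 1, 3 * a 3 0 + b 2 1, a 1 2 / 3 + b 0 3, 0, 2 * a 2 0 + b 1 1, 0]

noncomputable def evenCoeff₀ (a b : ℕ → ℕ → ℝ) : ℝ := (a 1 1 + 2 * b 0 2) / 2

noncomputable def evenCoeff₁ (a b : ℕ → ℕ → ℝ) : ℝ := a 2 1 + b 1 2

theorem hasDerivAt_potential (a b : ℕ → ℕ → ℝ) {x y : ℝ → ℝ} {x' y' t : ℝ}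
    (hx : HasDerivAt x x' t) (hy : HasDerivAt y y' t) :
    HasDerivAt (fun s => potential a b (x s) (y s))
      ((cubicPoly b (x t) (y t) - oddForm (firstVector a b) (x t) (y t) -
        (evenCoeff₀ a b + evenCoeff₁ a b * x t) * y t ^ 2) * x' - cubicPoly a (x t) (y t) * y') t := by
  have h1 := ((((hx.const_mul (b 0 0)).add (((hx.pow 2).const_mul (b 1 0)).div_const 2)).add
    (((hx.pow 3).const_mul (b 2 0)).div_const 3)).add (((hx.pow 4).const_mul (b 3 0)).div_const 4))
  have h2 := ((((((((((hy.const_mul (a 0 0)).add ((hx.const_mul (a 1 0)).mul hy)).add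
    (((hx.pow 2).const_mul (a 2 0)).mul hy)).add (((hx.pow 3).const_mul (a 3 0)).mul hy)).add
    (((hy.pow 2).const_mul (a 0 1)).div_const 2)).add
    (((hx.const_mul (a 1 1)).mul (hy.pow 2)).div_const 2)).add
    ((((hx.pow 2).const_mul (a 2 1)).mul (hy.pow 2)).div_const 2)).add
    (((hy.pow 3).const_mul (a 0 2)).div_const 3)).add
    (((hx.const_mul (a 1 2)).mul (hy.pow 3)).div_const 3)).add
    (((hy.pow 4).const_mul (a 0 3)).div_const 4))
  refine (h1.sub h2).congr_deriv ?_
  rw [cubicPoly_eq, cubicPoly_eq]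
  simp [oddForm, firstVector, evenCoeff₀, evenCoeff₁]
  ring

/-- With Q = `potential`, the perturbation form is dQ plus an odd form plus (α + βx) y² dx. Hence W
= H − εQ works with μ = 1, and the y² term is even. -/
theorem hasMelnikovForm_first (a b : ℕ → ℕ → ℝ) :
    HasMelnikovForm a b (oddForm (firstVector a b)) := by
  refine .of_reduction (k := 1) (W := fun ε x y => eightLoop x y - ε * potential a b x y)
    (μ := fun _ _ _ => 1) (η₁ := fun _ x y => oddForm (firstVector a b) x y +
      (evenCoeff₀ a b + evenCoeff₁ a b * x) * y ^ 2) (η₂ := fun _ _ _ => 0) (F := fun _ _ => 0)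
    (r := fun _ _ => 0) one_ne_zero ⟨continuous_const, fun _ _ => rfl, ?_, contDiff_const, ?_⟩
    (continuous_oddForm _) continuous_const ?_
  · unfold oddForm; fun_prop
  · intro ε x y x' y' t hx hy
    refine ((hasDerivAt_eightLoop hx hy).sub ((hasDerivAt_potential a b hx hy).const_mul ε)).congr_deriv ?_
    simp only [perturbedField]
    ring
  · intro x y x' y' t _ _
    refine (hasDerivAt_const t (0 : ℝ)).congr_deriv ?_
    simp only [oddForm]
    ring

/-- The coefficients of the second order Melnikov function. -/
noncomputable def secondVector (a b : ℕ → ℕ → ℝ) : Fin 6 → ℝ :=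
  ![-2 * (evenCoeff₀ a b * a 0 0),
    -2 * (evenCoeff₀ a b * a 2 0 + evenCoeff₁ a b * (a 1 0 + a 3 0)),
    -2 / 3 * (evenCoeff₀ a b * a 0 2 + evenCoeff₁ a b * a 3 0),
    -2 / 3 * (evenCoeff₁ a b * a 1 2),
    -2 * (evenCoeff₀ a b * (a 1 0 + a 3 0) + evenCoeff₁ a b * (a 0 0 + a 2 0)),
    -2 / 3 * (evenCoeff₀ a b * a 1 2 + evenCoeff₁ a b * a 0 2)]

/-- Write A' = α + βx. Since y² = 2H + x² − x⁴/2, the form A'y² dx equals d(2HA + B) − 2A dH, so the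
factor 1 − 2εA removes it at first order and leaves 2A'(Q − Ay²) dx at second order. The monomials
x³y and x⁴y that occur in it are lowered using y dH = y(x³ − x) dx + y² dy. -/
theorem hasMelnikovForm_second (h : firstVector a b = 0) :
    HasMelnikovForm a b (oddForm (secondVector a b)) := by
  set α := evenCoeff₀ a b with hα
  set β := evenCoeff₁ a b with hβ
  have hodd : ∀ x y, oddForm (firstVector a b) x y = 0 := fun x y => by rw [h]; simp [oddForm]
  have hA : ∀ {x : ℝ → ℝ} {x' t : ℝ}, HasDerivAt x x' t →
      HasDerivAt (fun s => α * x s + β * x s ^ 2 / 2) ((α + β * x t) * x') t := fun hx =>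
    ((hx.const_mul α).add (((hx.pow 2).const_mul β).div_const 2)).congr_deriv (by norm_num; ring)
  have hB : ∀ {x : ℝ → ℝ} {x' t : ℝ}, HasDerivAt x x' t →
      HasDerivAt (fun s => α * x s ^ 3 / 3 - α * x s ^ 5 / 10 + β * x s ^ 4 / 4 - β * x s ^ 6 / 12)
        ((α + β * x t) * (x t ^ 2 - x t ^ 4 / 2) * x') t := fun hx =>
    ((((((hx.pow 3).const_mul α).div_const 3).sub (((hx.pow 5).const_mul α).div_const 10)).add
      (((hx.pow 4).const_mul β).div_const 4)).sub
      (((hx.pow 6).const_mul β).div_const 12)).congr_deriv (by norm_num; ring)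
  refine .of_reduction (k := 2)
    (W := fun ε x y => (eightLoop x y - ε * potential a b x y) *
      (1 - 2 * ε * (α * x + β * x ^ 2 / 2)) -
      ε * (α * x ^ 3 / 3 - α * x ^ 5 / 10 + β * x ^ 4 / 4 - β * x ^ 6 / 12))
    (μ := fun ε x _ => 1 - 2 * ε * (α * x + β * x ^ 2 / 2))
    (η₁ := fun _ x y => 2 * (α + β * x) * (potential a b x y - (α * x + β * x ^ 2 / 2) * y ^ 2))
    (η₂ := fun _ _ _ => 0)
    (F := fun x y => 2 * ((α * a 3 0 + β * a 2 0) * y ^ 3 / 3 + β * a 3 0 * (x * y ^ 3) / 3))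
    (r := fun x y => -2 * ((α * a 3 0 + β * a 2 0) * y + β * a 3 0 * (x * y)))
    two_ne_zero ⟨by fun_prop, fun _ _ => by simp, ?_, contDiff_const, ?_⟩
    (continuous_oddForm _) (by fun_prop) ?_
  · unfold potential; fun_prop
  · intro ε x y x' y' t hx hy
    have h1 := ((((hasDerivAt_eightLoop hx hy).sub ((hasDerivAt_potential a b hx hy).const_mul ε)).mul
      (((hA hx).const_mul (2 * ε)).const_sub 1)).sub ((hB hx).const_mul ε))
    refine h1.congr_deriv ?_
    simp only [perturbedField, hodd, eightLoop, Pi.sub_apply, ← hα, ← hβ]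
    ring
  · intro x y x' y' t hx hy
    refine (((((hy.pow 3).const_mul _).div_const 3).add
      (((hx.mul (hy.pow 3)).const_mul _).div_const 3)).const_mul 2).congr_deriv ?_
    simp [oddForm, secondVector, potential, ← hα, ← hβ]
    ring

end Reductions

/-! ### Melnikov functions of order three and four. -/

section FocusForms

variable {a b : ℕ → ℕ → ℝ}

/-- The perturbations `d(q₀ + q₂ y² + q₄ y⁴ + κ y L) + A' y² dx` with `A' L = x - x³`, for which
the Melnikov functions of order one and two vanish. -/
structure FocusForm (a b : ℕ → ℕ → ℝ) (κ q₄ : ℝ) (A A' L L' q₀ q₀' q₂ q₂' : ℝ → ℝ) : Prop where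
  smooth_A : ContDiff ℝ ∞ A
  smooth_A' : ContDiff ℝ ∞ A'
  smooth_L : ContDiff ℝ ∞ L
  smooth_L' : ContDiff ℝ ∞ L'
  smooth_q₀ : ContDiff ℝ ∞ q₀
  smooth_q₀' : ContDiff ℝ ∞ q₀'
  smooth_q₂ : ContDiff ℝ ∞ q₂
  smooth_q₂' : ContDiff ℝ ∞ q₂'
  deriv_A : ∀ x, HasDerivAt A (A' x) x
  deriv_L : ∀ x, HasDerivAt L (L' x) x
  deriv_q₀ : ∀ x, HasDerivAt q₀ (q₀' x) x
  deriv_q₂ : ∀ x, HasDerivAt q₂ (q₂' x) x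
  mul_eq : ∀ x, A' x * L x = x - x ^ 3
  fst_eq : ∀ x y, cubicPoly a x y = -(2 * q₂ x * y + 4 * q₄ * y ^ 3 + κ * L x)
  snd_eq : ∀ x y, cubicPoly b x y = q₀' x + (q₂' x + A' x) * y ^ 2 + κ * y * L' x

/-- The relation A'L = x − x³ gives 2κA'Ly dx = 2κ(y² dy − y dH). The second order form is therefore
exact modulo dH, and absorbing the multiple of dH into μ pushes the remainder to third order. The
primitives below integrate what appears when y² is replaced by 2H + x² − x⁴/2. -/
theorem FocusForm.hasMelnikovForm {κ q₄ : ℝ} {A A' L L' q₀ q₀' q₂ q₂' : ℝ → ℝ}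
    (h : FocusForm a b κ q₄ A A' L L' q₀ q₀' q₂ q₂') :
    HasMelnikovForm a b fun x y => -2 * κ * (q₀' x * y + (q₂' x + A' x / 3) * y ^ 3) := by
  obtain ⟨hA, hA', hL, hL', hq₀, hq₀', hq₂, hq₂', dA, dL, dq₀, dq₂, hAL, ha, hb⟩ := h
  obtain ⟨B, hB, dB⟩ := exists_primitive (f := fun x => A' x * (x ^ 2 - x ^ 4 / 2)) (by fun_prop)
  obtain ⟨C, hC, dC⟩ := exists_primitive (f := fun x => A x * A' x * (x ^ 2 - x ^ 4 / 2))
    (by fun_prop)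
  obtain ⟨D, hD, dD⟩ := exists_primitive (f := fun x => A' x * (x ^ 2 - x ^ 4 / 2) ^ 2)
    (by fun_prop)
  obtain ⟨T, hT, dT⟩ := exists_primitive
    (f := fun x => A' x * (q₀ x + q₂ x * (x ^ 2 - x ^ 4 / 2))) (by fun_prop)
  obtain ⟨S, hS, dS⟩ := exists_primitive (f := fun x => A' x * q₂ x) (by fun_prop)
  -- Minus the coefficient of dH in the decomposition of the second order form.
  let r : ℝ → ℝ → ℝ := fun x y => 2 * κ * y + 4 * S x +
    q₄ * (16 * A x * eightLoop x y + 8 * B x) - 2 * A x ^ 2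
  have hH : ContDiff ℝ ∞ fun z : ℝ × ℝ => eightLoop z.1 z.2 := by unfold eightLoop; fun_prop
  have hr : ContDiff ℝ ∞ fun z : ℝ × ℝ => r z.1 z.2 := by
    simp only [r, eightLoop]; fun_prop
  have hr3 : ContDiff ℝ ∞ fun z : ℝ × ℝ × ℝ => r z.2.1 z.2.2 := hr.comp contDiff_snd
  have hca := contDiff_cubicPoly a (n := ∞)
  have hcb := contDiff_cubicPoly b (n := ∞)
  refine .of_reduction (k := 3)
    (W := fun ε x y => (eightLoop x y - ε * (q₀ x + q₂ x * y ^ 2 + q₄ * y ^ 4 + κ * (y * L x))) *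
      (1 - 2 * ε * A x) - ε * B x - ε ^ 2 * (2 * T x + 4 * (eightLoop x y * S x) +
        2 * q₄ * (4 * (eightLoop x y ^ 2 * A x) + 4 * (eightLoop x y * B x) + D x) +
        2 / 3 * κ * y ^ 3 - 2 * (eightLoop x y * A x ^ 2) - 2 * C x))
    (μ := fun ε x y => 1 - 2 * ε * A x - ε ^ 2 * r x y)
    (η₁ := fun _ x y => -(r x y * cubicPoly b x y))
    (η₂ := fun _ x y => r x y * cubicPoly a x y)
    (F := fun x y => -(κ * (y * L x * (4 * S x + q₄ * (16 * (A x * eightLoop x y) + 8 * B x) -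
      2 * A x ^ 2)) + 4 / 3 * κ * (A x * y ^ 3)))
    (r := fun x y => κ * y * (4 * A x + 16 * q₄ * A x * L x - 4 * q₂ x - 8 * q₄ * y ^ 2))
    three_ne_zero ⟨?_, fun _ _ => by simp, ?_, ?_, ?_⟩
    ?_ ?_ ?_
  · have := hr3.continuous
    have := hA.continuous
    fun_prop
  · exact (hr3.mul (hcb.comp contDiff_snd)).neg
  · exact hr3.mul (hca.comp contDiff_snd)
  · intro ε x y x' y' t hx hy
    have kA := (dA (x t)).comp t hx
    have kB := (dB (x t)).comp t hx
    have kC := (dC (x t)).comp t hx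
    have kD := (dD (x t)).comp t hx
    have kT := (dT (x t)).comp t hx
    have kS := (dS (x t)).comp t hx
    have kL := (dL (x t)).comp t hx
    have k0 := (dq₀ (x t)).comp t hx
    have k2 := (dq₂ (x t)).comp t hx
    have kH := hasDerivAt_eightLoop hx hy
    have kQ := ((k0.add (k2.mul (hy.pow 2))).add ((hy.pow 4).const_mul q₄)).add
      ((hy.mul kL).const_mul κ)
    have kF := (((((kT.const_mul 2).add ((kH.mul kS).const_mul 4)).add
      (((((((kH.pow 2).mul kA).const_mul 4).add ((kH.mul kB).const_mul 4)).add kD)).const_mul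
        (2 * q₄))).add ((hy.pow 3).const_mul (2 / 3 * κ))).sub
        ((kH.mul (kA.pow 2)).const_mul 2)).sub (kC.const_mul 2)
    have h1 := ((((kH.sub (kQ.const_mul ε)).mul ((kA.const_mul (2 * ε)).const_sub 1)).sub
      (kB.const_mul ε)).sub (kF.const_mul (ε ^ 2)))
    refine h1.congr_deriv ?_
    simp only [perturbedField, ha, hb, eightLoop, Pi.sub_apply, Pi.add_apply, Pi.mul_apply,
      Pi.pow_apply, Function.comp_apply, r]
    push_cast
    linear_combination (2 * ε ^ 2 * κ * y t * x') * hAL (x t)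
  · fun_prop
  · fun_prop
  · intro x y x' y' t hx hy
    have kA := (dA (x t)).comp t hx
    have kB := (dB (x t)).comp t hx
    have kS := (dS (x t)).comp t hx
    have kL := (dL (x t)).comp t hx
    have kH := hasDerivAt_eightLoop hx hy
    have h1 := ((((hy.mul kL).mul (((kS.const_mul 4).add ((((kA.mul kH).const_mul 16).add
      (kB.const_mul 8)).const_mul q₄)).sub ((kA.pow 2).const_mul 2))).const_mul κ).add
      ((kA.mul (hy.pow 3)).const_mul (4 / 3 * κ))).neg
    refine h1.congr_deriv ?_
    simp only [ha, hb, eightLoop, Pi.sub_apply, Pi.add_apply, Pi.mul_apply,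
      Pi.pow_apply, Function.comp_apply, r]
    push_cast
    linear_combination (-(κ * y t * (4 * q₂ (x t) + q₄ * (8 * y t ^ 2) - 4 * A (x t))) * x') *
      hAL (x t)

/-- Under these conditions the perturbation form is 4q dH + ω, so that Ω = (1 − 4εq) dH − εω. Three
successive divisions, ω = dΞ₁ − 2A dH, Aω = dΞ + τ dH and τω = dΞ₂ + τ₂ dH, push the remainder to
−2ε⁴τ₂ω. Powers of 1 − 4εq avoid denominators. -/
theorem FocusForm.hasMelnikovForm_fourth {κ q₄ q : ℝ} {A A' L L' q₀ q₀' q₂ q₂' : ℝ → ℝ}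
    (h : FocusForm a b κ q₄ A A' L L' q₀ q₀' q₂ q₂')
    (h₀' : ∀ x, q₀' x = 4 * q * (x ^ 3 - x)) (h₂ : ∀ x, q₂ x = 2 * q - A x / 3)
    (h₂' : ∀ x, q₂' x = -(A' x / 3)) :
    HasMelnikovForm a b fun x y => -2 * κ ^ 3 * (L x * L' x * y) := by
  obtain ⟨hA, hA', hL, hL', -, -, -, -, dA, dL, -, -, hAL, ha, hb⟩ := h
  simp only [h₀', h₂, h₂'] at ha hb
  obtain ⟨B, hB, dB⟩ := exists_primitive (f := fun x => A' x * (x ^ 2 - x ^ 4 / 2)) (by fun_prop)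
  obtain ⟨C, hC, dC⟩ := exists_primitive (f := fun x => A x * A' x * (x ^ 2 - x ^ 4 / 2))
    (by fun_prop)
  obtain ⟨C₂, hC₂, dC₂⟩ := exists_primitive
    (f := fun x => A x ^ 2 * A' x * (x ^ 2 - x ^ 4 / 2)) (by fun_prop)
  obtain ⟨G, hG, dG⟩ := exists_primitive (f := fun x => A x * A' x * (x ^ 2 - x ^ 4 / 2) ^ 2)
    (by fun_prop)
  obtain ⟨D, hD, dD⟩ := exists_primitive (f := fun x => A' x * (x ^ 2 - x ^ 4 / 2) ^ 2)
    (by fun_prop)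
  obtain ⟨D₂, hD₂, dD₂⟩ := exists_primitive (f := fun x => A' x * (x ^ 2 - x ^ 4 / 2) ^ 3)
    (by fun_prop)
  obtain ⟨K, hK, dK⟩ := exists_primitive (f := fun x => L x * (x - x ^ 3)) (by fun_prop)
  let P : ℝ → ℝ → ℝ := fun x y => -(A x * y ^ 2 / 3) + q₄ * y ^ 4 + κ * (y * L x)
  let ω₁ : ℝ → ℝ → ℝ := fun x y => 2 / 3 * A' x * y ^ 2 + κ * y * L' x
  let ω₂ : ℝ → ℝ → ℝ := fun x y => -(2 / 3 * A x * y) + 4 * q₄ * y ^ 3 + κ * L x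
  let τ : ℝ → ℝ → ℝ := fun x y => -(4 / 3 * A x ^ 2) +
    q₄ * (8 * (A x * eightLoop x y) + 4 * B x) + κ * y
  let τ₂ : ℝ → ℝ → ℝ := fun x y => -(8 * q₄ * (A x * P x y)) - 8 / 3 * κ * (A x * y) +
    4 * q₄ * κ * y ^ 3 - κ ^ 2 * L x + 40 / 27 * A x ^ 3 -
    q₄ * (32 * (eightLoop x y * A x ^ 2) + 16 * C x + 8 * (A x * B x)) +
    4 * q₄ ^ 2 * (24 * (eightLoop x y ^ 2 * A x) + 24 * (eightLoop x y * B x) + 6 * D x)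
  let Ξ₁ : ℝ → ℝ → ℝ := fun x y => P x y + 2 * (A x * eightLoop x y) + B x
  let Ξ : ℝ → ℝ → ℝ := fun x y => -(A x ^ 2 * y ^ 2 / 3) +
    4 / 3 * (A x ^ 2 * eightLoop x y + C x) + q₄ * (A x * y ^ 4) -
    q₄ * (4 * (eightLoop x y ^ 2 * A x) + 4 * (eightLoop x y * B x) + D x) +
    κ * (A x * (y * L x)) - κ * y ^ 3 / 3
  let Ξ₂ : ℝ → ℝ → ℝ := fun x y => τ x y * P x y + κ * (A x * y ^ 3) - κ * q₄ * y ^ 5 -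
    κ ^ 2 * K x - 20 / 9 * (2 * (eightLoop x y * A x ^ 3) / 3 + C₂ x) +
    q₄ * (16 * (eightLoop x y ^ 2 * A x ^ 2) + 24 * (eightLoop x y * C x) + 4 * G x) +
    q₄ * (8 * (eightLoop x y * (A x * B x - C x)) + 2 * B x ^ 2) -
    4 * q₄ ^ 2 * (8 * (eightLoop x y ^ 3 * A x) + 12 * (eightLoop x y ^ 2 * B x) +
      6 * (eightLoop x y * D x) + D₂ x)
  have dΞ₁ : ∀ {x y : ℝ → ℝ} {x' y' t : ℝ}, HasDerivAt x x' t → HasDerivAt y y' t →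
      HasDerivAt (fun s => Ξ₁ (x s) (y s)) ((ω₁ (x t) (y t) * x' + ω₂ (x t) (y t) * y') +
        2 * A (x t) * ((x t ^ 3 - x t) * x' + y t * y')) t := by
    intro x y x' y' t hx hy
    have kA := (dA (x t)).comp t hx
    have kB := (dB (x t)).comp t hx
    have kL := (dL (x t)).comp t hx
    have kH := hasDerivAt_eightLoop hx hy
    have kP := ((((kA.mul (hy.pow 2)).div_const 3).neg.add ((hy.pow 4).const_mul q₄)).add
      ((hy.mul kL).const_mul κ))
    refine ((kP.add ((kA.mul kH).const_mul 2)).add kB).congr_deriv ?_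
    simp only [eightLoop, Pi.pow_apply, Function.comp_apply, ω₁, ω₂]
    push_cast
    ring
  have dΞ : ∀ {x y : ℝ → ℝ} {x' y' t : ℝ}, HasDerivAt x x' t → HasDerivAt y y' t →
      HasDerivAt (fun s => Ξ (x s) (y s))
        (A (x t) * (ω₁ (x t) (y t) * x' + ω₂ (x t) (y t) * y') -
          τ (x t) (y t) * ((x t ^ 3 - x t) * x' + y t * y')) t := by
    intro x y x' y' t hx hy
    have kA := (dA (x t)).comp t hx
    have kB := (dB (x t)).comp t hx
    have kC := (dC (x t)).comp t hx
    have kD := (dD (x t)).comp t hx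
    have kL := (dL (x t)).comp t hx
    have kH := hasDerivAt_eightLoop hx hy
    refine (((((((((kA.pow 2).mul (hy.pow 2)).div_const 3).neg.add
      ((((kA.pow 2).mul kH).add kC).const_mul (4 / 3))).add ((kA.mul (hy.pow 4)).const_mul q₄)).sub
      ((((((kH.pow 2).mul kA).const_mul 4).add ((kH.mul kB).const_mul 4)).add kD).const_mul q₄)).add
      ((kA.mul (hy.mul kL)).const_mul κ)).sub
      (((hy.pow 3).const_mul κ).div_const 3))).congr_deriv ?_
    simp only [eightLoop, Pi.pow_apply, Pi.mul_apply, Function.comp_apply, ω₁, ω₂, τ]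
    push_cast
    linear_combination (κ * y t * x') * hAL (x t)
  have dΞ₂ : ∀ {x y : ℝ → ℝ} {x' y' t : ℝ}, HasDerivAt x x' t → HasDerivAt y y' t →
      HasDerivAt (fun s => Ξ₂ (x s) (y s))
        (τ (x t) (y t) * (ω₁ (x t) (y t) * x' + ω₂ (x t) (y t) * y') -
          τ₂ (x t) (y t) * ((x t ^ 3 - x t) * x' + y t * y')) t := by
    intro x y x' y' t hx hy
    have kA := (dA (x t)).comp t hx
    have kB := (dB (x t)).comp t hx
    have kC := (dC (x t)).comp t hx
    have kD := (dD (x t)).comp t hx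
    have kC₂ := (dC₂ (x t)).comp t hx
    have kG := (dG (x t)).comp t hx
    have kD₂ := (dD₂ (x t)).comp t hx
    have kK := (dK (x t)).comp t hx
    have kL := (dL (x t)).comp t hx
    have kH := hasDerivAt_eightLoop hx hy
    have kP := ((((kA.mul (hy.pow 2)).div_const 3).neg.add ((hy.pow 4).const_mul q₄)).add
      ((hy.mul kL).const_mul κ))
    have kτ := (((kA.pow 2).const_mul (4 / 3)).neg.add
      ((((kA.mul kH).const_mul 8).add (kB.const_mul 4)).const_mul q₄)).add (hy.const_mul κ)
    have k1 := ((((kτ.mul kP).add ((kA.mul (hy.pow 3)).const_mul κ)).sub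
      ((hy.pow 5).const_mul (κ * q₄))).sub (kK.const_mul (κ ^ 2))).sub
      (((((kH.mul (kA.pow 3)).const_mul 2).div_const 3).add kC₂).const_mul (20 / 9))
    have k2 := (((((kH.pow 2).mul (kA.pow 2)).const_mul 16).add ((kH.mul kC).const_mul 24)).add
      (kG.const_mul 4)).const_mul q₄
    have k3 := (((kH.mul ((kA.mul kB).sub kC)).const_mul 8).add ((kB.pow 2).const_mul 2)).const_mul q₄
    have k4 := ((((((kH.pow 3).mul kA).const_mul 8).add (((kH.pow 2).mul kB).const_mul 12)).add
      ((kH.mul kD).const_mul 6)).add kD₂).const_mul (4 * q₄ ^ 2)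
    refine (((k1.add k2).add k3).sub k4).congr_deriv ?_
    simp only [eightLoop, Pi.pow_apply, Pi.mul_apply, Pi.add_apply, Pi.sub_apply, Pi.neg_apply,
      Function.comp_apply, ω₁, ω₂, τ, τ₂, P]
    push_cast
    linear_combination (κ * y t * (-(8 / 3 * A (x t)) + 4 * q₄ * y t ^ 2) * x') * hAL (x t)
  have hτ₂ : ContDiff ℝ ∞ fun z : ℝ × ℝ × ℝ => τ₂ z.2.1 z.2.2 := by
    simp only [τ₂, P, eightLoop]; fun_prop
  have hτ : Continuous fun z : ℝ × ℝ × ℝ => τ z.2.1 z.2.2 := by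
    have := hA.continuous
    have := hB.continuous
    simp only [τ, eightLoop]; fun_prop
  have hω₁ : ContDiff ℝ ∞ fun z : ℝ × ℝ × ℝ => ω₁ z.2.1 z.2.2 := by
    simp only [ω₁]; fun_prop
  have hω₂ : ContDiff ℝ ∞ fun z : ℝ × ℝ × ℝ => ω₂ z.2.1 z.2.2 := by
    simp only [ω₂]; fun_prop
  refine .of_reduction (k := 4)
    (W := fun ε x y => (1 - 4 * ε * q) * ((1 - 4 * ε * q) ^ 3 * eightLoop x y -
      ε * (1 - 4 * ε * q) ^ 2 * Ξ₁ x y + 2 * ε ^ 2 * (1 - 4 * ε * q) * Ξ x y +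
      2 * ε ^ 3 * Ξ₂ x y))
    (μ := fun ε x y => (1 - 4 * ε * q) ^ 3 - 2 * ε * (1 - 4 * ε * q) ^ 2 * A x -
      2 * ε ^ 2 * (1 - 4 * ε * q) * τ x y - 2 * ε ^ 3 * τ₂ x y)
    (η₁ := fun _ x y => -2 * (τ₂ x y * ω₁ x y))
    (η₂ := fun _ x y => -2 * (τ₂ x y * ω₂ x y))
    (F := fun x y => -2 * κ * (y * L x * (-(8 * q₄ * (A x * (-(A x * y ^ 2 / 3) + q₄ * y ^ 4))) -
      κ ^ 2 * L x + 40 / 27 * A x ^ 3 -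
      q₄ * (32 * (eightLoop x y * A x ^ 2) + 16 * C x + 8 * (A x * B x)) +
      4 * q₄ ^ 2 * (24 * (eightLoop x y ^ 2 * A x) + 24 * (eightLoop x y * B x) + 6 * D x)) -
      8 / 9 * (A x ^ 2 * y ^ 3) + q₄ * (8 / 3 * (B x * y ^ 3) -
        8 / 3 * (A x * (x ^ 2 - x ^ 4 / 2) * y ^ 3) + 8 / 3 * (A x * y ^ 5))))
    (r := fun x y => -2 * κ * ((-(8 * q₄ * A x * L x) - 8 / 3 * A x + 4 * q₄ * y ^ 2) * y *
      (-(2 / 3 * A x) + 4 * q₄ * y ^ 2) -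
      L x * y * (16 / 3 * q₄ * A x ^ 2 - 32 * q₄ ^ 2 * A x * y ^ 2 - 32 * q₄ * A x ^ 2 +
        4 * q₄ ^ 2 * (48 * eightLoop x y * A x + 24 * B x)) + 8 / 3 * A x ^ 2 * y -
      q₄ * (8 * B x * y - 8 * A x * (x ^ 2 - x ^ 4 / 2) * y + 40 / 3 * A x * y ^ 3)))
    four_ne_zero ⟨?_, fun _ _ => by simp, ?_, ?_, ?_⟩ ?_ ?_ ?_
  · have hA₀ := hA.continuous
    exact (Continuous.sub (by fun_prop) (Continuous.mul (by fun_prop) hτ)).sub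
      (Continuous.mul (by fun_prop) hτ₂.continuous)
  · exact contDiff_const.mul (hτ₂.mul hω₁)
  · exact contDiff_const.mul (hτ₂.mul hω₂)
  · intro ε x y x' y' t hx hy
    refine ((((((hasDerivAt_eightLoop hx hy).const_mul _).sub ((dΞ₁ hx hy).const_mul _)).add
      ((dΞ hx hy).const_mul _)).add ((dΞ₂ hx hy).const_mul _)).const_mul _).congr_deriv ?_
    simp only [perturbedField, ha, hb, ω₁, ω₂]
    ring
  · fun_prop
  · have := hA.continuous
    have := hB.continuous
    have := hL.continuous
    simp only [eightLoop]
    fun_prop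
  · intro x y x' y' t hx hy
    have kA := (dA (x t)).comp t hx
    have kB := (dB (x t)).comp t hx
    have kC := (dC (x t)).comp t hx
    have kD := (dD (x t)).comp t hx
    have kL := (dL (x t)).comp t hx
    have kH := hasDerivAt_eightLoop hx hy
    have kw := (hx.pow 2).sub ((hx.pow 4).div_const 2)
    have k1 := (((((kA.mul (((kA.mul (hy.pow 2)).div_const 3).neg.add
      ((hy.pow 4).const_mul q₄))).const_mul (8 * q₄)).neg.sub (kL.const_mul (κ ^ 2))).add
      ((kA.pow 3).const_mul (40 / 27))).sub (((((kH.mul (kA.pow 2)).const_mul 32).add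
      (kC.const_mul 16)).add ((kA.mul kB).const_mul 8)).const_mul q₄)).add
      ((((((kH.pow 2).mul kA).const_mul 24).add ((kH.mul kB).const_mul 24)).add
      (kD.const_mul 6)).const_mul (4 * q₄ ^ 2))
    have k2 := ((((kB.mul (hy.pow 3)).const_mul (8 / 3)).sub
      (((kA.mul kw).mul (hy.pow 3)).const_mul (8 / 3))).add
      ((kA.mul (hy.pow 5)).const_mul (8 / 3))).const_mul q₄
    refine (((((hy.mul kL).mul k1).sub (((kA.pow 2).mul (hy.pow 3)).const_mul (8 / 9))).add
      k2).const_mul (-2 * κ)).congr_deriv ?_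
    simp only [eightLoop, Pi.pow_apply, Pi.mul_apply, Pi.add_apply, Pi.sub_apply, Pi.neg_apply,
      Function.comp_apply, ω₁, ω₂, τ₂, P]
    push_cast
    linear_combination (-2 * κ * y t * (16 / 3 * q₄ * A (x t) * y t ^ 2 - 8 * q₄ ^ 2 * y t ^ 4 +
      40 / 9 * A (x t) ^ 2 - q₄ * (32 * A (x t) * (y t ^ 2 - (x t ^ 2 - x t ^ 4 / 2)) +
        24 * A (x t) * (x t ^ 2 - x t ^ 4 / 2) + 8 * B (x t)) + 24 * q₄ ^ 2 * y t ^ 4) -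
      32 / 3 * q₄ * κ * A (x t) * y t ^ 3) * x' * hAL (x t)

end FocusForms

/-! ### Centers obtained by pull-back under a fold map. -/

section Fold

/-- The Poincaré lemma on a convex open set; d is the common value of the two mixed partial
derivatives. -/
theorem exists_primitive_of_closed {M N d : ℝ × ℝ → ℝ} {s : Set (ℝ × ℝ)} (hs : Convex ℝ s)
    (hso : IsOpen s) (hM : ∀ p ∈ s, DifferentiableAt ℝ M p) (hN : ∀ p ∈ s, DifferentiableAt ℝ N p)
    (hMd : ∀ p ∈ s, HasDerivAt (fun y => M (p.1, y)) (d p) p.2)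
    (hNd : ∀ p ∈ s, HasDerivAt (fun x => N (x, p.2)) (d p) p.1) :
    ∃ G : ℝ × ℝ → ℝ, ∀ p ∈ s, HasFDerivAt G
      (M p • ContinuousLinearMap.fst ℝ ℝ ℝ + N p • ContinuousLinearMap.snd ℝ ℝ ℝ) p := by
  have hω : ∀ p ∈ s, HasFDerivAt
      (fun p => M p • ContinuousLinearMap.fst ℝ ℝ ℝ + N p • ContinuousLinearMap.snd ℝ ℝ ℝ)
      ((fderiv ℝ M p).smulRight (ContinuousLinearMap.fst ℝ ℝ ℝ) +
        (fderiv ℝ N p).smulRight (ContinuousLinearMap.snd ℝ ℝ ℝ)) p := fun p hp =>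
    ((hM p hp).hasFDerivAt.smul_const (ContinuousLinearMap.fst ℝ ℝ ℝ)).add
      ((hN p hp).hasFDerivAt.smul_const (ContinuousLinearMap.snd ℝ ℝ ℝ))
  refine hs.exists_forall_hasFDerivAt_of_fderiv_symmetric hso
    (fun p hp => (hω p hp).differentiableAt.differentiableWithinAt) fun p hp u v => ?_
  rw [(hω p hp).fderiv]
  have h1 : fderiv ℝ M p (0, 1) = d p := by
    have h := (hM p hp).hasFDerivAt.comp_hasDerivAt (f := fun y => (p.1, y)) p.2
      ((hasDerivAt_const p.2 p.1).prodMk (hasDerivAt_id p.2))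
    exact h.unique (hMd p hp)
  have h2 : fderiv ℝ N p (1, 0) = d p := by
    have h := (hN p hp).hasFDerivAt.comp_hasDerivAt (f := fun x => (x, p.2)) p.1
      ((hasDerivAt_id p.1).prodMk (hasDerivAt_const p.1 p.2))
    exact h.unique (hNd p hp)
  have h3 : ∀ (T : ℝ × ℝ →L[ℝ] ℝ) (w : ℝ × ℝ), T w = w.1 * T (1, 0) + w.2 * T (0, 1) := fun T w => by
    conv_lhs => rw [show w = w.1 • ((1 : ℝ), (0 : ℝ)) + w.2 • ((0 : ℝ), (1 : ℝ)) by ext <;> simp]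
    rw [map_add, map_smul, map_smul, smul_eq_mul, smul_eq_mul]
  simp only [add_apply, ContinuousLinearMap.smulRight_apply,
    smul_apply, ContinuousLinearMap.coe_fst', ContinuousLinearMap.coe_snd',
    smul_eq_mul]
  rw [h3 (fderiv ℝ M p) u, h3 (fderiv ℝ M p) v, h3 (fderiv ℝ N p) u, h3 (fderiv ℝ N p) v, h1, h2]
  ring

/-- The homogeneous form `c V dV + (k V + h₀ + h₁ Y) dY` has an integrating factor. -/
theorem exists_fold_integral {c k h₀ h₁ : ℝ} {s : Set (ℝ × ℝ)} (hs : Convex ℝ s)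
    (hso : IsOpen s) (hD : ∀ p ∈ s, 0 < h₁ * c * p.1 ^ 2 + k * p.1 * (h₀ + h₁ * p.2) +
      (h₀ + h₁ * p.2) ^ 2) :
    ∃ G : ℝ × ℝ → ℝ, ∀ p ∈ s, HasFDerivAt G
      ((c * p.1 / (h₁ * c * p.1 ^ 2 + k * p.1 * (h₀ + h₁ * p.2) + (h₀ + h₁ * p.2) ^ 2)) •
        ContinuousLinearMap.fst ℝ ℝ ℝ +
      ((k * p.1 + (h₀ + h₁ * p.2)) /
        (h₁ * c * p.1 ^ 2 + k * p.1 * (h₀ + h₁ * p.2) + (h₀ + h₁ * p.2) ^ 2)) •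
        ContinuousLinearMap.snd ℝ ℝ ℝ) p := by
  have hne := fun p hp => (hD p hp).ne'
  -- With T = h₀ + h₁Y the form is homogeneous in (V, T). The denominator is h₁ times its
  -- contraction with the Euler field V∂_V + T∂_T, the classical integrating factor, and it remains
  -- valid for h₁ = 0.
  refine exists_primitive_of_closed
    (M := fun p => c * p.1 / (h₁ * c * p.1 ^ 2 + k * p.1 * (h₀ + h₁ * p.2) + (h₀ + h₁ * p.2) ^ 2))
    (N := fun p => (k * p.1 + (h₀ + h₁ * p.2)) /
      (h₁ * c * p.1 ^ 2 + k * p.1 * (h₀ + h₁ * p.2) + (h₀ + h₁ * p.2) ^ 2))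
    (d := fun p => -(c * p.1 * (k * p.1 * h₁ + 2 * (h₀ + h₁ * p.2) * h₁)) /
      (h₁ * c * p.1 ^ 2 + k * p.1 * (h₀ + h₁ * p.2) + (h₀ + h₁ * p.2) ^ 2) ^ 2)
    hs hso (fun p hp => ?_) (fun p hp => ?_) (fun p hp => ?_) fun p hp => ?_
  · fun_prop (disch := exact hne p hp)
  · fun_prop (disch := exact hne p hp)
  · have hT : HasDerivAt (fun y => h₀ + h₁ * y) h₁ p.2 :=
      (((hasDerivAt_id p.2).const_mul h₁).const_add h₀).congr_deriv (by simp)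
    refine ((hasDerivAt_const p.2 (c * p.1)).div (((hT.const_mul (k * p.1)).const_add
      (h₁ * c * p.1 ^ 2)).add (hT.pow 2)) (hne p hp)).congr_deriv ?_
    congr 1
    push_cast
    ring
  · have h1 := hasDerivAt_id p.1
    refine (((h1.const_mul k).add_const (h₀ + h₁ * p.2)).div ((((h1.pow 2).const_mul (h₁ * c)).add
      ((h1.const_mul k).mul_const (h₀ + h₁ * p.2))).add_const ((h₀ + h₁ * p.2) ^ 2))
      (hne p hp)).congr_deriv ?_
    simp only [id, Pi.pow_apply, Pi.add_apply]
    congr 1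
    push_cast
    ring

variable {a b : ℕ → ℕ → ℝ}

/-- The perturbation has no limit cycles near `(1, 0)`. -/
def IsCenterPerturbation (a b : ℕ → ℕ → ℝ) : Prop := ∀ r : ℝ, 0 < r → r ≤ 1 / 64 →
  ∀ᶠ ε in 𝓝 (0 : ℝ), numLimitCycles (perturbedField a b ε) (1, 0) r = 0

/-- Systems which are pulled back by a fold map have centers. -/
theorem isCenterPerturbation_of_fold {p β κ s t : ℝ}
    (ha : ∀ x y, cubicPoly a x y = s * y + β / 3 * x ^ 2 * y + t * y ^ 3 + κ * (x ^ 2 - 1))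
    (hb : ∀ x y, cubicPoly b x y = p * (x ^ 3 - x) + 2 / 3 * β * x * y ^ 2 - 2 * κ * x * y) :
    IsCenterPerturbation a b := by
  intro r hr0 hr
  refine eventually_numLimitCycles_eq_zero_of_integral ?_ hr0 hr
  let c : ℝ → ℝ := fun ε => 1 - ε * p
  let h₀ : ℝ → ℝ := fun ε => 1 + ε * s + ε * β / 3 - 2 * ε ^ 2 * κ ^ 2 / c ε
  let h₁ : ℝ → ℝ := fun ε => ε * t + 2 * ε ^ 2 * β ^ 2 / (9 * c ε)
  let D : ℝ → ℝ × ℝ → ℝ := fun ε z => h₁ ε * c ε * z.1 ^ 2 + ε * β * z.1 * (h₀ ε + h₁ ε * z.2) +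
    (h₀ ε + h₁ ε * z.2) ^ 2
  have c0 : c 0 = 1 := by simp [c]
  have hc : Continuous c := by fun_prop
  have hc0 : ∀ᶠ ε in 𝓝 (0 : ℝ), c ε ≠ 0 := hc.continuousAt.eventually_ne (by rw [c0]; norm_num)
  -- At ε = 0 the denominator is identically 1, so compactness keeps it positive for small ε.
  have hD : ∀ᶠ ε in 𝓝 (0 : ℝ), ∀ z ∈ Metric.closedBall (0 : ℝ × ℝ) 3, 0 < D ε z := by
    refine (isCompact_closedBall _ _).eventually_forall_of_forall_eventually fun z _ => ?_
    have hcz : ContinuousAt (fun w : ℝ × (ℝ × ℝ) => c w.1) (0, z) := by fun_prop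
    have h0z : ContinuousAt (fun w : ℝ × (ℝ × ℝ) => h₀ w.1) (0, z) :=
      ContinuousAt.sub (by fun_prop) (ContinuousAt.div (by fun_prop) hcz (by simp [c]))
    have h1z : ContinuousAt (fun w : ℝ × (ℝ × ℝ) => h₁ w.1) (0, z) :=
      ContinuousAt.add (by fun_prop)
        (ContinuousAt.div (by fun_prop) (hcz.const_mul 9) (by simp [c]))
    have hDz : ContinuousAt (fun w : ℝ × (ℝ × ℝ) => D w.1 w.2) (0, z) := by
      have hT := h0z.add (h1z.mul (by fun_prop : ContinuousAt (fun w : ℝ × (ℝ × ℝ) => w.2.2) (0, z)))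
      exact (((h1z.mul hcz).mul
        (by fun_prop : ContinuousAt (fun w : ℝ × (ℝ × ℝ) => w.2.1 ^ 2) (0, z))).add
        ((by fun_prop : ContinuousAt (fun w : ℝ × (ℝ × ℝ) => w.1 * β * w.2.1) (0, z)).mul hT)).add
        (hT.pow 2)
    refine hDz.eventually (lt_mem_nhds ?_)
    simp [D, h₀, h₁]
  have hsmall : ∀ᶠ ε in 𝓝 (0 : ℝ), |2 * ε / c ε| * (|κ| + |β|) < 1 := by
    have h1 : ContinuousAt (fun ε => |2 * ε / c ε| * (|κ| + |β|)) 0 :=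
      (ContinuousAt.div (by fun_prop) hc.continuousAt (by rw [c0]; norm_num)).abs.mul_const _
    exact h1.eventually (gt_mem_nhds (by simp))
  filter_upwards [hc0, hD, hsmall] with ε hcε hDε hsε
  obtain ⟨G, hG⟩ := exists_fold_integral (c := c ε) (k := ε * β) (h₀ := h₀ ε) (h₁ := h₁ ε)
    (s := Metric.ball (0 : ℝ × ℝ) 3) (convex_ball _ _) Metric.isOpen_ball
    fun z hz => hDε z (Metric.ball_subset_closedBall hz)
  -- V is chosen so that the dx part of Ω is c V x dx. Expressing x dx through dV and dy, the terms
  -- in y² cancel and the coefficient of dy becomes odd in y, so Ω is pulled back by (x, y) ↦ (V,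
  -- y²).
  let V : ℝ → ℝ → ℝ := fun x y => x ^ 2 - 1 + 2 * ε / c ε * (κ * y - β / 3 * y ^ 2)
  have hmem : ∀ x y, 1 / 2 ≤ x → x ≤ 3 / 2 → |y| ≤ 1 →
      (V x y, y ^ 2) ∈ Metric.ball (0 : ℝ × ℝ) 3 := fun x y hx1 hx2 hy => by
    have hy2 : y ^ 2 ≤ 1 := by rw [← sq_abs]; nlinarith [abs_nonneg y]
    have h1 : |κ * y - β / 3 * y ^ 2| ≤ |κ| + |β| := by
      refine (abs_sub _ _).trans (add_le_add ?_ ?_)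
      · rw [abs_mul]; nlinarith [abs_nonneg κ]
      · rw [abs_mul, abs_div, abs_of_nonneg (sq_nonneg y), abs_of_pos (show (0 : ℝ) < 3 by norm_num)]
        nlinarith [abs_nonneg β, sq_nonneg y]
    have h2 : |2 * ε / c ε * (κ * y - β / 3 * y ^ 2)| < 1 := by
      rw [abs_mul]
      exact (mul_le_mul_of_nonneg_left h1 (abs_nonneg _)).trans_lt hsε
    rw [abs_lt] at h2
    rw [mem_ball_zero_iff, Prod.norm_def, max_lt_iff, Real.norm_eq_abs, Real.norm_eq_abs, abs_lt,
      abs_lt]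
    have hV : V x y = x ^ 2 - 1 + 2 * ε / c ε * (κ * y - β / 3 * y ^ 2) := rfl
    refine ⟨⟨?_, ?_⟩, ?_, ?_⟩
    · show -3 < V x y
      nlinarith
    · show V x y < 3
      nlinarith
    · show -3 < y ^ 2
      nlinarith
    · show y ^ 2 < 3
      nlinarith
  refine ⟨fun x y => G (V x y, y ^ 2), fun x y => 2 / D ε (V x y, y ^ 2), fun x y h1 h2 h3 =>
    div_pos two_pos (hDε _ (Metric.ball_subset_closedBall (hmem x y h1 h2 h3))),
    fun x y x' y' t hx hy h1 h2 h3 => ?_⟩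
  have hm := hmem _ _ h1 h2 h3
  have hV : HasDerivAt (fun s => V (x s) (y s))
      (2 * x t * x' + 2 * ε / c ε * (κ * y' - 2 / 3 * β * y t * y')) t := by
    refine (((hx.pow 2).sub_const 1).add (((hy.const_mul κ).sub
      ((hy.pow 2).const_mul (β / 3))).const_mul (2 * ε / c ε))).congr_deriv ?_
    push_cast
    ring
  have hY : HasDerivAt (fun s => y s ^ 2) (2 * y t * y') t :=
    (hy.pow 2).congr_deriv (by norm_num)
  refine ((hG _ hm).comp_hasDerivAt t (f := fun s => (V (x s) (y s), y s ^ 2))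
    (hV.prodMk hY)).congr_deriv ?_
  simp only [add_apply, smul_apply,
    ContinuousLinearMap.coe_fst', ContinuousLinearMap.coe_snd', smul_eq_mul, perturbedField, ha, hb]
  have aux : ∀ m n u v w d : ℝ, m * u + n * v = 2 * w → m / d * u + n / d * v = 2 / d * w :=
    fun m n u v w d h => by
      rw [div_mul_eq_mul_div, div_mul_eq_mul_div, ← add_div, h, div_mul_eq_mul_div]
  refine aux _ _ _ _ _ _ ?_
  simp only [V, h₀, h₁]
  field_simp
  simp only [c]
  ring

end Fold

/-! ### Classification of the perturbations by their first nonvanishing Melnikov vector. -/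

section Classification

variable {a b : ℕ → ℕ → ℝ}

/-- The perturbations with vanishing Melnikov functions of order one and two which are neither
Hamiltonian nor reversible: `A' L = x - x³`, where `L = L₀ + L₁ x + L₂ x² + L₃ x³`. -/
structure FocusShape (a b : ℕ → ℕ → ℝ) (κ L₀ L₁ L₂ L₃ : ℝ) : Prop where
  b01 : b 0 1 = -a 1 0
  b11 : b 1 1 = -(2 * a 2 0)
  b21 : b 2 1 = -(3 * a 3 0)
  b03 : b 0 3 = 0
  a02 : a 0 2 = 0
  a12 : a 1 2 = 0
  a00 : a 0 0 = -(κ * L₀)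
  a10 : a 1 0 = -(κ * L₁)
  a20 : a 2 0 = -(κ * L₂)
  a30 : a 3 0 = -(κ * L₃)
  e₀ : evenCoeff₀ a b * L₀ = 0
  e₁ : evenCoeff₀ a b * L₁ + evenCoeff₁ a b * L₀ = 1
  e₂ : evenCoeff₀ a b * L₂ + evenCoeff₁ a b * L₁ = 0
  e₃ : evenCoeff₀ a b * L₃ + evenCoeff₁ a b * L₂ = -1
  e₄ : evenCoeff₁ a b * L₃ = 0

/-- The coefficients of the third order Melnikov function. -/
noncomputable def thirdVector (a b : ℕ → ℕ → ℝ) (κ : ℝ) : Fin 6 → ℝ :=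
  ![-2 * κ * b 0 0, -2 * κ * b 2 0, -2 * κ * (evenCoeff₀ a b / 3 - a 1 1 / 2), 0,
    -2 * κ * (b 1 0 + b 3 0), -2 * κ * (evenCoeff₁ a b / 3 - a 2 1)]

/-- The coefficients of the fourth order Melnikov function. -/
noncomputable def fourthVector (κ L₁ L₂ L₃ : ℝ) : Fin 6 → ℝ :=
  ![0, -2 * κ ^ 3 * (3 * L₁ * L₂ + 5 * L₂ * L₃), -2 * κ ^ 3 * (5 / 3 * L₂ * L₃), 0,
    -2 * κ ^ 3 * (L₁ ^ 2 + 2 * L₂ ^ 2 + 4 * L₁ * L₃ + 3 * L₃ ^ 2), -2 * κ ^ 3 * (2 * L₃ ^ 2)]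

variable {κ L₀ L₁ L₂ L₃ : ℝ}

/-- Only A' is prescribed, so the constant A₀ is free; the fourth order reduction needs a particular
choice of it. -/
theorem FocusShape.focusForm (h : FocusShape a b κ L₀ L₁ L₂ L₃) (A₀ : ℝ) :
    FocusForm a b κ (-(a 0 3 / 4))
      (fun x => A₀ + evenCoeff₀ a b * x + evenCoeff₁ a b * x ^ 2 / 2)
      (fun x => evenCoeff₀ a b + evenCoeff₁ a b * x)
      (fun x => L₀ + L₁ * x + L₂ * x ^ 2 + L₃ * x ^ 3)
      (fun x => L₁ + 2 * L₂ * x + 3 * L₃ * x ^ 2)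
      (fun x => b 0 0 * x + b 1 0 * x ^ 2 / 2 + b 2 0 * x ^ 3 / 3 + b 3 0 * x ^ 4 / 4)
      (fun x => b 0 0 + b 1 0 * x + b 2 0 * x ^ 2 + b 3 0 * x ^ 3)
      (fun x => -(a 0 1 + a 1 1 * x + a 2 1 * x ^ 2) / 2)
      (fun x => -(a 1 1 + 2 * a 2 1 * x) / 2) := by
  obtain ⟨b01, b11, b21, b03, a02, a12, a00, a10, a20, a30, e₀, e₁, e₂, e₃, e₄⟩ := h
  have d := fun x : ℝ => hasDerivAt_id x
  refine ⟨by fun_prop, by fun_prop, by fun_prop, by fun_prop, by fun_prop, by fun_prop,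
    by fun_prop, by fun_prop, fun x => ?_, fun x => ?_, fun x => ?_, fun x => ?_, fun x => ?_,
    fun x y => ?_, fun x y => ?_⟩
  · refine ((((d x).const_mul _).const_add _).add
      ((((d x).pow 2).const_mul _).div_const 2)).congr_deriv ?_
    simp only [id]; push_cast; ring
  · refine (((((d x).const_mul _).const_add _).add (((d x).pow 2).const_mul _)).add
      (((d x).pow 3).const_mul _)).congr_deriv ?_
    simp only [id]; push_cast; ring
  · refine (((((d x).const_mul _).add ((((d x).pow 2).const_mul _).div_const 2)).add
      ((((d x).pow 3).const_mul _).div_const 3)).add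
      ((((d x).pow 4).const_mul _).div_const 4)).congr_deriv ?_
    simp only [id]; push_cast; ring
  · refine (((((d x).const_mul _).const_add _).add
      (((d x).pow 2).const_mul _)).neg.div_const 2).congr_deriv ?_
    simp only [id]; push_cast; ring
  · linear_combination e₀ + x * e₁ + x ^ 2 * e₂ + x ^ 3 * e₃ + x ^ 4 * e₄
  · rw [cubicPoly_eq, a00, a10, a20, a30, a02, a12]; ring
  · rw [cubicPoly_eq, b01, b11, b21, b03, a10, a20, a30]
    simp only [evenCoeff₀, evenCoeff₁]
    ring

theorem FocusShape.hasMelnikovForm (h : FocusShape a b κ L₀ L₁ L₂ L₃) :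
    HasMelnikovForm a b (oddForm (thirdVector a b κ)) := by
  refine (h.focusForm 0).hasMelnikovForm.congr (F := fun _ y => 2 / 3 * κ * b 3 0 * y ^ 3)
    (r := fun _ y => -(2 * κ * b 3 0 * y)) (by fun_prop) (continuous_oddForm _) (by fun_prop) ?_
  intro x y x' y' t hx hy
  refine ((hy.pow 3).const_mul _).congr_deriv ?_
  simp [oddForm, thirdVector]
  ring

theorem FocusShape.hasMelnikovForm_fourth (h : FocusShape a b κ L₀ L₁ L₂ L₃) (hL₀ : L₀ = 0)
    (h3 : thirdVector a b κ = 0) (hκ : κ ≠ 0) :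
    HasMelnikovForm a b (oddForm (fourthVector κ L₁ L₂ L₃)) := by
  have k : -2 * κ ≠ 0 := by simpa using hκ
  have h0 : b 0 0 = 0 := (mul_eq_zero.1 (congrFun h3 0)).resolve_left k
  have h1 : b 2 0 = 0 := (mul_eq_zero.1 (congrFun h3 1)).resolve_left k
  have h2 : evenCoeff₀ a b / 3 - a 1 1 / 2 = 0 := (mul_eq_zero.1 (congrFun h3 2)).resolve_left k
  have h4 : b 1 0 + b 3 0 = 0 := (mul_eq_zero.1 (congrFun h3 4)).resolve_left k
  have h5 : evenCoeff₁ a b / 3 - a 2 1 = 0 := (mul_eq_zero.1 (congrFun h3 5)).resolve_left k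
  -- This constant makes q₂ = 2q − A/3 hold at x = 0, where q₂ is −a₀₁/2 and q = b₃₀/4.
  refine ((h.focusForm (3 / 2 * a 0 1 + 3 / 2 * b 3 0)).hasMelnikovForm_fourth
    (q := b 3 0 / 4) (fun x => ?_) (fun x => ?_) (fun x => ?_)).congr
    (F := fun x y => 2 / 3 * κ ^ 3 * ((2 * L₂ ^ 2 + 4 * L₁ * L₃) * y ^ 3 + 5 * L₂ * L₃ * (x * y ^ 3) +
      3 * L₃ ^ 2 * ((x ^ 2 + 1) * y ^ 3)))
    (r := fun x y => -2 * κ ^ 3 * ((2 * L₂ ^ 2 + 4 * L₁ * L₃) * y + 5 * L₂ * L₃ * (x * y) +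
      3 * L₃ ^ 2 * ((x ^ 2 + 1) * y)))
    (by fun_prop) (continuous_oddForm _) (by fun_prop) ?_
  · linear_combination h0 + x ^ 2 * h1 + x * h4
  · linear_combination x * h2 + x ^ 2 / 2 * h5
  · linear_combination h2 + x * h5
  · intro x y x' y' t hx hy
    refine (((((hy.pow 3).const_mul _).add ((hx.mul (hy.pow 3)).const_mul _)).add
      ((((hx.pow 2).add_const 1).mul (hy.pow 3)).const_mul _)).const_mul _).congr_deriv ?_
    simp [oddForm, fourthVector, hL₀]
    ring

/-- When α = 0 the relation A'L = x − x³ leaves L = L₀(1 − x²), and the vanishing of the third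
vector brings the remaining coefficients to the normal form of the fold systems. -/
theorem FocusShape.isCenterPerturbation (h : FocusShape a b κ L₀ L₁ L₂ L₃)
    (h3 : thirdVector a b κ = 0) (hκ : κ ≠ 0) (hα : evenCoeff₀ a b = 0) :
    IsCenterPerturbation a b := by
  have k : -2 * κ ≠ 0 := by simpa using hκ
  have h0 : b 0 0 = 0 := (mul_eq_zero.1 (congrFun h3 0)).resolve_left k
  have h1 : b 2 0 = 0 := (mul_eq_zero.1 (congrFun h3 1)).resolve_left k
  have h2 : evenCoeff₀ a b / 3 - a 1 1 / 2 = 0 := (mul_eq_zero.1 (congrFun h3 2)).resolve_left k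
  have h4 : b 1 0 + b 3 0 = 0 := (mul_eq_zero.1 (congrFun h3 4)).resolve_left k
  have h5 : evenCoeff₁ a b / 3 - a 2 1 = 0 := (mul_eq_zero.1 (congrFun h3 5)).resolve_left k
  have e₁ := h.e₁
  have e₂ := h.e₂
  have e₃ := h.e₃
  have e₄ := h.e₄
  rw [hα, zero_mul, zero_add] at e₁ e₂ e₃
  have hβ : evenCoeff₁ a b ≠ 0 := fun h => by rw [h, zero_mul] at e₁; exact zero_ne_one e₁
  have l1 := (mul_eq_zero.1 e₂).resolve_left hβ
  have l3 := (mul_eq_zero.1 e₄).resolve_left hβ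
  have l2 : L₂ = -L₀ := mul_left_cancel₀ hβ (by linarith)
  have a11 : a 1 1 = 0 := by rw [hα] at h2; linarith
  have b02 : b 0 2 = 0 := by
    have := hα
    rw [evenCoeff₀, a11] at this
    linarith
  have a21 : a 2 1 = evenCoeff₁ a b / 3 := by linarith
  have b12 : b 1 2 = 2 / 3 * evenCoeff₁ a b := by
    have : evenCoeff₁ a b = a 2 1 + b 1 2 := rfl
    linarith
  refine isCenterPerturbation_of_fold (p := b 3 0) (β := evenCoeff₁ a b) (κ := κ * L₀)
    (s := a 0 1) (t := a 0 3) (fun x y => ?_) fun x y => ?_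
  · rw [cubicPoly_eq, h.a00, h.a10, h.a20, h.a30, h.a02, h.a12, l1, l2, l3, a11, a21]
    ring
  · rw [cubicPoly_eq, h.b01, h.b11, h.b21, h.b03, h.a10, h.a20, h.a30, l1, l2, l3, b02, b12, h0, h1]
    linear_combination x * h4

/-- The last entry gives L₃ = 0; the entry before it is then a positive definite form in L₁ and L₂,
so L₁ = 0. Together with L₀ = 0 this contradicts the x-coefficient of A'L = x − x³. -/
theorem fourthVector_ne_zero (h : FocusShape a b κ L₀ L₁ L₂ L₃) (hL₀ : L₀ = 0) (hκ : κ ≠ 0) :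
    fourthVector κ L₁ L₂ L₃ ≠ 0 := by
  intro hv
  have k : -2 * κ ^ 3 ≠ 0 := by simpa using hκ
  have h5 : 2 * L₃ ^ 2 = 0 := (mul_eq_zero.1 (congrFun hv 5)).resolve_left k
  have h4 : L₁ ^ 2 + 2 * L₂ ^ 2 + 4 * L₁ * L₃ + 3 * L₃ ^ 2 = 0 :=
    (mul_eq_zero.1 (congrFun hv 4)).resolve_left k
  have l3 : L₃ = 0 := by simpa using h5
  rw [l3] at h4
  have l1 : L₁ = 0 := by
    have : L₁ ^ 2 = 0 := by nlinarith [sq_nonneg L₁, sq_nonneg L₂]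
    simpa using this
  have := h.e₁
  rw [l1, hL₀] at this
  simp at this

theorem evenCoeff₀_rotatedCoeff (a b : ℕ → ℕ → ℝ) :
    evenCoeff₀ (rotatedCoeff a) (rotatedCoeff b) = -evenCoeff₀ a b := by
  simp [evenCoeff₀, rotatedCoeff]; ring

theorem evenCoeff₁_rotatedCoeff (a b : ℕ → ℕ → ℝ) :
    evenCoeff₁ (rotatedCoeff a) (rotatedCoeff b) = evenCoeff₁ a b := by
  simp [evenCoeff₁, rotatedCoeff]; ring

theorem firstVector_rotatedCoeff (a b : ℕ → ℕ → ℝ) :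
    firstVector (rotatedCoeff a) (rotatedCoeff b) = flipOdd (firstVector a b) := by
  ext i
  fin_cases i <;> simp [firstVector, flipOdd, rotatedCoeff] <;> ring

theorem secondVector_rotatedCoeff (a b : ℕ → ℕ → ℝ) :
    secondVector (rotatedCoeff a) (rotatedCoeff b) = flipOdd (secondVector a b) := by
  ext i
  fin_cases i <;> simp [secondVector, flipOdd, evenCoeff₀_rotatedCoeff,
    evenCoeff₁_rotatedCoeff, -mul_eq_mul_left_iff, -neg_inj] <;>
    simp [rotatedCoeff, -mul_eq_mul_left_iff, -neg_inj] <;> ring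

theorem thirdVector_rotatedCoeff (a b : ℕ → ℕ → ℝ) (κ : ℝ) :
    thirdVector (rotatedCoeff a) (rotatedCoeff b) (-κ) = flipOdd (thirdVector a b κ) := by
  ext i
  fin_cases i <;> simp [thirdVector, flipOdd, evenCoeff₀_rotatedCoeff,
    evenCoeff₁_rotatedCoeff, -mul_eq_mul_left_iff, -neg_inj] <;>
    simp [rotatedCoeff, -mul_eq_mul_left_iff, -neg_inj] <;> ring

theorem fourthVector_neg (κ L₁ L₂ L₃ : ℝ) :
    fourthVector (-κ) (-L₁) L₂ (-L₃) = flipOdd (fourthVector κ L₁ L₂ L₃) := by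
  ext i
  fin_cases i <;> simp [fourthVector, flipOdd] <;> ring

theorem flipOdd_zero : flipOdd 0 = 0 := by
  ext i
  fin_cases i <;> simp [flipOdd]

/-- The half-turn replaces A'(x) by −A'(−x) and L(x) by L(−x), which preserves A'L = x − x³, and
changes the sign of κ. -/
theorem FocusShape.rotated (h : FocusShape a b κ L₀ L₁ L₂ L₃) :
    FocusShape (rotatedCoeff a) (rotatedCoeff b) (-κ) L₀ (-L₁) L₂ (-L₃) := by
  obtain ⟨b01, b11, b21, b03, a02, a12, a00, a10, a20, a30, e₀, e₁, e₂, e₃, e₄⟩ := h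
  constructor <;> try simp only [evenCoeff₀_rotatedCoeff, evenCoeff₁_rotatedCoeff]
  all_goals first | linarith | (simp only [rotatedCoeff]; norm_num; linarith)

/-- The shape of the perturbations with vanishing Melnikov functions of order one and two. -/
theorem hamiltonian_or_reversible_or_focusShape (h1 : firstVector a b = 0)
    (h2 : secondVector a b = 0) : (evenCoeff₀ a b = 0 ∧ evenCoeff₁ a b = 0) ∨
    (a 0 0 = 0 ∧ a 1 0 = 0 ∧ a 2 0 = 0 ∧ a 3 0 = 0 ∧ a 0 2 = 0 ∧ a 1 2 = 0) ∨
    ∃ κ L₀ L₁ L₂ L₃, κ ≠ 0 ∧ FocusShape a b κ L₀ L₁ L₂ L₃ := by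
  have c0 : a 1 0 + b 0 1 = 0 := congrFun h1 0
  have c2 : 3 * a 3 0 + b 2 1 = 0 := congrFun h1 1
  have c3 : a 1 2 / 3 + b 0 3 = 0 := congrFun h1 2
  have c1 : 2 * a 2 0 + b 1 1 = 0 := congrFun h1 4
  have d0 : -2 * (evenCoeff₀ a b * a 0 0) = 0 := congrFun h2 0
  have d1 : -2 * (evenCoeff₀ a b * a 2 0 + evenCoeff₁ a b * (a 1 0 + a 3 0)) = 0 := congrFun h2 1
  have d2 : -2 / 3 * (evenCoeff₀ a b * a 0 2 + evenCoeff₁ a b * a 3 0) = 0 := congrFun h2 2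
  have d3 : -2 / 3 * (evenCoeff₁ a b * a 1 2) = 0 := congrFun h2 3
  have d4 : -2 * (evenCoeff₀ a b * (a 1 0 + a 3 0) + evenCoeff₁ a b * (a 0 0 + a 2 0)) = 0 :=
    congrFun h2 4
  have d5 : -2 / 3 * (evenCoeff₀ a b * a 1 2 + evenCoeff₁ a b * a 0 2) = 0 := congrFun h2 5
  generalize hα : evenCoeff₀ a b = α at *
  generalize hβ : evenCoeff₁ a b = β at *
  by_cases hA : α = 0 ∧ β = 0
  · exact .inl hA
  refine .inr ?_
  by_cases hQ : a 0 0 = 0 ∧ a 1 0 = 0 ∧ a 2 0 = 0 ∧ a 3 0 = 0 ∧ a 0 2 = 0 ∧ a 1 2 = 0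
  · exact .inl hQ
  refine .inr ?_
  have build : ∀ κ L₀ L₁ L₂ L₃ : ℝ, κ ≠ 0 → a 0 2 = 0 → a 1 2 = 0 → a 0 0 = -(κ * L₀) →
      a 1 0 = -(κ * L₁) → a 2 0 = -(κ * L₂) → a 3 0 = -(κ * L₃) → α * L₀ = 0 →
      α * L₁ + β * L₀ = 1 → α * L₂ + β * L₁ = 0 → α * L₃ + β * L₂ = -1 → β * L₃ = 0 →
      ∃ κ L₀ L₁ L₂ L₃, κ ≠ 0 ∧ FocusShape a b κ L₀ L₁ L₂ L₃ := by
    intro κ L₀ L₁ L₂ L₃ hκ a02 a12 a00 a10 a20 a30 e₀ e₁ e₂ e₃ e₄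
    subst hα hβ
    exact ⟨κ, L₀, L₁, L₂, L₃, hκ, by linarith, by linarith, by linarith, by linarith, a02, a12,
      a00, a10, a20, a30, e₀, e₁, e₂, e₃, e₄⟩
  -- The linear function A' = α + βx divides x − x³ in three ways: as a constant, as a multiple of
  -- x, or as a multiple of 1 ± x. The quotient is L, and κ is read off from a nonzero coefficient.
  by_cases hβ0 : β = 0
  · have hα0 : α ≠ 0 := fun h => hA ⟨h, hβ0⟩
    have z0 : a 0 0 = 0 := mul_left_cancel₀ hα0 (by linarith)
    have z2 : a 2 0 = 0 := mul_left_cancel₀ hα0 (by rw [hβ0] at d1; linarith)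
    have z02 : a 0 2 = 0 := mul_left_cancel₀ hα0 (by rw [hβ0] at d2; linarith)
    have z12 : a 1 2 = 0 := mul_left_cancel₀ hα0 (by rw [hβ0] at d5; linarith)
    have z3 : a 3 0 = -a 1 0 := mul_left_cancel₀ hα0 (by rw [hβ0] at d4; linarith)
    have hne : a 1 0 ≠ 0 := fun h => hQ ⟨z0, h, z2, by rw [z3, h, neg_zero], z02, z12⟩
    refine build (-(a 1 0 * α)) 0 (1 / α) 0 (-(1 / α)) (neg_ne_zero.2 (mul_ne_zero hne hα0)) z02 z12
      (by rw [z0]; ring) ?_ (by rw [z2]; ring) ?_ (by ring) ?_ (by rw [hβ0]; ring) ?_ (by rw [hβ0]; ring)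
    · field_simp
    · rw [z3]; field_simp
    · rw [hβ0]; field_simp; ring
    · rw [hβ0]; field_simp; ring
  · have z12 : a 1 2 = 0 := mul_left_cancel₀ hβ0 (by linarith)
    have z02 : a 0 2 = 0 := mul_left_cancel₀ hβ0 (by rw [z12] at d5; linarith)
    have z3 : a 3 0 = 0 := mul_left_cancel₀ hβ0 (by rw [z02] at d2; linarith)
    rw [z3, add_zero] at d1 d4
    by_cases hα0 : α = 0
    · have z1 : a 1 0 = 0 := mul_left_cancel₀ hβ0 (by rw [hα0] at d1; linarith)
      have z2 : a 2 0 = -a 0 0 := mul_left_cancel₀ hβ0 (by rw [hα0] at d4; linarith)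
      have hne : a 0 0 ≠ 0 := fun h => hQ ⟨h, z1, by rw [z2, h, neg_zero], z3, z02, z12⟩
      refine build (-(a 0 0 * β)) (1 / β) 0 (-(1 / β)) 0 (neg_ne_zero.2 (mul_ne_zero hne hβ0)) z02
        z12 ?_ (by rw [z1]; ring) ?_ (by rw [z3]; ring) (by rw [hα0]; ring) ?_ (by rw [hα0]; ring) ?_
        (by ring)
      · field_simp
      · rw [z2]; field_simp
      · rw [hα0]; field_simp; ring
      · rw [hα0]; field_simp; ring
    · have z0 : a 0 0 = 0 := mul_left_cancel₀ hα0 (by linarith)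
      rw [z0, zero_add] at d4
      have hne : a 1 0 ≠ 0 := fun h => hQ ⟨z0, h,
        mul_left_cancel₀ hα0 (by rw [h] at d1; linarith), z3, z02, z12⟩
      -- The two equations for a₁₀ and a₂₀ have a nontrivial solution only if their determinant α² −
      -- β² vanishes, that is, if the root of A' is ±1.
      have hsq : β ^ 2 = α ^ 2 := mul_left_cancel₀ hne (by linear_combination α / 2 * d4 - β / 2 * d1)
      have z2 : a 2 0 = -(β * a 1 0 / α) := by
        field_simp
        linarith
      refine build (-(a 1 0 * α)) 0 (1 / α) (-(β / α ^ 2)) 0 (neg_ne_zero.2 (mul_ne_zero hne hα0)) z02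
        z12 (by rw [z0]; ring) ?_ ?_ (by rw [z3]; ring) (by ring) ?_ ?_ ?_ (by ring)
      · field_simp
      · rw [z2]; field_simp
      · field_simp; ring
      · field_simp; ring
      · field_simp; linarith

theorem isCenterPerturbation_of_hamiltonian (h1 : firstVector a b = 0) (hα : evenCoeff₀ a b = 0)
    (hβ : evenCoeff₁ a b = 0) : IsCenterPerturbation a b := by
  intro r hr0 hr
  refine eventually_numLimitCycles_eq_zero_of_integral (.of_forall fun ε => ?_) hr0 hr
  refine ⟨fun x y => eightLoop x y - ε * potential a b x y, fun _ _ => 1, fun _ _ _ _ _ => one_pos,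
    fun x y x' y' t hx hy _ _ _ => ?_⟩
  refine ((hasDerivAt_eightLoop hx hy).sub
    ((hasDerivAt_potential a b hx hy).const_mul ε)).congr_deriv ?_
  simp only [perturbedField, h1, hα, hβ, oddForm, Pi.zero_apply]
  ring

theorem isCenterPerturbation_of_reversible (h1 : firstVector a b = 0) (h : a 0 0 = 0 ∧ a 1 0 = 0 ∧
    a 2 0 = 0 ∧ a 3 0 = 0 ∧ a 0 2 = 0 ∧ a 1 2 = 0) : IsCenterPerturbation a b := by
  obtain ⟨a00, a10, a20, a30, a02, a12⟩ := h
  have c0 : a 1 0 + b 0 1 = 0 := congrFun h1 0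
  have c2 : 3 * a 3 0 + b 2 1 = 0 := congrFun h1 1
  have c3 : a 1 2 / 3 + b 0 3 = 0 := congrFun h1 2
  have c1 : 2 * a 2 0 + b 1 1 = 0 := congrFun h1 4
  have b01 : b 0 1 = 0 := by linarith
  have b11 : b 1 1 = 0 := by linarith
  have b21 : b 2 1 = 0 := by linarith
  have b03 : b 0 3 = 0 := by linarith
  intro r hr0 hr
  refine eventually_numLimitCycles_eq_zero_of_reversible (fun x y => ?_) (fun x y => ?_) hr0 hr
  · simp only [cubicPoly_eq, a00, a10, a20, a30, a02, a12]; ring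
  · simp only [cubicPoly_eq, b01, b11, b21, b03]; ring

/-- Either some Melnikov function does not vanish, or the perturbation preserves both centers. -/
theorem exists_melnikovVector_or_isCenterPerturbation (a b : ℕ → ℕ → ℝ) :
    (∃ v ≠ 0, HasMelnikovVector a b v ∧
      HasMelnikovVector (rotatedCoeff a) (rotatedCoeff b) (flipOdd v)) ∨
    (IsCenterPerturbation a b ∧ IsCenterPerturbation (rotatedCoeff a) (rotatedCoeff b)) := by
  by_cases h1 : firstVector a b = 0
  swap
  · refine .inl ⟨_, h1, hasMelnikovForm_first a b, ?_⟩
    rw [← firstVector_rotatedCoeff]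
    exact hasMelnikovForm_first _ _
  have h1' : firstVector (rotatedCoeff a) (rotatedCoeff b) = 0 := by
    rw [firstVector_rotatedCoeff, h1, flipOdd_zero]
  by_cases h2 : secondVector a b = 0
  swap
  · refine .inl ⟨_, h2, hasMelnikovForm_second h1, ?_⟩
    rw [← secondVector_rotatedCoeff]
    exact hasMelnikovForm_second h1'
  rcases hamiltonian_or_reversible_or_focusShape h1 h2 with
    ⟨hα, hβ⟩ | h | ⟨κ, L₀, L₁, L₂, L₃, hκ, h⟩
  · exact .inr ⟨isCenterPerturbation_of_hamiltonian h1 hα hβ,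
      isCenterPerturbation_of_hamiltonian h1' (by rw [evenCoeff₀_rotatedCoeff, hα, neg_zero])
        (by rw [evenCoeff₁_rotatedCoeff, hβ])⟩
  · refine .inr ⟨isCenterPerturbation_of_reversible h1 h, isCenterPerturbation_of_reversible h1' ?_⟩
    obtain ⟨a00, a10, a20, a30, a02, a12⟩ := h
    simp [rotatedCoeff, *]
  have hκ' : -κ ≠ 0 := neg_ne_zero.2 hκ
  by_cases h3 : thirdVector a b κ = 0
  swap
  · refine .inl ⟨_, h3, h.hasMelnikovForm, ?_⟩
    rw [← thirdVector_rotatedCoeff]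
    exact h.rotated.hasMelnikovForm
  have h3' : thirdVector (rotatedCoeff a) (rotatedCoeff b) (-κ) = 0 := by
    rw [thirdVector_rotatedCoeff, h3, flipOdd_zero]
  by_cases hα : evenCoeff₀ a b = 0
  · exact .inr ⟨h.isCenterPerturbation h3 hκ hα, h.rotated.isCenterPerturbation h3' hκ'
      (by rw [evenCoeff₀_rotatedCoeff, hα, neg_zero])⟩
  have hL₀ : L₀ = 0 := (mul_eq_zero.1 h.e₀).resolve_left hα
  refine .inl ⟨_, fourthVector_ne_zero h hL₀ hκ, h.hasMelnikovForm_fourth hL₀ h3 hκ, ?_⟩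
  rw [← fourthVector_neg]
  exact h.rotated.hasMelnikovForm_fourth hL₀ h3' hκ'

end Classification

/-! ### Realization of every vector, and prescription of zeros. -/

section Realization

/-- Fixing α = 2 and β = 1, the second vector is an invertible linear function of six coefficients
of f, because αβ ≠ 0 and α² ≠ β². Coefficients of g then cancel the first vector without affecting α
and β. -/
theorem exists_secondVector_eq (v : Fin 6 → ℝ) : ∃ a b : ℕ → ℕ → ℝ, firstVector a b = 0 ∧
    secondVector a b = v := by
  let a₁₂ := -3 / 2 * v 3
  let a₀₂ := -3 / 2 * v 5 - 2 * a₁₂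
  let a₃₀ := -3 / 2 * v 2 - 2 * a₀₂
  let s := (v 0 + v 1 - 2 * v 4) / 6
  let a₂₀ := -v 4 / 2 + v 0 / 4 - 2 * s
  let a₁₀ := s - a₃₀
  let a : ℕ → ℕ → ℝ := fun i j => match i, j with
    | 0, 0 => -v 0 / 4
    | 1, 0 => a₁₀
    | 2, 0 => a₂₀
    | 3, 0 => a₃₀
    | 0, 2 => a₀₂
    | 1, 2 => a₁₂
    | _, _ => 0
  let b : ℕ → ℕ → ℝ := fun i j => match i, j with
    | 0, 1 => -a₁₀
    | 1, 1 => -(2 * a₂₀)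
    | 2, 1 => -(3 * a₃₀)
    | 0, 3 => -(a₁₂ / 3)
    | 0, 2 => 2
    | 1, 2 => 1
    | _, _ => 0
  have h0 : evenCoeff₀ a b = 2 := by norm_num [evenCoeff₀, a, b]
  have h1 : evenCoeff₁ a b = 1 := by norm_num [evenCoeff₁, a, b]
  refine ⟨a, b, ?_, ?_⟩
  · ext i
    fin_cases i <;> simp [firstVector, a, b]
  · ext i
    fin_cases i <;> simp [secondVector, h0, h1] <;> simp [a, a₁₂, a₀₂, a₃₀, s, a₂₀, a₁₀] <;> ring

theorem exists_hasMelnikovVector (v : Fin 6 → ℝ) : ∃ a b : ℕ → ℕ → ℝ, HasMelnikovVector a b v ∧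
    HasMelnikovVector (rotatedCoeff a) (rotatedCoeff b) (flipOdd v) := by
  obtain ⟨a, b, h1, h2⟩ := exists_secondVector_eq v
  refine ⟨a, b, h2 ▸ hasMelnikovForm_second h1, ?_⟩
  rw [← h2, ← secondVector_rotatedCoeff]
  exact hasMelnikovForm_second (by rw [firstVector_rotatedCoeff, h1, flipOdd_zero])

/-- The rotation by half a turn, as a linear map. -/
def flipOddL : (Fin 6 → ℝ) →ₗ[ℝ] (Fin 6 → ℝ) where
  toFun := flipOdd
  map_add' v w := by ext i; fin_cases i <;> simp [flipOdd] <;> ring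
  map_smul' c v := by ext i; fin_cases i <;> simp [flipOdd]

/-- The value of the cycle integral at `ρ`, as a linear functional. -/
noncomputable def cycleIntegralAt (ρ : ℝ) : (Fin 6 → ℝ) →ₗ[ℝ] ℝ :=
  (LinearMap.proj ρ : (ℝ → ℝ) →ₗ[ℝ] ℝ) ∘ₗ cycleIntegralL

/-- Fewer than six linear conditions on ℝ⁶ have a nonzero common solution. -/
theorem exists_ne_zero_of_add_lt {m n : ℕ} (h : m + n < 6) (s : ℕ → ℝ) : ∃ v : Fin 6 → ℝ, v ≠ 0 ∧
    (∀ i < m, cycleIntegral v (s i) = 0) ∧ ∀ i < n, cycleIntegral (flipOdd v) (s i) = 0 := by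
  let T : (Fin 6 → ℝ) →ₗ[ℝ] (Fin m → ℝ) × (Fin n → ℝ) :=
    (LinearMap.pi fun i : Fin m => cycleIntegralAt (s i)).prod
      ((LinearMap.pi fun i : Fin n => cycleIntegralAt (s i)) ∘ₗ flipOddL)
  have hker : LinearMap.ker T ≠ ⊥ := LinearMap.ker_ne_bot_of_finrank_lt (by simpa using h)
  obtain ⟨v, hv, hv0⟩ := (Submodule.ne_bot_iff _).1 hker
  have hT : T v = 0 := hv
  exact ⟨v, hv0, fun i hi => congrFun (congrArg Prod.fst hT) ⟨i, hi⟩,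
    fun i hi => congrFun (congrArg Prod.snd hT) ⟨i, hi⟩⟩

/-- Six zeros would be too many conditions in general. With v 4 = v 5 = 0 both centers have the same
integral, and only five conditions remain. -/
theorem exists_ne_zero_of_even (s : ℕ → ℝ) : ∃ v : Fin 6 → ℝ, v ≠ 0 ∧
    (∀ i < 3, cycleIntegral v (s i) = 0) ∧ ∀ i < 3, cycleIntegral (flipOdd v) (s i) = 0 := by
  let T : (Fin 6 → ℝ) →ₗ[ℝ] (Fin 3 → ℝ) × ℝ × ℝ :=
    (LinearMap.pi fun i : Fin 3 => cycleIntegralAt (s i)).prod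
      ((LinearMap.proj 4).prod (LinearMap.proj 5))
  have hker : LinearMap.ker T ≠ ⊥ := LinearMap.ker_ne_bot_of_finrank_lt (by simp)
  obtain ⟨v, hv, hv0⟩ := (Submodule.ne_bot_iff _).1 hker
  have hT : T v = 0 := hv
  have h4 : v 4 = 0 := congrArg (fun p => p.2.1) hT
  have h5 : v 5 = 0 := congrArg (fun p => p.2.2) hT
  have hflip : flipOdd v = v := by
    ext i
    fin_cases i <;> simp [flipOdd, h4, h5]
  have h : ∀ i < 3, cycleIntegral v (s i) = 0 := fun i hi => congrFun (congrArg Prod.fst hT) ⟨i, hi⟩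
  exact ⟨v, hv0, h, by rwa [hflip]⟩

theorem exists_ne_zero_of_mem {d : ℕ × ℕ} (hd : d ∈ maximalDistributions) (s : ℕ → ℝ) :
    ∃ v : Fin 6 → ℝ, v ≠ 0 ∧ (∀ i < d.1, cycleIntegral v (s i) = 0) ∧
      ∀ i < d.2, cycleIntegral (flipOdd v) (s i) = 0 := by
  have h : d.1 + d.2 < 6 ∨ d = (3, 3) := by revert d; decide
  rcases h with h | rfl
  · exact exists_ne_zero_of_add_lt h s
  · exact exists_ne_zero_of_even s

theorem le_of_zeros {v : Fin 6 → ℝ} {R h : ℝ} {m j : ℕ} (hh : 0 < h) (hR : m * h ≤ R)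
    (hj : ∀ ρ ∈ Set.Icc (-R) R, iteratedDeriv (2 * j + 2) (cycleIntegral v) ρ ≠ 0)
    (hz : ∀ i < m, cycleIntegral v ((i + 1) * h) = 0) : m ≤ j := by
  have hinj : Function.Injective fun i : ℕ => ((i : ℝ) + 1) * h := fun i k hik => by
    have := mul_right_cancel₀ hh.ne' hik
    exact_mod_cast add_right_cancel this
  rw [← Finset.card_range m, ← Finset.card_image_of_injective _ hinj]
  refine card_pos_zeros_le (contDiff_cycleIntegral v) (cycleIntegral_neg v) (cycleIntegral_zero v)
    (le_trans (by positivity) hR) hj _ fun x hx => ?_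
  obtain ⟨i, hi, rfl⟩ := Finset.mem_image.1 hx
  rw [Finset.mem_range] at hi
  refine ⟨by positivity, le_trans ?_ hR, hz i hi⟩
  exact mul_le_mul_of_nonneg_right (by exact_mod_cast hi) hh.le

/-- The integral has as many positive zeros as its order permits, so it changes sign at each of
them. The midpoints (i + 1/2)h serve as test radii, and the lower bound meets the upper one. -/
theorem HasMelnikovVector.eventually_numLimitCycles_eq {a b : ℕ → ℕ → ℝ} {v : Fin 6 → ℝ}
    (hv : HasMelnikovVector a b v) {R : ℝ} (hR : R ≤ 1 / 8) {m : ℕ}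
    (hm : ∀ ρ ∈ Set.Icc (-R) R, iteratedDeriv (2 * m + 2) (cycleIntegral v) ρ ≠ 0) {h r : ℝ}
    (hh : 0 < h) (hmh : (m + 1) * h < r) (hr : 8 * r ≤ R)
    (hz : ∀ i < m, cycleIntegral v ((i + 1) * h) = 0) :
    ∀ᶠ ε in 𝓝[≠] (0 : ℝ), numLimitCycles (perturbedField a b ε) (1, 0) r = m := by
  have hr0 : 0 < r := lt_trans (by positivity) hmh
  have hle : (m + 1 / 2) * h ≤ (m + 1) * h := mul_le_mul_of_nonneg_right (by linarith) hh.le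
  have hmono : StrictMono fun i : ℕ => ((i : ℝ) + 1 / 2) * h := fun i k hik =>
    mul_lt_mul_of_pos_right (by simpa using hik) hh
  filter_upwards [hv.eventually_numLimitCycles_le hR hm hr0 hr,
    hv.eventually_le_numLimitCycles hR hm (m := m) (s := fun i => ((i : ℝ) + 1 / 2) * h) (r := r)
      (by simpa using hh) hmono (by show (m + 1 / 2) * h < R; linarith) (by linarith)
      (by show (m + 1 / 2) * h < r; linarith) fun i hi =>
        sign_change_of_zeros (contDiff_cycleIntegral v) (cycleIntegral_neg v)
          (cycleIntegral_zero v) hh (by linarith) hm hz hi] with ε h1 h2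
  exact le_antisymm h1 h2

end Realization

/-! ### Assembly of the two halves. -/

theorem theorem4 :
    (∀ d ∈ maximalDistributions, SmallAmplitudeDistribution d.1 d.2) ∧
    (∃ r : ℝ, 0 < r ∧ ∀ a b : ℕ → ℕ → ℝ, ∀ᶠ ε in 𝓝[≠] (0 : ℝ),
      ∃ d ∈ maximalDistributions,
        numLimitCycles (perturbedField a b ε) (1, 0) r ≤ (d.1 : ℕ∞) ∧
        numLimitCycles (perturbedField a b ε) (-1, 0) r ≤ (d.2 : ℕ∞)) := by
  obtain ⟨R, hR0, hR8, hR⟩ := exists_uniform_radius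
  refine ⟨fun d hd => ?_, min (R / 8) (1 / 64), by positivity, fun a b => ?_⟩
  · filter_upwards [self_mem_nhdsWithin,
      (gt_mem_nhds (show 0 < R / 8 by positivity)).filter_mono nhdsWithin_le_nhds] with r hr0 hr
    rw [Set.mem_Ioi] at hr0
    -- At most five zeros are prescribed at each center; spacing r/7 leaves room for a sixth grid
    -- point below r, as the sign-change argument needs.
    obtain ⟨v, hv0, hz1, hz2⟩ := exists_ne_zero_of_mem hd fun i => ((i : ℝ) + 1) * (r / 7)
    obtain ⟨d', hd', i, j, hi, hj, hij⟩ := hR v hv0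
    have hbound : ∀ d ∈ maximalDistributions, d.1 ≤ 5 ∧ d.2 ≤ 5 := by decide
    have h5 : ∀ n : ℕ, n ≤ 5 → ((n : ℝ) + 1) * (r / 7) < r := fun n hn => by
      have : (n : ℝ) ≤ 5 := by exact_mod_cast hn
      nlinarith
    have hr7 : 0 < r / 7 := by positivity
    have k1 := h5 _ (hbound d hd).1
    have k2 := h5 _ (hbound d hd).2
    have le1 : d.1 ≤ i := le_of_zeros hr7 (by linarith) (fun ρ hρ => (hij ρ hρ).1) hz1
    have le2 : d.2 ≤ j := le_of_zeros hr7 (by linarith) (fun ρ hρ => (hij ρ hρ).2) hz2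
    have hmax : ∀ d ∈ maximalDistributions, ∀ d' ∈ maximalDistributions,
        d.1 ≤ d'.1 → d.2 ≤ d'.2 → d = d' := by decide
    -- The prescribed zeros bound the orders from below by d, the uniform radius bounds them above
    -- by d'. Since the list is an antichain, d = d' and the orders are exactly d.
    obtain rfl := hmax d hd d' hd' (le1.trans hi) (le2.trans hj)
    obtain rfl := le_antisymm le1 hi
    obtain rfl := le_antisymm le2 hj
    obtain ⟨a, b, h1, h2⟩ := exists_hasMelnikovVector v
    refine ⟨a, b, ?_⟩
    filter_upwards [h1.eventually_numLimitCycles_eq hR8 (fun ρ hρ => (hij ρ hρ).1) hr7 k1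
        (by linarith) hz1,
      h2.eventually_numLimitCycles_eq hR8 (fun ρ hρ => (hij ρ hρ).2) hr7 k2
        (by linarith) hz2] with ε e1 e2
    exact ⟨e1, by rw [numLimitCycles_neg, e2]⟩
  · have hr0 : 0 < min (R / 8) (1 / 64) := by positivity
    have hr1 := min_le_left (R / 8) (1 / 64)
    have hr2 := min_le_right (R / 8) (1 / 64)
    rcases exists_melnikovVector_or_isCenterPerturbation a b with ⟨v, hv, h1, h2⟩ | ⟨h1, h2⟩
    · obtain ⟨d, hd, i, j, hi, hj, hij⟩ := hR v hv
      filter_upwards [h1.eventually_numLimitCycles_le hR8 (fun ρ hρ => (hij ρ hρ).1) hr0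
          (by linarith),
        h2.eventually_numLimitCycles_le hR8 (fun ρ hρ => (hij ρ hρ).2) hr0
          (by linarith)] with ε e1 e2
      refine ⟨d, hd, e1.trans (by exact_mod_cast hi), ?_⟩
      rw [numLimitCycles_neg]
      exact e2.trans (by exact_mod_cast hj)
    · filter_upwards [(h1 _ hr0 hr2).filter_mono nhdsWithin_le_nhds,
        (h2 _ hr0 hr2).filter_mono nhdsWithin_le_nhds] with ε e1 e2
      -- With no limit cycles at either center, any member of the list would do.
      refine ⟨(5, 0), by decide, ?_, ?_⟩
      · rw [e1]; exact zero_le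
      · rw [numLimitCycles_neg, e2]; exact zero_le
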